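/- **Proposition 4.6 (bending the Bianchi groups into $\mathrm U(3,1)$).** Let $d\ge 1$ be a squarefree integer, $d\ne 1,3$, let $\mathcal O_d$ be the ring of integers of $\mathbb Q(i\sqrt d)$, and let $\tau=\frac{1+i\sqrt d}{2}$ if $d\equiv 3 \pmod 4$, $\tau=i\sqrt d$ otherwise. Let $\mathrm{Bi}(d)=\mathrm{PSL}(2,\mathcal O_d)$, with the elements $$a=\begin{pmatrix}0&-1\\1&0\end{pmatrix},\quad t=\begin{pmatrix}1&1\\0&1\end{pmatrix},\quad \mathbf u=\begin{pmatrix}1&\tau\\0&1\end{pmatrix}.$$ Let $\mathrm U(3,1)\subset \mathrm{GL}(4,\mathbb C)$ be the unitary group of the Hermitian form $2\,\mathrm{Re}(z_1\bar z_4)+|z_2|^2+|z_3|^2$; it acts by isometries on complex hyperbolic space $\mathrm H^3_{\mathbb C}$. Let $\rho_1:\mathrm{Bi}(d)\to \mathrm{SO}(3,1)\subset \mathrm U(3,1)$ be the lattice embedding given by the action $X\mapsto gXg^*$ on Hermitian $2\times 2$ matrices, in the coordinates $X=\begin{pmatrix}x&(-y+iz)/\sqrt2\\(-y-iz)/\sqrt2&-t\end{pmatrix}$.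 Put $Z_3(u)=\mathrm{Diag}(1,1,u,1)$ and $$A_1=\begin{pmatrix}0&0&0&-1\\0&-1&0&0\\0&0&1&0\\-1&0&0&0\end{pmatrix},\qquad T_1=\begin{pmatrix}1&-\sqrt2&0&-1\\0&1&0&\sqrt2\\0&0&1&0\\0&0&0&1\end{pmatrix},$$ $$U_u=\begin{pmatrix}1&0&\sqrt{2d}&-d\\0&1&0&0\\0&0&u&-u\sqrt{2d}\\0&0&0&1\end{pmatrix}\ (d\equiv 1,2 \bmod 4),\qquad U_u=\begin{pmatrix}1&-\frac{\sqrt2}2&\frac{\sqrt{2d}}2&-\frac{d+1}4\\0&1&0&\frac{\sqrt2}2\\0&0&u&-u\frac{\sqrt{2d}}2\\0&0&0&1\end{pmatrix}\ (d\equiv 3 \bmod 4),$$ so that $\rho_1(a)=A_1$, $\rho_1(t)=T_1$, $\rho_1(\mathbf u)=U_1$ and $U_u=Z_3(u)U_1$. Let $P\subset \mathrm H^3_{\mathbb R}$ be the hyperbolic plane preserved by $\mathrm{PSL}(2,\mathbb Z)$ (the vertical half-plane over $\mathbb R$ in the upper half-space), and let $\Gamma'\subset \mathrm{Bi}(d)$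 be the stabilizer of the connected component of $\mathrm H^3_{\mathbb R}\setminus \bigcup_{\gamma\in\mathrm{Bi}(d)}\gamma P$ that contains the point $-\tau/2+j$ (it is the component adjacent to both $P$ and $\mathbf u^{-1}P$). For $|u|=1$, a *bending deformation with parameter $u$* (of $\rho_1$, along the modular surface) is a homomorphism $\rho_u:\mathrm{Bi}(d)\to \mathrm U(3,1)$ with $\rho_u|_{\Gamma'}=\rho_1|_{\Gamma'}$ and $\rho_u(\mathbf u)=Z_3(u)\rho_1(\mathbf u)$. An element of $\mathrm U(3,1)$ is *parabolic* if it has no fixed point in $\mathrm H^3_{\mathbb C}$ and exactly one on $\partial_\infty\mathrm H^3_{\mathbb C}$, and *boundary elliptic* if it acts nontrivially and has fixed points both in $\mathrm H^3_{\mathbb C}$ and on $\partial_\infty\mathrm H^3_{\mathbb C}$. The representation $\rho_u$ is *parabolic-preserving* if $\rho_u(\gamma)$ is parabolic (resp. boundary elliptic) whenever $\rho_1(\gamma)$ is. It is *strongly parabolic-preserving* if moreover $\rho_u(\Lambda)$ is discrete whenever $\Lambda$ is the stabilizer in $\mathrm{Bi}(d)$ (acting through $\rho_1$) of a boundary point that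 is fixed by some parabolic $\rho_1(\gamma)$. Then: 1. For every $u\in\mathrm U(1)$ there is exactly one bending deformation $\rho_u:\mathrm{Bi}(d)\to\mathrm U(3,1)$ with parameter $u$. It satisfies $\rho_u(a)=A_1$, $\rho_u(t)=T_1$, $\rho_u(\mathbf u)=U_u$, and $\mathrm{Tr}\,U_u=3+u$. If $d\in\{2,7,11\}$, it is the only homomorphism $\mathrm{Bi}(d)\to \mathrm U(3,1)$ with these values on $a,t,\mathbf u$. 2. If $u\ne u'$ in $\mathrm U(1)$, then $\rho_u$ and $\rho_{u'}$ are not conjugate, not even in $\mathrm{GL}(4,\mathbb C)$. 3. For every $u\in\mathrm U(1)$ with $u\ne -1$, $\rho_u$ is parabolic-preserving. 4. If $d\equiv 1$ or $2 \pmod 4$, then for every $u\in\mathrm U(1)$ with $u\neq -1$, $\rho_u$ is strongly parabolic-preserving. 5. For every $u\in\mathrm U(1)$ with $u\ne\pm1$, the image $\rho_u(\mathrm{Bi}(d))$ is contained in no proper connected Lie subgroup of $\mathrm U(3,1)$. Its Zariski closure in the real algebraic group $\mathrm U(3,1)$ contains $\mathrm{SU}(3,1)$, so that its image in $\mathrm{PU}(3,1)$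 is Zariski-dense; and it is Zariski-dense in $\mathrm U(3,1)$ itself if $u$ is not a root of unity. -/

import Mathlib

open scoped MatrixGroups LinearAlgebra.Projectivization ComplexOrder

noncomputable section

namespace BianchiBending

/-! ### The group `U(3,1)` and complex hyperbolic 3-space (Siegel model) -/

/-- The matrix of the Siegel Hermitian form `2 Re(z₁ z̄₄) + |z₂|² + |z₃|²`. -/
def siegelJ : Matrix (Fin 4) (Fin 4) ℂ :=
  !![0, 0, 0, 1; 0, 1, 0, 0; 0, 0, 1, 0; 1, 0, 0, 0]

/-- `U(3,1)`, the subgroup of `GL(4,ℂ)` preserving the Siegel Hermitian form. -/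
def U31 : Subgroup (GL (Fin 4) ℂ) where
  carrier := {g | g.val.conjTranspose * siegelJ * g.val = siegelJ}
  one_mem' := by simp
  mul_mem' := by
    intro a b ha hb
    simp only [Set.mem_ofPred_eq, Units.val_mul, Matrix.conjTranspose_mul] at *
    calc _ = b.val.conjTranspose * (a.val.conjTranspose * siegelJ * a.val) * b.val := by
          simp only [Matrix.mul_assoc]
      _ = siegelJ := by rw [ha, hb]
  inv_mem' := by
    intro a ha
    simp only [Set.mem_ofPred_eq] at *
    have h1 : a.val * (a⁻¹).val = 1 := by simp
    have h2 : (a⁻¹).val.conjTranspose * a.val.conjTranspose = 1 := by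
      rw [← Matrix.conjTranspose_mul, h1, Matrix.conjTranspose_one]
    calc _ = (a⁻¹).val.conjTranspose * (a.val.conjTranspose * siegelJ * a.val) * (a⁻¹).val := by
          rw [ha]
      _ = ((a⁻¹).val.conjTranspose * a.val.conjTranspose) * siegelJ * (a.val * (a⁻¹).val) := by
          simp only [Matrix.mul_assoc]
      _ = siegelJ := by rw [h1, h2]; simp

/-- The underlying matrix of an element of `U(3,1)`. -/
def toMat (g : U31) : Matrix (Fin 4) (Fin 4) ℂ := g.val.val

/-- The value `⟨v, v⟩` of the Siegel Hermitian form (a real number). -/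
def normForm (v : Fin 4 → ℂ) : ℝ := (star v ⬝ᵥ (siegelJ.mulVec v)).re

/-- Complex hyperbolic 3-space: the negative lines in `ℂ^{3,1}`. -/
def HC3 : Set (ℙ ℂ (Fin 4 → ℂ)) := {p | normForm p.rep < 0}

/-- The boundary at infinity of complex hyperbolic 3-space: the null lines in `ℂ^{3,1}`. -/
def boundaryHC3 : Set (ℙ ℂ (Fin 4 → ℂ)) := {p | normForm p.rep = 0}

/-- The projective point `p` is fixed by (the class in `PU(3,1)` of) `g`. -/
def Fixes (g : U31) (p : ℙ ℂ (Fin 4 → ℂ)) : Prop :=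
  g.val • p = p

/-- The isometry of complex hyperbolic 3-space given by `g` is parabolic: no fixed point inside,
exactly one on the boundary. -/
def IsParabolic (g : U31) : Prop :=
  (∀ p ∈ HC3, ¬ Fixes g p) ∧ ∃! p, p ∈ boundaryHC3 ∧ Fixes g p

/-- The isometry given by `g` is elliptic: it is not the identity and it has a fixed point inside
complex hyperbolic space. -/
def IsElliptic (g : U31) : Prop :=
  (∃ p ∈ HC3, ¬ Fixes g p) ∧ ∃ p ∈ HC3, Fixes g p

/-- Boundary elliptic: elliptic, with a fixed point on the boundary at infinity. -/
def IsBoundaryElliptic (g : U31) : Prop :=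
  IsElliptic g ∧ ∃ p ∈ boundaryHC3, Fixes g p

section ParabolicPreserving

variable {Γ : Type*} [Group Γ]

/-- Parabolic-preserving: `Γ` is regarded as a group of isometries of complex hyperbolic space
through `ι`, and `ρ` is another representation of `Γ`. -/
def IsParabolicPreserving (ι ρ : Γ →* U31) : Prop :=
  (∀ γ, IsParabolic (ι γ) → IsParabolic (ρ γ)) ∧
    ∀ γ, IsBoundaryElliptic (ι γ) → IsBoundaryElliptic (ρ γ)

/-- The stabilizer in `Γ` (acting through `ι`) of a projective point. -/
def pointStab (ι : Γ →* U31) (p : ℙ ℂ (Fin 4 → ℂ)) : Subgroup Γ :=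
  (MulAction.stabilizer (GL (Fin 4) ℂ) p).comap (U31.subtype.comp ι)

/-- The parabolic subgroups of `Γ` (acting through `ι`): the stabilizers in `Γ` of the boundary
points that are fixed by some parabolic element of `Γ`. -/
def IsParabolicSubgroup (ι : Γ →* U31) (P : Subgroup Γ) : Prop :=
  ∃ p ∈ boundaryHC3, (∃ γ, IsParabolic (ι γ) ∧ Fixes (ι γ) p) ∧ P = pointStab ι p

/-- Strongly parabolic-preserving: parabolic-preserving, and the image of every parabolic subgroup
is discrete. -/
def IsStronglyParabolicPreserving (ι ρ : Γ →* U31) : Prop :=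
  IsParabolicPreserving ι ρ ∧
    ∀ P : Subgroup Γ, IsParabolicSubgroup ι P → DiscreteTopology (P.map ρ)

end ParabolicPreserving

/-! ### The Bianchi groups -/

/-- The imaginary quadratic field `ℚ(i√d)` inside `ℂ`. -/
def quadField (d : ℕ) : IntermediateField ℚ ℂ :=
  IntermediateField.adjoin ℚ {Complex.I * (Real.sqrt d : ℂ)}

/-- `𝒪_d`, the ring of integers of `ℚ(i√d)`, as a subring of `ℂ`. -/
def ringO (d : ℕ) : Subring ℂ :=
  (integralClosure ℤ ℂ).toSubring ⊓ (quadField d).toSubfield.toSubring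

/-- The standard generator `τ` of `𝒪_d` (for squarefree `d`). -/
def tau (d : ℕ) : ℂ :=
  if d % 4 = 3 then (1 + Complex.I * (Real.sqrt d : ℂ)) / 2 else Complex.I * (Real.sqrt d : ℂ)

theorem sqrt_sq (d : ℕ) : (Complex.I * (Real.sqrt d : ℂ)) ^ 2 = -(d : ℂ) := by
  rw [mul_pow, Complex.I_sq, ← Complex.ofReal_pow, Real.sq_sqrt (Nat.cast_nonneg d)]
  simp

theorem tau_mem (d : ℕ) : tau d ∈ ringO d := by
  refine Subring.mem_inf.2 ⟨?_, ?_⟩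
  · change IsIntegral ℤ (tau d)
    unfold tau
    have hs := sqrt_sq d
    split_ifs with h
    · obtain ⟨k, hk⟩ : ∃ k : ℕ, d + 1 = 4 * k := ⟨(d + 1) / 4, by omega⟩
      refine ⟨Polynomial.X ^ 2 + (-Polynomial.X + Polynomial.C (k : ℤ)), ?_, ?_⟩
      · apply Polynomial.monic_X_pow_add
        compute_degree!
      · have hk' : (d : ℂ) + 1 = 4 * k := by exact_mod_cast hk
        simp
        linear_combination (1 / 4 : ℂ) * hs - (1 / 4 : ℂ) * hk'
    · refine ⟨Polynomial.X ^ 2 + Polynomial.C (d : ℤ), ?_, ?_⟩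
      · apply Polynomial.monic_X_pow_add
        compute_degree!
      · simp only [Polynomial.eval₂_add, Polynomial.eval₂_pow, Polynomial.eval₂_X, hs]
        simp
  · change tau d ∈ quadField d
    have hs : Complex.I * (Real.sqrt d : ℂ) ∈ quadField d :=
      IntermediateField.mem_adjoin_simple_self ℚ _
    unfold tau
    split_ifs with h
    · exact div_mem (add_mem (one_mem _) hs) (by exact_mod_cast (quadField d).natCast_mem 2)
    · exact hs

/-- `τ` as an element of `𝒪_d`. -/
def tauO (d : ℕ) : ringO d := ⟨tau d, tau_mem d⟩

/-- The Bianchi group `Bi(d) = PSL(2, 𝒪_d)`. -/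
abbrev Bi (d : ℕ) : Type := Matrix.ProjectiveSpecialLinearGroup (Fin 2) (ringO d)

/-- The class in `Bi(d)` of a matrix in `SL(2, 𝒪_d)`. -/
def toBi (d : ℕ) : SL(2, ringO d) →* Bi d := QuotientGroup.mk' _

/-- The generator `a`. -/
def aElt (d : ℕ) : Bi d := toBi d ⟨!![0, -1; 1, 0], by simp [Matrix.det_fin_two]⟩

/-- The generator `t`. -/
def tElt (d : ℕ) : Bi d := toBi d ⟨!![1, 1; 0, 1], by simp [Matrix.det_fin_two]⟩

/-- The generator `u` (translation by `τ`). -/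
def uElt (d : ℕ) : Bi d := toBi d ⟨!![1, tauO d; 0, 1], by simp [Matrix.det_fin_two]⟩

/-! ### The lattice embedding of `Bi(d)` into `SO(3,1) ⊂ U(3,1)` -/

/-- `g ∈ SL(2,ℂ)` acting on complex `2 × 2` matrices by `X ↦ g X g*`. -/
def hermAct : SL(2, ℂ) →* Module.End ℂ (Matrix (Fin 2) (Fin 2) ℂ) where
  toFun g :=
    { toFun := fun X => g.val * X * g.val.conjTranspose
      map_add' := fun X Y => by rw [Matrix.mul_add, Matrix.add_mul]
      map_smul' := fun c X => by simp }
  map_one' := by ext1 X; simp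
  map_mul' g h := by
    apply LinearMap.ext
    intro X
    simp [Matrix.mul_assoc, Matrix.conjTranspose_mul]

/-- Linear coordinates `(x,y,z,t)` on `2 × 2` matrices. The real points of `ℂ⁴` are the Hermitian
matrices, and `-2 det` becomes the quadratic form `2xt + y² + z²`. -/
def hermCoord : (Fin 4 → ℂ) ≃ₗ[ℂ] Matrix (Fin 2) (Fin 2) ℂ where
  toFun v := !![v 0, (-v 1 + Complex.I * v 2) / (Real.sqrt 2 : ℂ);
    (-v 1 - Complex.I * v 2) / (Real.sqrt 2 : ℂ), -v 3]
  invFun X := ![X 0 0, -(X 0 1 + X 1 0) / (Real.sqrt 2 : ℂ),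
    -Complex.I * (X 0 1 - X 1 0) / (Real.sqrt 2 : ℂ), -X 1 1]
  map_add' v w := by
    ext i j; fin_cases i <;> fin_cases j <;> simp <;> ring
  map_smul' c v := by
    ext i j; fin_cases i <;> fin_cases j <;> simp <;> ring
  left_inv v := by
    have h2 : (Real.sqrt 2 : ℂ) ^ 2 = 2 := by
      rw [← Complex.ofReal_pow, Real.sq_sqrt (by norm_num)]; norm_num
    have h0 : (Real.sqrt 2 : ℂ) ≠ 0 := fun h => by simp [h] at h2
    ext i
    fin_cases i
    · simp
    · simp only [Matrix.of_apply, Matrix.cons_val', Matrix.cons_val_zero, Matrix.cons_val_one,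
        Matrix.cons_val_fin_one, Fin.mk_one]
      field_simp
      rw [h2]; ring
    · simp
      field_simp
      rw [h2]; linear_combination (-2 * v 2) * Complex.I_sq
    · simp
  right_inv X := by
    have h2 : (Real.sqrt 2 : ℂ) ^ 2 = 2 := by
      rw [← Complex.ofReal_pow, Real.sq_sqrt (by norm_num)]; norm_num
    have h0 : (Real.sqrt 2 : ℂ) ≠ 0 := fun h => by simp [h] at h2
    ext i j
    fin_cases i <;> fin_cases j
    · simp
    · simp
      field_simp
      rw [h2]; linear_combination (-(X 0 1 - X 1 0)) * Complex.I_sq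
    · simp
      field_simp
      rw [h2]; linear_combination (X 0 1 - X 1 0) * Complex.I_sq
    · simp

/-- The matrix of `X ↦ g X g*` in the coordinates `(x,y,z,t)`: the spin homomorphism. -/
def spinGL : SL(2, ℂ) →* GL (Fin 4) ℂ :=
  (((LinearMap.toMatrixAlgEquiv' (R := ℂ) (n := Fin 4)).toAlgHom.comp
    (hermCoord.symm.conjAlgEquiv ℂ).toAlgHom).toRingHom.toMonoidHom.comp hermAct).toHomUnits

theorem spinGL_mulVec (g : SL(2, ℂ)) (v : Fin 4 → ℂ) :
    hermCoord ((spinGL g).val.mulVec v) = g.val * hermCoord v * g.val.conjTranspose := by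
  have : (spinGL g).val.mulVec v = hermCoord.symm (hermAct g (hermCoord v)) := by
    change (LinearMap.toMatrixAlgEquiv' _).mulVec v = _
    rw [← Matrix.toLinAlgEquiv'_apply]
    simp
  rw [this, LinearEquiv.apply_symm_apply]
  rfl

theorem form_eq_trace (v w : Fin 4 → ℂ) :
    star w ⬝ᵥ (siegelJ.mulVec v) =
      -(hermCoord v * (hermCoord w).conjTranspose.adjugate).trace := by
  have h2 : (Real.sqrt 2 : ℂ) ^ 2 = 2 := by
    rw [← Complex.ofReal_pow, Real.sq_sqrt (by norm_num)]; norm_num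
  have h0 : (Real.sqrt 2 : ℂ) ≠ 0 := fun h => by simp [h] at h2
  simp [hermCoord, siegelJ, Matrix.adjugate_fin_two, Matrix.trace_fin_two, dotProduct,
    Fin.sum_univ_four, Matrix.mulVec, Complex.conj_ofReal]
  field_simp
  rw [h2]
  linear_combination (2 * v 2 * (starRingEnd ℂ) (w 2)) * Complex.I_sq

theorem spinGL_mem (g : SL(2, ℂ)) : spinGL g ∈ U31 := by
  change (spinGL g).val.conjTranspose * siegelJ * (spinGL g).val = siegelJ
  have key : ∀ v w : Fin 4 → ℂ,
      star w ⬝ᵥ (((spinGL g).val.conjTranspose * siegelJ * (spinGL g).val).mulVec v) =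
        star w ⬝ᵥ (siegelJ.mulVec v) := by
    intro v w
    have hl : star w ⬝ᵥ (((spinGL g).val.conjTranspose * siegelJ * (spinGL g).val).mulVec v) =
        star ((spinGL g).val.mulVec w) ⬝ᵥ (siegelJ.mulVec ((spinGL g).val.mulVec v)) := by
      rw [Matrix.star_mulVec, ← Matrix.dotProduct_mulVec, Matrix.mulVec_mulVec,
        Matrix.mulVec_mulVec, Matrix.mul_assoc]
    rw [hl, form_eq_trace, form_eq_trace, spinGL_mulVec, spinGL_mulVec]
    have hd : g.val.det = 1 := g.prop
    have hd' : g.val.conjTranspose.det = 1 := by simp [Matrix.det_conjTranspose, hd]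
    simp only [Matrix.conjTranspose_mul, Matrix.conjTranspose_conjTranspose,
      Matrix.adjugate_mul_distrib]
    congr 1
    calc _ = (g.val * hermCoord v * (g.val.conjTranspose * g.val.conjTranspose.adjugate) *
            (hermCoord w).conjTranspose.adjugate * g.val.adjugate).trace := by
          simp only [Matrix.mul_assoc]
      _ = (g.val * (hermCoord v * (hermCoord w).conjTranspose.adjugate) *
            g.val.adjugate).trace := by
          rw [Matrix.mul_adjugate, hd']; simp only [one_smul, Matrix.mul_one, Matrix.mul_assoc]
      _ = _ := by
          rw [Matrix.trace_mul_comm, ← Matrix.mul_assoc, Matrix.adjugate_mul, hd]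
          simp
  ext i j
  have := key (Pi.single j 1) (Pi.single i 1)
  simpa [Pi.star_single] using this

/-- The spin homomorphism `SL(2,ℂ) → SO(3,1) ⊂ U(3,1)`. -/
def spinU : SL(2, ℂ) →* U31 := spinGL.codRestrict U31 spinGL_mem

/-- The inclusion `SL(2, 𝒪_d) → SL(2,ℂ)`. -/
def toSLC (d : ℕ) : SL(2, ringO d) →* SL(2, ℂ) :=
  Matrix.SpecialLinearGroup.map (ringO d).subtype

theorem spinU_center (d : ℕ) :
    Subgroup.center SL(2, ringO d) ≤ (spinU.comp (toSLC d)).ker := by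
  intro g hg
  obtain ⟨r, hr, hg⟩ := Matrix.SpecialLinearGroup.mem_center_iff.1 hg
  have hr' : (r : ℂ) ^ 2 = 1 := by
    have := congrArg (fun x : ringO d => (x : ℂ)) hr
    simpa using this
  have hval : (toSLC d g).val = (r : ℂ) • (1 : Matrix (Fin 2) (Fin 2) ℂ) := by
    ext i j
    have : (toSLC d g).val i j = ((g.val i j : ringO d) : ℂ) := rfl
    rw [this, ← hg]
    fin_cases i <;> fin_cases j <;> simp
  have hrr : (r : ℂ) * (starRingEnd ℂ) (r : ℂ) = 1 := by
    rcases (sq_eq_one_iff.1 hr') with h | h <;> simp [h]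
  rw [MonoidHom.mem_ker]
  apply Subtype.ext
  apply Units.ext
  change (spinGL (toSLC d g)).val = 1
  apply Matrix.toLin'.injective
  apply LinearMap.ext
  intro v
  apply hermCoord.injective
  rw [Matrix.toLin'_apply, spinGL_mulVec, hval]
  simp [smul_smul]
  rw [mul_comm, hrr, one_smul]

/-- The lattice embedding `ρ₁ : Bi(d) → SO(3,1) ⊂ U(3,1)`. -/
def rho1 (d : ℕ) : Bi d →* U31 :=
  QuotientGroup.lift _ (spinU.comp (toSLC d)) (spinU_center d)

/-! ### The explicit matrices -/

/-- The matrix `A₁`. -/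
def matA : Matrix (Fin 4) (Fin 4) ℂ :=
  !![0, 0, 0, -1; 0, -1, 0, 0; 0, 0, 1, 0; -1, 0, 0, 0]

/-- The matrix `T₁`. -/
def matT : Matrix (Fin 4) (Fin 4) ℂ :=
  !![1, -(Real.sqrt 2 : ℂ), 0, -1; 0, 1, 0, (Real.sqrt 2 : ℂ); 0, 0, 1, 0; 0, 0, 0, 1]

/-- The matrix `U_u`, for `d ≡ 3 mod 4` and for `d ≡ 1, 2 mod 4` (`d` squarefree). -/
def matU (d : ℕ) (u : ℂ) : Matrix (Fin 4) (Fin 4) ℂ :=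
  if d % 4 = 3 then
    !![1, -(Real.sqrt 2 : ℂ) / 2, (Real.sqrt (2 * d) : ℂ) / 2, -((d : ℂ) + 1) / 4;
      0, 1, 0, (Real.sqrt 2 : ℂ) / 2;
      0, 0, u, -u * (Real.sqrt (2 * d) : ℂ) / 2;
      0, 0, 0, 1]
  else
    !![1, 0, (Real.sqrt (2 * d) : ℂ), -(d : ℂ);
      0, 1, 0, 0;
      0, 0, u, -u * (Real.sqrt (2 * d) : ℂ);
      0, 0, 0, 1]

/-- `Z₃(u) = Diag(1,1,u,1)`. -/
def matZ3 (u : ℂ) : Matrix (Fin 4) (Fin 4) ℂ := Matrix.diagonal ![1, 1, u, 1]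

/-! ### Cutting hyperbolic 3-space along the modular surface -/

/-- Hyperbolic 3-space: positive definite Hermitian `2 × 2` matrices of determinant 1, with
`SL(2,ℂ)` acting by `X ↦ g X g*`. The point `z + tj` of the upper half-space (`t > 0`) is the matrix
`t⁻¹ [[|z|² + t², z], [z̄, 1]]`. -/
def HR3 : Set (Matrix (Fin 2) (Fin 2) ℂ) := {X | X.PosDef ∧ X.det = 1}

/-- The hyperbolic plane (`z` real) that is preserved by `PSL(2,ℤ)`. -/
def modularPlane : Set (Matrix (Fin 2) (Fin 2) ℂ) := {X ∈ HR3 | ∀ i j, (X i j).im = 0}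

/-- The preimage in hyperbolic 3-space of the modular surface: all the translates of the modular
plane under `Bi(d)`. -/
def walls (d : ℕ) : Set (Matrix (Fin 2) (Fin 2) ℂ) :=
  ⋃ g : SL(2, ringO d), hermAct (toSLC d g) '' modularPlane

/-- The point `-τ/2 + j` of the upper half-space. It lies between the modular plane `P` and the
neighbouring vertical wall `u⁻¹ P`. -/
def basePoint (d : ℕ) : Matrix (Fin 2) (Fin 2) ℂ :=
  !![(Complex.normSq (tau d) : ℂ) / 4 + 1, -tau d / 2; -star (tau d) / 2, 1]

/-- The component of (hyperbolic 3-space minus the walls) that is adjacent to both `P` and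
`u⁻¹ P`. -/
def piece (d : ℕ) : Set (Matrix (Fin 2) (Fin 2) ℂ) :=
  connectedComponentIn (HR3 \ walls d) (basePoint d)

/-- The stabilizer of this component in `SL(2, 𝒪_d)`. -/
def pieceStabSL (d : ℕ) : Subgroup SL(2, ringO d) where
  carrier := {g | hermAct (toSLC d g) '' piece d = piece d}
  one_mem' := by simp
  mul_mem' := by
    intro a b ha hb
    simp only [Set.mem_ofPred_eq] at *
    rw [map_mul, map_mul, Module.End.mul_eq_comp, LinearMap.coe_comp, Set.image_comp, hb, ha]
  inv_mem' := by
    intro a ha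
    simp only [Set.mem_ofPred_eq] at *
    have h : hermAct (toSLC d a⁻¹) * hermAct (toSLC d a) = 1 := by
      rw [← map_mul, ← map_mul, inv_mul_cancel, map_one, map_one]
    calc _ = hermAct (toSLC d a⁻¹) '' (hermAct (toSLC d a) '' piece d) := by rw [ha]
      _ = piece d := by
        rw [← Set.image_comp, ← LinearMap.coe_comp, ← Module.End.mul_eq_comp, h]
        simp

/-- The fundamental group `Γ'` of the Bianchi orbifold cut along the modular surface: the
stabilizer in `Bi(d)` of a component of the complement of the walls. The Bianchi group is the
HNN extension `Γ' *_u`, the stable letter `u` conjugating `u⁻¹ PSL(2,ℤ) u` to `PSL(2,ℤ)`. -/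
def cutGroup (d : ℕ) : Subgroup (Bi d) := (pieceStabSL d).map (toBi d)

/-- `ρ` is the bending deformation with parameter `u` of the lattice embedding `ρ₁` along the
modular surface: it agrees with `ρ₁` on the cut group `Γ'`, and it multiplies the image of the
stable letter by the element `Z₃(u)`, which centralizes `ρ₁(PSL(2,ℤ))`. -/
def IsBending (d : ℕ) (u : ℂ) (ρ : Bi d →* U31) : Prop :=
  (∀ γ ∈ cutGroup d, ρ γ = rho1 d γ) ∧
    toMat (ρ (uElt d)) = matZ3 u * toMat (rho1 d (uElt d))

/-! ### Lie subgroups and Zariski closures -/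

/-- A connected Lie subgroup of `GL(4,ℂ)`: the group generated by the exponentials of the elements
of a real Lie subalgebra of `M₄(ℂ)` (which is then its Lie algebra). -/
def IsConnectedLieSubgroup (K : Subgroup (GL (Fin 4) ℂ)) : Prop :=
  ∃ 𝔨 : Submodule ℝ (Matrix (Fin 4) (Fin 4) ℂ),
    (∀ X ∈ 𝔨, ∀ Y ∈ 𝔨, X * Y - Y * X ∈ 𝔨) ∧
    K = Subgroup.closure {g | ∃ X ∈ 𝔨, g.val = NormedSpace.exp X}

/-- The real coordinates of a complex `4 × 4` matrix: the real and the imaginary parts of its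
entries. -/
def realCoords (M : Matrix (Fin 4) (Fin 4) ℂ) : (Fin 4 × Fin 4) ⊕ (Fin 4 × Fin 4) → ℝ :=
  Sum.elim (fun ij => (M ij.1 ij.2).re) (fun ij => (M ij.1 ij.2).im)

/-- The Zariski closure in the real algebraic group `U(3,1)` of a set `S ⊆ U(3,1)`: the common
zeros in `U(3,1)` of all real polynomials in the real coordinates that vanish on `S`. -/
def zariskiClosure (S : Set U31) : Set U31 :=
  {g | ∀ f : MvPolynomial ((Fin 4 × Fin 4) ⊕ (Fin 4 × Fin 4)) ℝ,
    (∀ s ∈ S, MvPolynomial.eval (realCoords (toMat s)) f = 0) →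
      MvPolynomial.eval (realCoords (toMat g)) f = 0}

end BianchiBending

end

open BianchiBending

noncomputable section

namespace BianchiBending

/-! ### Arithmetic of the rings `𝒪_d` -/

/-! Existence and uniqueness. A translate of the modular plane is cut out, in the cone of positive
definite Hermitian matrices, by the form X ↦ Im tr(X adj v), where v = gJg* is skew-Hermitian. Write
δ = Im τ. The diagonal entries of v are ip, iq with p, q ∈ 2δℤ, and the upper right entry z ∈ 𝒪_d
satisfies |z|² - pq = 1 and Re z ≡ 1 mod 2δ². For d ≠ 1, 3 one has δ² ≥ 7/4, and these constraints
make distinct walls disjoint (`wall_disjoint`) and locally finite (`finite_sep_wall`).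

For any such family in a convex set (`WallSpace`) the chambers form a tree. An equivariant choice of
group elements R(w) therefore has a well-defined product of R(w)^{±1} along the walls between two
points. This is a cocycle, and multiplying ρ by it gives a new representation
(`WallSpace.Action.bend`). Here R(gP) = ρ₁(g) Z₃(u) ρ₁(g)⁻¹, which is well defined because the
elements that fix J are real and commute with Z₃(u). The result is ρ₁ on the stabilizer of the base
chamber and Z₃(u)ρ₁ on the stable letter. The walls are a single orbit, so these elements generate,
and the bending is unique. When 𝒪_d is norm-Euclidean by rounding, a, t and the stable letter
already generate. The trace 3 + u separates conjugacy classes.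

Parabolic elements. An element that fixes a point of real hyperbolic space, or a cusp that lies on
no wall, is conjugate into the stabilizer of the base chamber, so its images under ρ and ρ₁ are
conjugate. A cusp on a wall is equivalent to ∞, whose stabilizer consists of translations by 𝒪_d.
For u ≠ 1 the images of t and of the stable letter are simultaneously conjugate to a commuting
normal form (`cuspMat`). Its vertical part is a multiple of -δ²(1+u)/(1-u), which vanishes only for
u = -1. Parabolicity and discreteness are read off from it.

Zariski density. The closure of the image contains the real translations, hence the closures of
SL(2,ℤ) and of its conjugate by the stable letter. Together these give all translations, and then
Z₃(u) itself. If Im u ≠ 0, the commutator of a real translation with its twist by Z₃(u) yields the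
centre of the Heisenberg group. With a Weyl element this produces the whole Heisenberg group and
then SU(3,1) (`mem_of_det_eq_one`). If u is not a root of unity, the powers of Z₃(u) are
Zariski-dense in the circle of all Z₃(v), which supplies the determinants.

Connected Lie subgroups. Preserving a real subspace of matrices under conjugation is a Zariski
closed condition. The Lie algebra of a connected K that contains the image is thus stable under
SU(3,1). It is not scalar, so K contains SU(3,1). Since det U_u = u ≠ 1, some one-parameter subgroup
of K has nontrivial determinant, and K is everything. -/

theorem mem_quadField {d : ℕ} {x : ℂ} (hx : x ∈ quadField d) :
    ∃ a b : ℚ, x = a + b * (Complex.I * (Real.sqrt d : ℂ)) := by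
  have hs := sqrt_sq d
  set α := Complex.I * (Real.sqrt d : ℂ) with hα
  induction hx using IntermediateField.adjoin_induction with
  | mem x hx =>
    rw [Set.mem_singleton_iff] at hx
    exact ⟨0, 1, by rw [hx]; push_cast; ring⟩
  | algebraMap x => exact ⟨x, 0, by simp⟩
  | add x y _ _ hx hy =>
    obtain ⟨a, b, rfl⟩ := hx
    obtain ⟨a', b', rfl⟩ := hy
    exact ⟨a + a', b + b', by push_cast; ring⟩
  | inv x _ hx =>
    obtain ⟨a, b, rfl⟩ := hx
    by_cases h0 : (a : ℂ) + b * α = 0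
    · exact ⟨0, 0, by rw [h0]; simp⟩
    · refine ⟨a / (a ^ 2 + d * b ^ 2), -b / (a ^ 2 + d * b ^ 2), ?_⟩
      have hne : (a : ℂ) ^ 2 + d * b ^ 2 ≠ 0 := by
        intro h
        have h' : a ^ 2 + d * b ^ 2 = 0 := by exact_mod_cast h
        have ha : a = 0 := by
          have : (0 : ℚ) ≤ d * b ^ 2 := by positivity
          nlinarith [sq_nonneg a]
        subst ha
        have hb : (b : ℂ) * α = 0 := by
          have h2 : ((b : ℂ) * α) ^ 2 = 0 := by
            rw [mul_pow, hs]; linear_combination -h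
          exact pow_eq_zero_iff (two_ne_zero) |>.1 h2
        exact h0 (by simp [hb])
      push_cast
      rw [inv_eq_iff_eq_inv, eq_comm, inv_eq_iff_eq_inv, eq_comm]
      refine (eq_inv_of_mul_eq_one_left ?_).symm
      field_simp
      linear_combination (-(b : ℂ) ^ 2) * hs
  | mul x y _ _ hx hy =>
    obtain ⟨a, b, rfl⟩ := hx
    obtain ⟨a', b', rfl⟩ := hy
    exact ⟨a * a' - d * b * b', a * b' + b * a', by
      push_cast; linear_combination (b * b' : ℂ) * hs⟩

theorem exists_int_of_isIntegral_rat {q : ℚ} (h : IsIntegral ℤ (q : ℂ)) : ∃ n : ℤ, q = n := by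
  have h1 : IsIntegral ℤ q := by
    have : IsIntegral ℤ (algebraMap ℚ ℂ q) := by simpa using h
    exact (isIntegral_algebraMap_iff (algebraMap ℚ ℂ).injective).1 this
  obtain ⟨n, hn⟩ := IsIntegrallyClosed.isIntegral_iff.1 h1
  exact ⟨n, by simp [← hn]⟩

/-- The square of the denominator of b divides d · num², is coprime to num², hence divides d. -/
theorem exists_int_of_squarefree_mul_sq {d : ℕ} (hd : Squarefree d) {b : ℚ} {k : ℤ}
    (h : (d : ℚ) * b ^ 2 = k) : ∃ n : ℤ, b = n := by
  have hden : (b.den : ℚ) ≠ 0 := by exact_mod_cast b.den_nz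
  have h1 : (d : ℤ) * b.num ^ 2 = k * (b.den : ℤ) ^ 2 := by
    have : (d : ℚ) * (b.num : ℚ) ^ 2 = k * (b.den : ℚ) ^ 2 := by
      have hb : (b.num : ℚ) = b * b.den := (Rat.mul_den_eq_num b).symm
      rw [← h, hb]
      ring
    exact_mod_cast this
  have hcop : IsCoprime ((b.den : ℤ) ^ 2) (b.num ^ 2) := by
    apply IsCoprime.pow
    rw [Int.isCoprime_iff_gcd_eq_one, Int.gcd, Int.natAbs_natCast]
    exact b.reduced.symm
  have h2 : ((b.den : ℤ) ^ 2) ∣ (d : ℤ) := hcop.dvd_of_dvd_mul_right ⟨k, by rw [h1]; ring⟩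
  have h3 : b.den * b.den ∣ d := by
    rw [← sq]; exact_mod_cast h2
  have h4 := Nat.isUnit_iff.1 (hd _ h3)
  exact ⟨b.num, by
    conv_lhs => rw [← Rat.num_div_den b]
    simp [h4]⟩

/-- Write x = a + b i√d. Trace and norm are rational algebraic integers, so A = 2a and N = a² + db²
are integers. Then d(2b)² = 4N - A² makes B = 2b an integer, and A² + dB² ≡ 0 mod 4 decides the
parities of A and B. -/
theorem exists_int_tau_of_mem {d : ℕ} (hd : Squarefree d) {x : ℂ} (hx : x ∈ ringO d) :
    ∃ m n : ℤ, x = m + n * tau d := by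
  obtain ⟨hint, hq⟩ := Subring.mem_inf.1 hx
  replace hint : IsIntegral ℤ x := hint
  obtain ⟨a, b, hab⟩ := mem_quadField hq
  have hconj : IsIntegral ℤ ((starRingEnd ℂ) x) :=
    map_isIntegral_int (starRingEnd ℂ) hint
  have hcx : (starRingEnd ℂ) x = a - b * (Complex.I * (Real.sqrt d : ℂ)) := by
    rw [hab]
    simp
    ring
  obtain ⟨A, hA⟩ := exists_int_of_isIntegral_rat (q := 2 * a) (by
    have e : ((2 * a : ℚ) : ℂ) = x + (starRingEnd ℂ) x := by
      rw [hcx, hab]; push_cast; ring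
    rw [e]; exact hint.add hconj)
  obtain ⟨N, hN⟩ := exists_int_of_isIntegral_rat (q := a ^ 2 + d * b ^ 2) (by
    have e : ((a ^ 2 + d * b ^ 2 : ℚ) : ℂ) = x * (starRingEnd ℂ) x := by
      rw [hcx, hab]; push_cast
      linear_combination ((b : ℂ) ^ 2) * sqrt_sq d
    rw [e]; exact hint.mul hconj)
  obtain ⟨B, hB⟩ := exists_int_of_squarefree_mul_sq hd (b := 2 * b) (k := 4 * N - A ^ 2) (by
    push_cast; rw [← hN, ← hA]; ring)
  have hrel : A ^ 2 + d * B ^ 2 = 4 * N := by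
    have : (A : ℚ) ^ 2 + d * (B : ℚ) ^ 2 = 4 * N := by rw [← hN, ← hA, ← hB]; ring
    exact_mod_cast this
  have ha : (a : ℂ) = A / 2 := by
    have : a = A / 2 := by rw [← hA]; ring
    rw [this]; push_cast; ring
  have hb : (b : ℂ) = B / 2 := by
    have : b = B / 2 := by rw [← hB]; ring
    rw [this]; push_cast; ring
  -- This leaves only d ≡ 1, 2 mod 4 besides d ≡ 3.
  have hd4 : ¬ 4 ∣ d := fun h => by
    have := Nat.isUnit_iff.1 (hd 2 (by simpa using h)); omega
  have hmod : (A ^ 2 + d * B ^ 2) % 4 = 0 := by omega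
  have hred : ((A % 4) ^ 2 + ((d % 4 : ℕ) : ℤ) * (B % 4) ^ 2) % 4 = 0 := by
    rw [← hmod]; push_cast
    simp [Int.add_emod, Int.mul_emod, pow_two]
  by_cases h3 : d % 4 = 3
  · have hpar : (A - B) % 2 = 0 := by
      rw [h3] at hred
      have h1 : A % 4 = 0 ∨ A % 4 = 1 ∨ A % 4 = 2 ∨ A % 4 = 3 := by omega
      have h2 : B % 4 = 0 ∨ B % 4 = 1 ∨ B % 4 = 2 ∨ B % 4 = 3 := by omega
      rcases h1 with h1 | h1 | h1 | h1 <;> rcases h2 with h2 | h2 | h2 | h2 <;>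
        rw [h1, h2] at hred <;> norm_num at hred <;> omega
    obtain ⟨m, hm⟩ : ∃ m, A - B = 2 * m := ⟨(A - B) / 2, by omega⟩
    refine ⟨m, B, ?_⟩
    have hm' : (A : ℂ) - B = 2 * m := by exact_mod_cast hm
    rw [hab, ha, hb, tau, if_pos h3]
    linear_combination hm' / 2
  · have hpar : A % 2 = 0 ∧ B % 2 = 0 := by
      have h1 : A % 4 = 0 ∨ A % 4 = 1 ∨ A % 4 = 2 ∨ A % 4 = 3 := by omega
      have h2 : B % 4 = 0 ∨ B % 4 = 1 ∨ B % 4 = 2 ∨ B % 4 = 3 := by omega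
      have h5 : d % 4 = 1 ∨ d % 4 = 2 := by omega
      rcases h5 with h5 | h5 <;> rw [h5] at hred <;>
      rcases h1 with h1 | h1 | h1 | h1 <;> rcases h2 with h2 | h2 | h2 | h2 <;>
        rw [h1, h2] at hred <;> norm_num at hred <;> omega
    obtain ⟨m, hm⟩ : ∃ m, A = 2 * m := ⟨A / 2, by omega⟩
    obtain ⟨n, hn⟩ : ∃ n, B = 2 * n := ⟨B / 2, by omega⟩
    refine ⟨m, n, ?_⟩
    rw [hab, ha, hb, tau, if_neg h3, hm, hn]
    push_cast; ring

/-- The imaginary part of `τ`. -/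
def delta (d : ℕ) : ℝ := (tau d).im

theorem delta_eq (d : ℕ) : delta d = if d % 4 = 3 then Real.sqrt d / 2 else Real.sqrt d := by
  unfold delta tau
  split_ifs <;> simp

theorem tau_re (d : ℕ) : (tau d).re = if d % 4 = 3 then 1 / 2 else 0 := by
  unfold tau
  split_ifs <;> simp

/-- The standing assumption on `d`. -/
structure Admissible (d : ℕ) : Prop where
  squarefree : Squarefree d
  ne_one : d ≠ 1
  ne_three : d ≠ 3

namespace Admissible
variable {d : ℕ} (hd : Admissible d)
include hd

theorem pos : 0 < d := Nat.pos_of_ne_zero hd.squarefree.ne_zero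

theorem delta_pos : 0 < delta d := by
  have := hd.pos
  rw [delta_eq]
  split_ifs <;> positivity

/-- The only place where d ≠ 1, 3 enters: there δ² would be 1 and 3/4, while the smallest remaining
cases are d = 2 with δ² = 2 and d = 7 with δ² = 7/4. -/
theorem delta_sq : 7 / 4 ≤ delta d ^ 2 := by
  have h1 := hd.pos
  have h2 := hd.ne_one
  have h3 := hd.ne_three
  rw [delta_eq]
  split_ifs with h
  · rw [div_pow, Real.sq_sqrt (Nat.cast_nonneg d)]
    have : (7 : ℝ) ≤ d := by exact_mod_cast (by omega : 7 ≤ d)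
    linarith
  · rw [Real.sq_sqrt (Nat.cast_nonneg d)]
    have : (2 : ℝ) ≤ d := by exact_mod_cast (by omega : 2 ≤ d)
    linarith

theorem exists_int_im {x : ℂ} (hx : x ∈ ringO d) : ∃ n : ℤ, x.im = n * delta d := by
  obtain ⟨m, n, rfl⟩ := exists_int_tau_of_mem hd.squarefree hx
  exact ⟨n, by simp [delta]⟩

theorem exists_int_of_im_eq_zero {x : ℂ} (hx : x ∈ ringO d) (h : x.im = 0) :
    ∃ n : ℤ, x = n := by
  obtain ⟨m, n, rfl⟩ := exists_int_tau_of_mem hd.squarefree hx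
  refine ⟨m, ?_⟩
  have : (n : ℝ) * delta d = 0 := by simpa [delta] using h
  have hn : n = 0 := by
    rcases mul_eq_zero.1 this with h | h
    · exact_mod_cast h
    · exact absurd h hd.delta_pos.ne'
  simp [hn]

theorem star_mem {x : ℂ} (hx : x ∈ ringO d) : (starRingEnd ℂ) x ∈ ringO d := by
  obtain ⟨m, n, rfl⟩ := exists_int_tau_of_mem hd.squarefree hx
  have ht : (starRingEnd ℂ) (tau d) = (if d % 4 = 3 then 1 else 0) - tau d := by
    unfold tau
    split_ifs
    · rw [map_div₀, map_ofNat]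
      simp
      ring
    · simp
  rw [map_add, map_mul, ht]
  simp only [map_intCast]
  refine add_mem (intCast_mem _ _) (mul_mem (intCast_mem _ _) (sub_mem ?_ (tau_mem d)))
  split_ifs
  · exact one_mem _
  · exact zero_mem _

theorem exists_nat_normSq {x : ℂ} (hx : x ∈ ringO d) : ∃ n : ℕ, Complex.normSq x = n := by
  have h1 : x * (starRingEnd ℂ) x ∈ ringO d := mul_mem hx (hd.star_mem hx)
  rw [Complex.mul_conj] at h1
  obtain ⟨n, hn⟩ := hd.exists_int_of_im_eq_zero h1 (by simp)
  have hn' : Complex.normSq x = n := by exact_mod_cast hn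
  have : 0 ≤ n := by
    have := Complex.normSq_nonneg x
    rw [hn'] at this
    exact_mod_cast this
  lift n to ℕ using this
  exact ⟨n, by exact_mod_cast hn'⟩

/-- Imaginary parts are multiples of δ > 1, so an element of norm one is real. -/
theorem eq_one_or_of_normSq {x : ℂ} (hx : x ∈ ringO d) (h : Complex.normSq x = 1) :
    x = 1 ∨ x = -1 := by
  obtain ⟨n, hn⟩ := hd.exists_int_im hx
  have h7 := hd.delta_sq
  rw [Complex.normSq_apply, hn] at h
  have hn0 : n = 0 := by
    by_contra h0
    have : (1 : ℝ) ≤ (n : ℝ) ^ 2 := by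
      have : 1 ≤ n ^ 2 := by
        have := Int.one_le_abs h0
        nlinarith [sq_abs n]
      exact_mod_cast this
    nlinarith [mul_self_nonneg x.re]
  obtain ⟨m, rfl⟩ := hd.exists_int_of_im_eq_zero hx (by rw [hn, hn0]; simp)
  have h2 : m * m = 1 := by
    rw [hn0] at h
    simp at h
    exact_mod_cast h
  rcases mul_self_eq_one_iff.1 h2 with h | h
  · left; simp [h]
  · right; simp [h]

theorem finite_bounded (R : ℝ) : {x : ℂ | x ∈ ringO d ∧ Complex.normSq x ≤ R}.Finite := by
  have h7 := hd.delta_sq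
  set B : ℤ := ⌈R⌉ + 1 with hB
  have hRB : R ≤ B := by
    have := Int.le_ceil R
    rw [hB]; push_cast; linarith
  have hfin : ((fun p : ℤ × ℤ => (p.1 : ℂ) + p.2 * tau d) ''
      (Set.Icc (-(2 * B)) (2 * B) ×ˢ Set.Icc (-B) B)).Finite :=
    Set.Finite.image _ ((Set.finite_Icc _ _).prod (Set.finite_Icc _ _))
  refine hfin.subset ?_
  rintro x ⟨hx, hR⟩
  obtain ⟨m, n, rfl⟩ := exists_int_tau_of_mem hd.squarefree hx
  have hnorm : Complex.normSq ((m : ℂ) + n * tau d) =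
      (m + n * (tau d).re) ^ 2 + (n : ℝ) ^ 2 * delta d ^ 2 := by
    rw [Complex.normSq_apply]; simp [delta]; ring
  rw [hnorm] at hR
  have hre : (tau d).re ^ 2 ≤ 1 / 4 := by
    rw [tau_re]; split_ifs <;> norm_num
  have hn2 : (n : ℝ) ^ 2 ≤ B := by nlinarith [sq_nonneg ((m : ℝ) + n * (tau d).re), sq_nonneg (n : ℝ)]
  -- From m² ≤ 2(m + n Re τ)² + 2(n Re τ)²; the difference of the two sides is (m + 2n Re τ)².
  have hm2 : (m : ℝ) ^ 2 ≤ 4 * B := by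
    nlinarith [sq_nonneg ((m : ℝ) + 2 * (n * (tau d).re)), sq_nonneg (n : ℝ),
      mul_le_mul_of_nonneg_left hre (sq_nonneg (n : ℝ))]
  have hn3 : n ^ 2 ≤ B := by exact_mod_cast hn2
  have hm3 : m ^ 2 ≤ 4 * B := by exact_mod_cast hm2
  refine ⟨(m, n), ⟨⟨?_, ?_⟩, ⟨?_, ?_⟩⟩, rfl⟩ <;> simp only <;> nlinarith

end Admissible

/-! ### Disjoint locally finite families of walls in a convex set -/

/-- A locally finite family of pairwise disjoint hyperplane sections ("walls") of a convex set. -/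
structure WallSpace (E W : Type*) [AddCommGroup E] [Module ℝ E] where
  /-- the convex set -/
  cone : Set E
  convex : Convex ℝ cone
  /-- the linear form that cuts out a wall -/
  form : W → E →ₗ[ℝ] ℝ
  disjoint : ∀ v w, v ≠ w → ∀ x ∈ cone, form v x = 0 → form w x ≠ 0
  finite_sep : ∀ x ∈ cone, ∀ y ∈ cone, {v | form v x * form v y ≤ 0}.Finite

namespace WallSpace

/-! ### Separation of points by disjoint walls. -/

section Geometry

variable {E W : Type*} [AddCommGroup E] [Module ℝ E]

theorem exists_zero_of_neg_of_pos {C : Set E} (hC : Convex ℝ C) (f : E →ₗ[ℝ] ℝ) {x y : E}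
    (hx : x ∈ C) (hy : y ∈ C) (hfx : f x < 0) (hfy : 0 < f y) :
    ∃ p ∈ C, f p = 0 ∧ ∃ a b : ℝ, 0 < a ∧ 0 < b ∧ p = a • x + b • y := by
  have hpos : 0 < f y - f x := by linarith
  refine ⟨(f y / (f y - f x)) • x + (-f x / (f y - f x)) • y,
    hC hx hy (by positivity) (div_nonneg (by linarith) hpos.le) (by field_simp; ring), ?_,
    _, _, by positivity, div_pos (by linarith) hpos, rfl⟩
  simp only [map_add, map_smul, smul_eq_mul]
  field_simp
  ring

/-- If all four sign patterns occur, the wall f = 0 contains a point with g > 0 (between x₃ and x₂)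
and one with g < 0 (between x₁ and x₄). The segment joining them stays in f = 0 and meets g = 0. -/
theorem not_four_quadrants {C : Set E} (hC : Convex ℝ C) {f g : E →ₗ[ℝ] ℝ}
    (hfg : ∀ x ∈ C, f x = 0 → g x ≠ 0) {x₁ x₂ x₃ x₄ : E}
    (h₁ : x₁ ∈ C) (h₂ : x₂ ∈ C) (h₃ : x₃ ∈ C) (h₄ : x₄ ∈ C)
    (f₁ : f x₁ < 0) (f₂ : 0 < f x₂) (f₃ : f x₃ < 0) (f₄ : 0 < f x₄)
    (g₁ : g x₁ < 0) (g₂ : 0 < g x₂) (g₃ : 0 < g x₃) (g₄ : g x₄ < 0) : False := by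
  obtain ⟨p, hp, hfp, a, b, ha, hb, hpe⟩ := exists_zero_of_neg_of_pos hC f h₃ h₂ f₃ f₂
  obtain ⟨q, hq, hfq, a', b', ha', hb', hqe⟩ := exists_zero_of_neg_of_pos hC f h₁ h₄ f₁ f₄
  have hgp : 0 < g p := by
    rw [hpe]; simp only [map_add, map_smul, smul_eq_mul]; positivity
  have hgq : g q < 0 := by
    rw [hqe]; simp only [map_add, map_smul, smul_eq_mul]; nlinarith
  obtain ⟨r, hr, hgr, a'', b'', -, -, hre⟩ := exists_zero_of_neg_of_pos hC g hq hp hgq hgp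
  exact hfg r hr (by rw [hre]; simp [hfp, hfq]) hgr

variable (𝓦 : WallSpace E W)

/-- A point of the convex set that lies on no wall. -/
def IsRegular (x : E) : Prop := x ∈ 𝓦.cone ∧ ∀ v, 𝓦.form v x ≠ 0

/-- The point `x` is on the positive side of the wall `v`. -/
def Pos (v : W) (x : E) : Prop := 0 < 𝓦.form v x

open Classical in
/-- The walls that separate two points. -/
def sep (x y : E) : Finset W :=
  -- For points of the cone finiteness is part of the structure, so the default ∅ is never reached
  -- there.
  if h : {v | 𝓦.form v x * 𝓦.form v y < 0}.Finite then h.toFinset else ∅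

variable {𝓦}

theorem IsRegular.neg_of_not_pos {x : E} (hx : 𝓦.IsRegular x) {v : W} (h : ¬ 𝓦.Pos v x) :
    𝓦.form v x < 0 :=
  lt_of_le_of_ne (not_lt.1 h) (hx.2 v)

theorem IsRegular.not_pos_iff {x : E} (hx : 𝓦.IsRegular x) {v : W} :
    ¬ 𝓦.Pos v x ↔ 𝓦.form v x < 0 :=
  ⟨hx.neg_of_not_pos, fun h h' => lt_asymm h h'⟩

theorem mem_sep {x y : E} (hx : 𝓦.IsRegular x) (hy : 𝓦.IsRegular y) {v : W} :
    v ∈ 𝓦.sep x y ↔ ¬ (𝓦.Pos v x ↔ 𝓦.Pos v y) := by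
  have hfin : {v | 𝓦.form v x * 𝓦.form v y < 0}.Finite :=
    (𝓦.finite_sep x hx.1 y hy.1).subset fun v hv => by
      simp only [Set.mem_ofPred_eq] at *
      exact hv.le
  rw [sep, dif_pos hfin]
  simp only [Set.Finite.mem_toFinset, Set.mem_ofPred_eq, mul_neg_iff]
  rw [← hx.not_pos_iff, ← hy.not_pos_iff]
  change (𝓦.Pos v x ∧ _ ∨ _ ∧ 𝓦.Pos v y) ↔ _
  tauto

theorem form_mul_pos {u : W} {a b : E} (ha : 𝓦.IsRegular a) (hb : 𝓦.IsRegular b)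
    (hab : 𝓦.Pos u a ↔ 𝓦.Pos u b) : 0 < 𝓦.form u a * 𝓦.form u b := by
  by_cases h1 : 𝓦.Pos u a
  · exact mul_pos h1 (hab.1 h1)
  · exact mul_pos_of_neg_of_neg (ha.neg_of_not_pos h1) (hb.neg_of_not_pos fun h => h1 (hab.2 h))

theorem form_mul_neg {u : W} {a b : E} (ha : 𝓦.IsRegular a) (hb : 𝓦.IsRegular b)
    (hab : ¬ (𝓦.Pos u a ↔ 𝓦.Pos u b)) : 𝓦.form u a * 𝓦.form u b < 0 := by
  by_cases h1 : 𝓦.Pos u a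
  · exact mul_neg_of_pos_of_neg h1 (hb.neg_of_not_pos (by tauto))
  · exact mul_neg_of_neg_of_pos (ha.neg_of_not_pos h1) (by change 𝓦.Pos u b; tauto)

theorem sep_eq_empty {x y : E} (hx : 𝓦.IsRegular x) (hy : 𝓦.IsRegular y) :
    𝓦.sep x y = ∅ ↔ ∀ v, 𝓦.Pos v x ↔ 𝓦.Pos v y := by
  rw [Finset.eq_empty_iff_forall_notMem]
  simp only [mem_sep hx hy, not_not]

/-- The segment from x to y crosses the separating wall v at time T v. Disjoint walls are crossed at
distinct times, so there is a last one, w, and y' is taken on the segment just before it. This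
drives the inductions on the number of separating walls. -/
theorem exists_last_step [DecidableEq W] {x y : E} (hx : 𝓦.IsRegular x) (hy : 𝓦.IsRegular y)
    (hne : (𝓦.sep x y).Nonempty) :
    ∃ w ∈ 𝓦.sep x y, ∃ y', 𝓦.IsRegular y' ∧ 𝓦.sep y' y = {w} ∧
      𝓦.sep x y' = (𝓦.sep x y).erase w := by
  set T : W → ℝ := fun v => 𝓦.form v x / (𝓦.form v x - 𝓦.form v y) with hT
  have hdiff : ∀ v ∈ 𝓦.sep x y, 𝓦.form v x - 𝓦.form v y ≠ 0 := by
    intro v hv h0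
    rw [mem_sep hx hy] at hv
    apply hv
    unfold Pos
    rw [show 𝓦.form v x = 𝓦.form v y by linarith]
  have hform : ∀ v ∈ 𝓦.sep x y, ∀ t : ℝ, 𝓦.form v ((1 - t) • x + t • y) =
      (𝓦.form v y - 𝓦.form v x) * (t - T v) := by
    intro v hv t
    have := hdiff v hv
    simp only [map_add, map_smul, smul_eq_mul, hT]
    field_simp
    ring
  have hT01 : ∀ v ∈ 𝓦.sep x y, 0 < T v ∧ T v < 1 := by
    intro v hv
    have hv' := hv
    rw [mem_sep hx hy] at hv
    by_cases h1 : 𝓦.Pos v x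
    · have h2 : ¬ 𝓦.Pos v y := by tauto
      have h2 := hy.neg_of_not_pos h2
      have h1 : 0 < 𝓦.form v x := h1
      have h3 : 0 < 𝓦.form v x - 𝓦.form v y := by linarith
      exact ⟨div_pos h1 h3, (div_lt_one h3).2 (by linarith)⟩
    · have h2 : 0 < 𝓦.form v y := by
        change 𝓦.Pos v y
        tauto
      have h1 := hx.neg_of_not_pos h1
      have h3 : 𝓦.form v x - 𝓦.form v y < 0 := by linarith
      exact ⟨div_pos_of_neg_of_neg h1 h3, (div_lt_one_of_neg h3).2 (by linarith)⟩
  have hmem : ∀ t : ℝ, 0 ≤ t → t ≤ 1 → (1 - t) • x + t • y ∈ 𝓦.cone := fun t h0 h1 =>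
    𝓦.convex hx.1 hy.1 (by linarith) h0 (by ring)
  obtain ⟨w, hw, hmax⟩ := Finset.exists_max_image (𝓦.sep x y) T hne
  have hlt : ∀ v ∈ (𝓦.sep x y).erase w, T v < T w := by
    intro v hv
    obtain ⟨hvw, hv⟩ := Finset.mem_erase.1 hv
    refine lt_of_le_of_ne (hmax v hv) fun heq => ?_
    have h01 := hT01 v hv
    refine 𝓦.disjoint v w hvw _ (hmem (T v) h01.1.le h01.2.le) ?_ ?_
    · rw [hform v hv]; ring
    · rw [hform w hw, heq]; ring
  -- The time 0 is added so that a previous time exists even if w is the only separating wall.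
  set S : Finset ℝ := insert 0 (((𝓦.sep x y).erase w).image T) with hS
  have hSne : S.Nonempty := ⟨0, by simp [hS]⟩
  set s := S.max' hSne with hs
  have hs0 : 0 ≤ s := S.le_max' 0 (by simp [hS])
  have hsv : ∀ v ∈ (𝓦.sep x y).erase w, T v ≤ s := fun v hv =>
    S.le_max' _ (by rw [hS]; exact Finset.mem_insert_of_mem (Finset.mem_image_of_mem T hv))
  have hsw : s < T w := by
    rw [hs, Finset.max'_lt_iff]
    intro r hr
    rw [hS, Finset.mem_insert, Finset.mem_image] at hr
    rcases hr with rfl | ⟨v, hv, rfl⟩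
    · exact (hT01 w hw).1
    · exact hlt v hv
  set t := (s + T w) / 2 with ht
  have ht1 : t < T w := by linarith
  have hts : s < t := by linarith
  have htw := hT01 w hw
  set y' := (1 - t) • x + t • y with hy'
  have hy'C : y' ∈ 𝓦.cone := hmem t (by linarith) (by linarith)
  have key1 : ∀ v, v ≠ w → 0 < 𝓦.form v y' * 𝓦.form v y := by
    intro v hvw
    by_cases hv : v ∈ 𝓦.sep x y
    · have h1 := hsv v (Finset.mem_erase.2 ⟨hvw, hv⟩)
      rw [hy', hform v hv]
      have h3 : 0 < t - T v := by linarith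
      rw [mem_sep hx hy] at hv
      by_cases h2 : 𝓦.Pos v x
      · have h4 := hy.neg_of_not_pos (v := v) (by tauto)
        have h2 : 0 < 𝓦.form v x := h2
        exact mul_pos_of_neg_of_neg (mul_neg_of_neg_of_pos (by linarith) h3) h4
      · have h4 : 0 < 𝓦.form v y := by
          change 𝓦.Pos v y
          tauto
        have h2 := hx.neg_of_not_pos h2
        exact mul_pos (mul_pos (by linarith) h3) h4
    · rw [mem_sep hx hy, not_not] at hv
      have h1t : 0 < 1 - t := by linarith
      have h0t : 0 < t := by linarith
      simp only [hy', map_add, map_smul, smul_eq_mul]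
      by_cases h2 : 𝓦.Pos v x
      · have h4 : 0 < 𝓦.form v y := hv.1 h2
        have h2 : 0 < 𝓦.form v x := h2
        positivity
      · have h4 := hy.neg_of_not_pos (fun h => h2 (hv.2 h))
        have h2 := hx.neg_of_not_pos h2
        apply mul_pos_of_neg_of_neg _ h4
        nlinarith
  have key2 : 𝓦.form w y' * 𝓦.form w y < 0 := by
    rw [hy', hform w hw]
    have h3 : t - T w < 0 := by linarith
    rw [mem_sep hx hy] at hw
    by_cases h2 : 𝓦.Pos w x
    · have h4 := hy.neg_of_not_pos (v := w) (by tauto)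
      have h2 : 0 < 𝓦.form w x := h2
      exact mul_neg_of_pos_of_neg (mul_pos_of_neg_of_neg (by linarith) h3) h4
    · have h4 : 0 < 𝓦.form w y := by
        change 𝓦.Pos w y
        tauto
      have h2 := hx.neg_of_not_pos h2
      exact mul_neg_of_neg_of_pos (mul_neg_of_pos_of_neg (by linarith) h3) h4
  have hy'R : 𝓦.IsRegular y' := by
    refine ⟨hy'C, fun v h0 => ?_⟩
    by_cases hvw : v = w
    · rw [hvw] at h0; rw [h0] at key2; simp at key2
    · have := key1 v hvw; rw [h0] at this; simp at this
  have k1 : ∀ v, v ≠ w → (𝓦.Pos v y' ↔ 𝓦.Pos v y) := by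
    intro v hvw
    rcases mul_pos_iff.1 (key1 v hvw) with h | h
    · exact iff_of_true h.1 h.2
    · exact iff_of_false h.1.not_gt h.2.not_gt
  have k2 : ¬ (𝓦.Pos w y' ↔ 𝓦.Pos w y) := by
    rcases mul_neg_iff.1 key2 with h | h
    · exact fun h' => h.2.not_gt (h'.1 h.1)
    · exact fun h' => h.1.not_gt (h'.2 h.2)
  refine ⟨w, hw, y', hy'R, ?_, ?_⟩
  · ext v
    rw [mem_sep hy'R hy, Finset.mem_singleton]
    by_cases hvw : v = w
    · subst hvw; tauto
    · have := k1 v hvw; tauto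
  · ext v
    rw [Finset.mem_erase, mem_sep hx hy'R, mem_sep hx hy]
    rw [mem_sep hx hy] at hw
    by_cases hvw : v = w
    · subst hvw; tauto
    · have := k1 v hvw; tauto

theorem pos_iff_of_sep_singleton {x y : E} (hx : 𝓦.IsRegular x) (hy : 𝓦.IsRegular y) {w : W}
    (h : 𝓦.sep x y = {w}) {v : W} (hv : v ≠ w) : 𝓦.Pos v x ↔ 𝓦.Pos v y := by
  by_contra hc
  rw [← mem_sep hx hy, h, Finset.mem_singleton] at hc
  exact hv hc

theorem not_pos_iff_of_sep_singleton {x y : E} (hx : 𝓦.IsRegular x) (hy : 𝓦.IsRegular y) {w : W}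
    (h : 𝓦.sep x y = {w}) : ¬ (𝓦.Pos w x ↔ 𝓦.Pos w y) := by
  rw [← mem_sep hx hy, h, Finset.mem_singleton]

/-- The regular point `x` is in a chamber that has the wall `w` as a face. -/
def IsAdjacent (𝓦 : WallSpace E W) (x : E) (w : W) : Prop :=
  ∀ v, v ≠ w → ∀ q ∈ 𝓦.cone, 𝓦.form w q = 0 → 0 < 𝓦.form v x * 𝓦.form v q

/-- The wall w is convex and does not meet v, so it lies on one side of v. -/
theorem form_mul_form_pos_of_wall {w v : W} (hv : v ≠ w) {p q : E} (hp : p ∈ 𝓦.cone)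
    (hq : q ∈ 𝓦.cone) (hwp : 𝓦.form w p = 0) (hwq : 𝓦.form w q = 0) :
    0 < 𝓦.form v p * 𝓦.form v q := by
  have hp0 := 𝓦.disjoint w v hv.symm p hp hwp
  have hq0 := 𝓦.disjoint w v hv.symm q hq hwq
  have main : ∀ p ∈ 𝓦.cone, ∀ q ∈ 𝓦.cone, 𝓦.form w p = 0 → 𝓦.form w q = 0 →
      𝓦.form v p < 0 → 0 < 𝓦.form v q → False := by
    intro p hp q hq hwp hwq h1 h2
    obtain ⟨r, hr, hvr, a, b, -, -, rfl⟩ :=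
      exists_zero_of_neg_of_pos 𝓦.convex (𝓦.form v) hp hq h1 h2
    exact 𝓦.disjoint w v hv.symm _ hr (by simp [hwp, hwq]) hvr
  rcases lt_or_gt_of_ne hp0 with h1 | h1 <;> rcases lt_or_gt_of_ne hq0 with h2 | h2
  · exact mul_pos_of_neg_of_neg h1 h2
  · exact (main p hp q hq hwp hwq h1 h2).elim
  · exact (main q hq p hp hwq hwp h2 h1).elim
  · exact mul_pos h1 h2

theorem isAdjacent_of_exists {x : E} {w : W} {p : E} (hp : p ∈ 𝓦.cone) (hwp : 𝓦.form w p = 0)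
    (h : ∀ v, v ≠ w → 0 < 𝓦.form v x * 𝓦.form v p) : 𝓦.IsAdjacent x w := by
  intro v hv q hq hwq
  have h1 := form_mul_form_pos_of_wall hv hp hq hwp hwq
  have h2 := h v hv
  rcases mul_pos_iff.1 h1 with h1 | h1
  · exact mul_pos ((mul_pos_iff_of_pos_right h1.1).1 h2) h1.2
  · exact mul_pos_of_neg_of_neg (by nlinarith) h1.2

/-- The segment from x to y meets w at a point p. Every other form has the same sign at x and y,
hence at p as well. -/
theorem isAdjacent_of_sep {x y : E} (hx : 𝓦.IsRegular x) (hy : 𝓦.IsRegular y) {w : W}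
    (h : 𝓦.sep x y = {w}) : 𝓦.IsAdjacent x w := by
  have main : ∃ p ∈ 𝓦.cone, 𝓦.form w p = 0 ∧ ∃ a b : ℝ, 0 < a ∧ 0 < b ∧ p = a • x + b • y := by
    have hw := not_pos_iff_of_sep_singleton hx hy h
    by_cases h1 : 𝓦.Pos w x
    · have h2 : ¬ 𝓦.Pos w y := by tauto
      obtain ⟨p, hp, hp0, a, b, ha, hb, he⟩ := exists_zero_of_neg_of_pos 𝓦.convex (𝓦.form w)
        hy.1 hx.1 (hy.neg_of_not_pos h2) h1
      exact ⟨p, hp, hp0, b, a, hb, ha, by rw [he, add_comm]⟩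
    · have h2 : 𝓦.Pos w y := by tauto
      exact exists_zero_of_neg_of_pos 𝓦.convex (𝓦.form w) hx.1 hy.1 (hx.neg_of_not_pos h1) h2
  obtain ⟨p, hp, hp0, a, b, ha, hb, rfl⟩ := main
  refine isAdjacent_of_exists hp hp0 fun v hv => ?_
  have hiff := pos_iff_of_sep_singleton hx hy h hv
  simp only [map_add, map_smul, smul_eq_mul]
  by_cases h1 : 𝓦.Pos v x
  · have h2 : 0 < 𝓦.form v y := hiff.1 h1
    have h1 : 0 < 𝓦.form v x := h1
    positivity
  · have h2 := hy.neg_of_not_pos (fun h => h1 (hiff.2 h))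
    have h1 := hx.neg_of_not_pos h1
    apply mul_pos_of_neg_of_neg h1
    nlinarith

/-- A side of a wall belongs to a single chamber: away from w, the signs at x and at y are both
those at q. -/
theorem sep_eq_empty_of_isAdjacent {x y : E} (hx : 𝓦.IsRegular x) (hy : 𝓦.IsRegular y) {w : W}
    (hxw : 𝓦.IsAdjacent x w) (hyw : 𝓦.IsAdjacent y w) {q : E} (hq : q ∈ 𝓦.cone)
    (hwq : 𝓦.form w q = 0) (h : 𝓦.Pos w x ↔ 𝓦.Pos w y) : 𝓦.sep x y = ∅ := by
  rw [sep_eq_empty hx hy]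
  intro v
  by_cases hv : v = w
  · rw [hv]; exact h
  · have h1 := hxw v hv q hq hwq
    have h2 := hyw v hv q hq hwq
    unfold Pos
    rcases mul_pos_iff.1 h1 with h1 | h1 <;> rcases mul_pos_iff.1 h2 with h2 | h2
    · exact iff_of_true h1.1 h2.1
    · linarith [h1.2, h2.2]
    · linarith [h1.2, h2.2]
    · exact iff_of_false h1.1.not_gt h2.1.not_gt

end Geometry

/-! ### Developing map and bending cocycle -/

section Development

variable {E W G : Type*} [AddCommGroup E] [Module ℝ E] [DecidableEq W] [Group G]
variable (𝓦 : WallSpace E W) (R : W → G) (x₀ : E)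

open Classical in
/-- The group element attached to crossing the wall `w` starting from the side of `x`. -/
def crossing (x : E) (w : W) : G := if 𝓦.Pos w x then (R w)⁻¹ else R w

open Classical in
/-- The product of the crossing elements along a path from `x₀` that crosses the walls in `S`. -/
def develop (S : Finset W) : G :=
  -- Such a w is the last wall on the way from x₀. `develop_of_mem` shows that it is unique, so the
  -- choice below is harmless.
  if h : ∃ w ∈ S, ∃ y, 𝓦.IsRegular y ∧ 𝓦.sep x₀ y = S.erase w then
    develop (S.erase h.choose) * 𝓦.crossing R x₀ h.choose
  else 1
termination_by S.card
decreasing_by exact Finset.card_erase_lt_of_mem h.choose_spec.1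

variable {𝓦 x₀}

/-- If another wall v could be removed last, reaching a point z, then x₀, y, y', z would occupy all
four quadrants of the disjoint walls w and v. -/
theorem develop_of_mem (hx₀ : 𝓦.IsRegular x₀) {y y' : E} (hy : 𝓦.IsRegular y)
    (hy' : 𝓦.IsRegular y') {w : W} (h : 𝓦.sep y' y = {w}) (hw : w ∈ 𝓦.sep x₀ y) :
    𝓦.develop R x₀ (𝓦.sep x₀ y) = 𝓦.develop R x₀ (𝓦.sep x₀ y') * 𝓦.crossing R x₀ w := by
  have k1 : ∀ v, v ≠ w → (𝓦.Pos v y' ↔ 𝓦.Pos v y) := fun v hv =>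
    pos_iff_of_sep_singleton hy' hy h hv
  have k2 : ¬ (𝓦.Pos w y' ↔ 𝓦.Pos w y) := not_pos_iff_of_sep_singleton hy' hy h
  have herase : 𝓦.sep x₀ y' = (𝓦.sep x₀ y).erase w := by
    ext v
    rw [Finset.mem_erase, mem_sep hx₀ hy', mem_sep hx₀ hy]
    rw [mem_sep hx₀ hy] at hw
    by_cases hvw : v = w
    · subst hvw; tauto
    · have := k1 v hvw; tauto
  have hex : ∃ w ∈ 𝓦.sep x₀ y, ∃ z, 𝓦.IsRegular z ∧ 𝓦.sep x₀ z = (𝓦.sep x₀ y).erase w :=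
    ⟨w, hw, y', hy', herase⟩
  have huniq : hex.choose = w := by
    obtain ⟨hv, z, hz, hzs⟩ := hex.choose_spec
    set v := hex.choose
    by_contra hvw
    have m1 : w ∈ 𝓦.sep x₀ z := by rw [hzs]; exact Finset.mem_erase.2 ⟨Ne.symm hvw, hw⟩
    have m2 : v ∉ 𝓦.sep x₀ z := by rw [hzs]; simp
    rw [mem_sep hx₀ hz] at m1 m2
    rw [mem_sep hx₀ hy] at hw hv
    have m3 := k1 v hvw
    -- Scaling by the values at y makes y positive for both forms and removes a case distinction on
    -- signs.
    refine not_four_quadrants 𝓦.convex (f := 𝓦.form w y • 𝓦.form w) (g := 𝓦.form v y • 𝓦.form v)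
      ?_ hx₀.1 hy.1 hy'.1 hz.1 ?_ ?_ ?_ ?_ ?_ ?_ ?_ ?_
    · intro x hx h0
      simp only [LinearMap.smul_apply, smul_eq_mul, mul_eq_zero, hy.2, false_or, ne_eq] at h0 ⊢
      exact 𝓦.disjoint w v (Ne.symm hvw) x hx h0
    all_goals simp only [LinearMap.smul_apply, smul_eq_mul]
    · exact form_mul_neg hy hx₀ fun h => hw h.symm
    · exact form_mul_pos hy hy Iff.rfl
    · exact form_mul_neg hy hy' fun h => k2 h.symm
    · exact form_mul_pos hy hz (by clear * - hw m1; tauto)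
    · exact form_mul_neg hy hx₀ fun h => hv h.symm
    · exact form_mul_pos hy hy Iff.rfl
    · exact form_mul_pos hy hy' m3.symm
    · exact form_mul_neg hy hz (by clear * - hv m2; tauto)
  rw [develop, dif_pos hex, huniq, herase]

variable (𝓦 x₀) in
/-- The bending cocycle. -/
def cocycle (x y : E) : G :=
  (𝓦.develop R x₀ (𝓦.sep x₀ x))⁻¹ * 𝓦.develop R x₀ (𝓦.sep x₀ y)

theorem cocycle_mul (x y z : E) :
    𝓦.cocycle R x₀ x y * 𝓦.cocycle R x₀ y z = 𝓦.cocycle R x₀ x z := by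
  simp [cocycle, mul_assoc]

theorem cocycle_of_sep_empty (hx₀ : 𝓦.IsRegular x₀) {x y : E} (hx : 𝓦.IsRegular x)
    (hy : 𝓦.IsRegular y) (h : 𝓦.sep x y = ∅) : 𝓦.cocycle R x₀ x y = 1 := by
  have : 𝓦.sep x₀ x = 𝓦.sep x₀ y := by
    rw [sep_eq_empty hx hy] at h
    ext v
    rw [mem_sep hx₀ hx, mem_sep hx₀ hy, h v]
  rw [cocycle, this, inv_mul_cancel]

/-- One of x, y is farther from x₀ by exactly the wall w. If it is x, the wall is crossed backwards,
and the inverse that appears matches the change of side in `crossing`. -/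
theorem cocycle_of_sep_singleton (hx₀ : 𝓦.IsRegular x₀) {x y : E} (hx : 𝓦.IsRegular x)
    (hy : 𝓦.IsRegular y) {w : W} (h : 𝓦.sep x y = {w}) :
    𝓦.cocycle R x₀ x y = 𝓦.crossing R x w := by
  have k2 := not_pos_iff_of_sep_singleton hx hy h
  by_cases hw : w ∈ 𝓦.sep x₀ y
  · rw [cocycle, develop_of_mem R hx₀ hy hx h hw, inv_mul_cancel_left]
    rw [mem_sep hx₀ hy] at hw
    have : 𝓦.Pos w x₀ ↔ 𝓦.Pos w x := by tauto
    by_cases hp : 𝓦.Pos w x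
    · rw [crossing, crossing, if_pos hp, if_pos (this.2 hp)]
    · rw [crossing, crossing, if_neg hp, if_neg (fun h => hp (this.1 h))]
  · have hw' : w ∈ 𝓦.sep x₀ x := by
      rw [mem_sep hx₀ hy] at hw
      rw [mem_sep hx₀ hx]; tauto
    have h' : 𝓦.sep y x = {w} := by
      rw [← h]; ext v; rw [mem_sep hy hx, mem_sep hx hy]; tauto
    rw [cocycle, develop_of_mem R hx₀ hx hy h' hw']
    rw [mem_sep hx₀ hx] at hw'
    simp only [mul_inv_rev, inv_mul_cancel_right, crossing]
    by_cases hp : 𝓦.Pos w x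
    · rw [if_pos hp, if_neg (by tauto)]
    · rw [if_neg hp, if_pos (by tauto), inv_inv]

end Development

/-! ### Group actions -/

/-- An action of a group on a wall space. -/
structure Action {E W : Type*} [AddCommGroup E] [Module ℝ E] (𝓦 : WallSpace E W)
    (Γ : Type*) [Group Γ] where
  /-- the action on points -/
  act : Γ → E → E
  /-- the action on walls -/
  wact : Γ → W → W
  act_one : ∀ x, act 1 x = x
  act_mul : ∀ g h x, act (g * h) x = act g (act h x)
  wact_one : ∀ v, wact 1 v = v
  wact_mul : ∀ g h v, wact (g * h) v = wact g (wact h v)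
  act_mem : ∀ g x, x ∈ 𝓦.cone → act g x ∈ 𝓦.cone
  form_act : ∀ g v x, 𝓦.form (wact g v) (act g x) = 𝓦.form v x

namespace Action

variable {E W Γ G : Type*} [AddCommGroup E] [Module ℝ E] [Group Γ] [Group G]
  {𝓦 : WallSpace E W} (A : Action 𝓦 Γ)
include A

theorem wact_inv_wact (g : Γ) (v : W) : A.wact g⁻¹ (A.wact g v) = v := by
  rw [← A.wact_mul, inv_mul_cancel, A.wact_one]

theorem wact_wact_inv (g : Γ) (v : W) : A.wact g (A.wact g⁻¹ v) = v := by
  rw [← A.wact_mul, mul_inv_cancel, A.wact_one]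

theorem act_inv_act (g : Γ) (x : E) : A.act g⁻¹ (A.act g x) = x := by
  rw [← A.act_mul, inv_mul_cancel, A.act_one]

theorem form_act' (g : Γ) (v : W) (x : E) :
    𝓦.form v (A.act g x) = 𝓦.form (A.wact g⁻¹ v) x := by
  rw [← A.form_act g (A.wact g⁻¹ v), A.wact_wact_inv]

theorem isRegular_act {g : Γ} {x : E} (hx : 𝓦.IsRegular x) : 𝓦.IsRegular (A.act g x) :=
  ⟨A.act_mem g x hx.1, fun v => by rw [A.form_act']; exact hx.2 _⟩

theorem pos_act (g : Γ) (v : W) (x : E) : 𝓦.Pos (A.wact g v) (A.act g x) ↔ 𝓦.Pos v x := by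
  unfold Pos; rw [A.form_act]

theorem mem_sep_act {g : Γ} {x y : E} (hx : 𝓦.IsRegular x) (hy : 𝓦.IsRegular y) {v : W} :
    A.wact g v ∈ 𝓦.sep (A.act g x) (A.act g y) ↔ v ∈ 𝓦.sep x y := by
  rw [mem_sep (A.isRegular_act hx) (A.isRegular_act hy), mem_sep hx hy, A.pos_act, A.pos_act]

theorem sep_act_eq_empty {g : Γ} {x y : E} (hx : 𝓦.IsRegular x) (hy : 𝓦.IsRegular y) :
    𝓦.sep (A.act g x) (A.act g y) = ∅ ↔ 𝓦.sep x y = ∅ := by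
  simp only [Finset.eq_empty_iff_forall_notMem]
  constructor
  · intro h v hv
    exact h _ ((A.mem_sep_act hx hy).2 hv)
  · intro h v hv
    rw [← A.wact_wact_inv g v, A.mem_sep_act hx hy] at hv
    exact h _ hv

theorem sep_act_eq_singleton {g : Γ} {x y : E} (hx : 𝓦.IsRegular x) (hy : 𝓦.IsRegular y) {w : W}
    (h : 𝓦.sep x y = {w}) : 𝓦.sep (A.act g x) (A.act g y) = {A.wact g w} := by
  ext v
  rw [← A.wact_wact_inv g v, A.mem_sep_act hx hy, h]
  simp only [Finset.mem_singleton]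
  constructor
  · intro h; rw [h]
  · intro h; rw [← A.wact_inv_wact g w, ← h, A.wact_inv_wact]

theorem isAdjacent_act {g : Γ} {x : E} {w : W} (h : 𝓦.IsAdjacent x w) :
    𝓦.IsAdjacent (A.act g x) (A.wact g w) := by
  intro v hv q hq hwq
  have h1 : A.wact g⁻¹ v ≠ w := fun h => hv (by rw [← h, A.wact_wact_inv])
  have h2 : 𝓦.form w (A.act g⁻¹ q) = 0 := by
    rw [A.form_act', inv_inv, hwq]
  have := h _ h1 _ (A.act_mem g⁻¹ q hq) h2
  rw [A.form_act', inv_inv, A.wact_wact_inv] at this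
  rwa [A.form_act']

/-- Equivariance is clear for a single crossing, since R is equivariant and the action respects
sides. The cocycle is a product of single crossings. -/
theorem cocycle_act [DecidableEq W] {R : W → G} {ρ : Γ →* G}
    (hR : ∀ g v, R (A.wact g v) = ρ g * R v * (ρ g)⁻¹) {x₀ : E} (hx₀ : 𝓦.IsRegular x₀) (g : Γ)
    {x y : E} (hx : 𝓦.IsRegular x) (hy : 𝓦.IsRegular y) :
    𝓦.cocycle R x₀ (A.act g x) (A.act g y) = ρ g * 𝓦.cocycle R x₀ x y * (ρ g)⁻¹ := by
  induction hn : (𝓦.sep x y).card using Nat.strong_induction_on generalizing y with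
  | _ n ih =>
  rcases (𝓦.sep x y).eq_empty_or_nonempty with he | hne
  · rw [cocycle_of_sep_empty R hx₀ hx hy he, cocycle_of_sep_empty R hx₀ (A.isRegular_act hx)
      (A.isRegular_act hy) ((A.sep_act_eq_empty hx hy).2 he)]
    simp
  · obtain ⟨w, hw, y', hy', h1, h2⟩ := exists_last_step hx hy hne
    have hlt : (𝓦.sep x y').card < n := by
      rw [h2, ← hn]; exact Finset.card_erase_lt_of_mem hw
    rw [← cocycle_mul R x y' y, ← cocycle_mul R _ (A.act g y') _, ih _ hlt hy' rfl,
      cocycle_of_sep_singleton R hx₀ hy' hy h1,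
      cocycle_of_sep_singleton R hx₀ (A.isRegular_act hy') (A.isRegular_act hy)
        (A.sep_act_eq_singleton hy' hy h1)]
    by_cases hp : 𝓦.Pos w y'
    · rw [crossing, crossing, if_pos hp, if_pos ((A.pos_act g w y').2 hp), hR]
      group
    · rw [crossing, crossing, if_neg hp, if_neg (fun h => hp ((A.pos_act g w y').1 h)), hR]
      group

/-- The bent representation. -/
def bend [DecidableEq W] {R : W → G} {ρ : Γ →* G}
    (hR : ∀ g v, R (A.wact g v) = ρ g * R v * (ρ g)⁻¹) {x₀ : E} (hx₀ : 𝓦.IsRegular x₀) :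
    Γ →* G where
  toFun g := 𝓦.cocycle R x₀ x₀ (A.act g x₀) * ρ g
  map_one' := by
    rw [A.act_one, cocycle, inv_mul_cancel, map_one, mul_one]
  -- c(x₀, ghx₀) = c(x₀, gx₀) · c(gx₀, ghx₀), and the second factor is the conjugate of c(x₀, hx₀)
  -- by ρ(g).
  map_mul' g h := by
    rw [A.act_mul, ← cocycle_mul R x₀ (A.act g x₀),
      A.cocycle_act hR hx₀ g hx₀ (A.isRegular_act hx₀), map_mul]
    group

theorem bend_of_sep_empty [DecidableEq W] {R : W → G} {ρ : Γ →* G}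
    (hR : ∀ g v, R (A.wact g v) = ρ g * R v * (ρ g)⁻¹) {x₀ : E} (hx₀ : 𝓦.IsRegular x₀) {g : Γ}
    (h : 𝓦.sep x₀ (A.act g x₀) = ∅) : A.bend hR hx₀ g = ρ g := by
  change 𝓦.cocycle R x₀ x₀ (A.act g x₀) * ρ g = _
  rw [cocycle_of_sep_empty R hx₀ hx₀ (A.isRegular_act hx₀) h, one_mul]

theorem bend_of_sep_singleton [DecidableEq W] {R : W → G} {ρ : Γ →* G}
    (hR : ∀ g v, R (A.wact g v) = ρ g * R v * (ρ g)⁻¹) {x₀ : E} (hx₀ : 𝓦.IsRegular x₀) {g : Γ}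
    {w : W} (h : 𝓦.sep x₀ (A.act g x₀) = {w}) (hw : ¬ 𝓦.Pos w x₀) :
    A.bend hR hx₀ g = R w * ρ g := by
  change 𝓦.cocycle R x₀ x₀ (A.act g x₀) * ρ g = _
  rw [cocycle_of_sep_singleton R hx₀ hx₀ (A.isRegular_act hx₀) h, crossing, if_neg hw]

/-- If every chamber adjacent to the base chamber is reached by an element of `H`, then every
chamber is. -/
theorem exists_mem_sep_eq_empty {x₀ : E} (hx₀ : 𝓦.IsRegular x₀) (H : Subgroup Γ)
    (hH : ∀ y w, 𝓦.IsRegular y → 𝓦.sep x₀ y = {w} → ∃ h ∈ H, 𝓦.sep (A.act h x₀) y = ∅)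
    {y : E} (hy : 𝓦.IsRegular y) : ∃ h ∈ H, 𝓦.sep (A.act h x₀) y = ∅ := by
  classical
  induction hn : (𝓦.sep x₀ y).card using Nat.strong_induction_on generalizing y with
  | _ n ih =>
  rcases (𝓦.sep x₀ y).eq_empty_or_nonempty with he | hne
  · exact ⟨1, H.one_mem, by rwa [A.act_one]⟩
  · obtain ⟨w, hw, y', hy', h1, h2⟩ := exists_last_step hx₀ hy hne
    have hlt : (𝓦.sep x₀ y').card < n := by
      rw [h2, ← hn]; exact Finset.card_erase_lt_of_mem hw
    obtain ⟨h, hh, hs⟩ := ih _ hlt hy' rfl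
    have hgx := A.isRegular_act (g := h) hx₀
    have hgy := A.isRegular_act (g := h⁻¹) hy
    have hs1 : 𝓦.sep (A.act h x₀) y = {w} := by
      rw [sep_eq_empty hgx hy'] at hs
      rw [← h1]; ext v
      rw [mem_sep hgx hy, mem_sep hy' hy, hs v]
    have hs2 : 𝓦.sep x₀ (A.act h⁻¹ y) = {A.wact h⁻¹ w} := by
      have := A.sep_act_eq_singleton (g := h⁻¹) hgx hy hs1
      rwa [A.act_inv_act] at this
    obtain ⟨k, hk, hs3⟩ := hH _ _ hgy hs2
    refine ⟨h * k, H.mul_mem hh hk, ?_⟩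
    rw [A.act_mul, ← A.sep_act_eq_empty (g := h⁻¹) (A.isRegular_act (A.isRegular_act hx₀)) hy,
      A.act_inv_act]
    exact hs3

/-- If the walls form one orbit, every chamber is a translate of the base chamber by an element of
the group generated by the stabilizer of the base chamber and an element that crosses one wall. -/
theorem exists_mem_closure_sep {x₀ q₀ : E} {w₀ : W} {u : Γ} (hr : 𝓦.IsRegular x₀)
    (hadj : 𝓦.IsAdjacent x₀ w₀) (hadj' : 𝓦.IsAdjacent (A.act u x₀) w₀)
    (hpos : ¬ 𝓦.Pos w₀ x₀) (hpos' : 𝓦.Pos w₀ (A.act u x₀)) (hq₀ : q₀ ∈ 𝓦.cone)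
    (hwq₀ : 𝓦.form w₀ q₀ = 0) (htrans : ∀ w, ∃ g, A.wact g w₀ = w) {y : E}
    (hy : 𝓦.IsRegular y) :
    ∃ h ∈ Subgroup.closure ({g | 𝓦.sep x₀ (A.act g x₀) = ∅} ∪ {u}),
      𝓦.sep (A.act h x₀) y = ∅ := by
  set C : Set Γ := {g | 𝓦.sep x₀ (A.act g x₀) = ∅} with hC
  have hCmem : ∀ g, 𝓦.sep x₀ (A.act g x₀) = ∅ → g ∈ C := fun g hg => hg
  set H := Subgroup.closure (C ∪ {u}) with hH
  have huH : u ∈ H := Subgroup.subset_closure (Or.inr rfl)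
  refine A.exists_mem_sep_eq_empty hr H ?_ hy
  intro y w hy hs
  have hxw := isAdjacent_of_sep hr hy hs
  have hyw : 𝓦.IsAdjacent y w := by
    refine isAdjacent_of_sep hy hr ?_
    rw [← hs]; ext v; rw [mem_sep hy hr, mem_sep hr hy]; tauto
  have hne := not_pos_iff_of_sep_singleton hr hy hs
  obtain ⟨g, hgw⟩ := htrans w
  have h1 := A.isAdjacent_act (g := g) hadj
  have h2 := A.isAdjacent_act (g := g) hadj'
  have p1 := A.pos_act g w₀ x₀
  have p2 := A.pos_act g w₀ (A.act u x₀)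
  have hq := A.act_mem g _ hq₀
  have hwq := A.form_act g w₀ q₀
  rw [hwq₀] at hwq
  rw [← A.act_mul] at h2 p2
  rw [hgw] at h1 h2 p1 p2 hwq
  have hrg := A.isRegular_act (g := g) hr
  have hrgu := A.isRegular_act (g := g * u) hr
  replace p1 := mt p1.1 hpos
  replace p2 := p2.2 hpos'
  -- The points gx₀ and gux₀ lie on the two sides of w = g w₀, in chambers adjacent to it. The one
  -- on the side of x₀ is in the chamber of x₀, the other in the chamber of y.
  by_cases hx : 𝓦.Pos w x₀
  · have hgu := hCmem _ (sep_eq_empty_of_isAdjacent hr hrgu hxw h2 hq hwq (iff_of_true hx p2))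
    have hgH : g ∈ H := by
      have := H.mul_mem (Subgroup.subset_closure (Or.inl hgu)) (H.inv_mem huH)
      rwa [mul_inv_cancel_right] at this
    exact ⟨g, hgH, sep_eq_empty_of_isAdjacent hrg hy h1 hyw hq hwq
      (iff_of_false p1 (by clear * - hne hx; tauto))⟩
  · have hg' := hCmem _ (sep_eq_empty_of_isAdjacent hr hrg hxw h1 hq hwq (iff_of_false hx p1))
    exact ⟨g * u, H.mul_mem (Subgroup.subset_closure (Or.inl hg')) huH,
      sep_eq_empty_of_isAdjacent hrgu hy h2 hyw hq hwq
        (iff_of_true p2 (by clear * - hne hx; tauto))⟩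

end Action

end WallSpace

/-! ### Hermitian matrices and walls -/

/-- The Hermitian matrix with the given entries. -/
def herm (a c : ℝ) (b : ℂ) : Matrix (Fin 2) (Fin 2) ℂ := !![(a : ℂ), b; (starRingEnd ℂ) b, (c : ℂ)]

/-- The skew-Hermitian matrix with the given entries. -/
def skew (p q : ℝ) (z : ℂ) : Matrix (Fin 2) (Fin 2) ℂ :=
  !![Complex.I * p, z; -(starRingEnd ℂ) z, Complex.I * q]

theorem posDef_iff {X : Matrix (Fin 2) (Fin 2) ℂ} :
    X.PosDef ↔ ∃ (a c : ℝ) (b : ℂ), X = herm a c b ∧ 0 < a ∧ 0 < c ∧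
      Complex.normSq b < a * c := by
  constructor
  · intro h
    have h0 := h.diag_pos (i := 0)
    have h1 := h.diag_pos (i := 1)
    have hdet := h.det_pos
    rw [Complex.lt_def] at h0 h1
    have e01 : X 1 0 = (starRingEnd ℂ) (X 0 1) := by
      have := congrFun (congrFun h.isHermitian.eq 1) 0
      simpa [Matrix.conjTranspose_apply] using this.symm
    have e0 : X 0 0 = ((X 0 0).re : ℂ) := by
      apply Complex.ext <;> simp [← h0.2]
    have e1 : X 1 1 = ((X 1 1).re : ℂ) := by
      apply Complex.ext <;> simp [← h1.2]
    refine ⟨(X 0 0).re, (X 1 1).re, X 0 1, ?_, h0.1, h1.1, ?_⟩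
    · ext i j
      fin_cases i <;> fin_cases j
      · exact e0
      · rfl
      · exact e01
      · exact e1
    · rw [Matrix.det_fin_two, e0, e1, e01, Complex.mul_conj] at hdet
      have : (0 : ℂ) < (((X 0 0).re * (X 1 1).re - Complex.normSq (X 0 1) : ℝ) : ℂ) := by
        push_cast; exact hdet
      have := Complex.zero_lt_real.1 this
      linarith
  · rintro ⟨a, c, b, rfl, ha, hc, hb⟩
    refine Matrix.PosDef.of_dotProduct_mulVec_pos ?_ ?_
    · ext i j
      fin_cases i <;> fin_cases j <;> simp [herm]
    · intro x hx
      have key : star x ⬝ᵥ (herm a c b).mulVec x =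
          ((Complex.normSq (a * x 0 + b * x 1) + (a * c - Complex.normSq b) * Complex.normSq (x 1))
            / a : ℝ) := by
        apply Complex.ext
        · simp only [herm, dotProduct, Matrix.mulVec, Fin.sum_univ_two, Complex.normSq_apply]
          simp
          field_simp
          ring
        · simp only [herm, dotProduct, Matrix.mulVec, Fin.sum_univ_two, Complex.normSq_apply]
          simp
          ring
      rw [key, Complex.zero_lt_real]
      apply div_pos _ ha
      by_cases h1 : x 1 = 0
      · have h0 : x 0 ≠ 0 := by
          intro h0
          apply hx
          ext i
          fin_cases i <;> simp [h0, h1]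
        have : 0 < Complex.normSq (a * x 0) := by
          rw [Complex.normSq_pos]
          exact mul_ne_zero (by exact_mod_cast ha.ne') h0
        simpa [h1] using this
      · have : 0 < Complex.normSq (x 1) := Complex.normSq_pos.2 h1
        have h2 := Complex.normSq_nonneg (a * x 0 + b * x 1)
        have h3 : 0 < (a * c - Complex.normSq b) := by linarith
        positivity

/-- The pairing of `2 × 2` matrices used to define walls. -/
def wallForm (v : Matrix (Fin 2) (Fin 2) ℂ) : Matrix (Fin 2) (Fin 2) ℂ →ₗ[ℝ] ℝ where
  toFun X := (X * v.adjugate).trace.im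
  map_add' X Y := by rw [Matrix.add_mul, Matrix.trace_add, Complex.add_im]
  map_smul' c X := by
    rw [Matrix.smul_mul, Matrix.trace_smul]
    simp

theorem wallForm_skew (p q : ℝ) (z : ℂ) (a c : ℝ) (b : ℂ) :
    wallForm (skew p q z) (herm a c b) =
      a * q + c * p + 2 * (b.im * z.re - b.re * z.im) := by
  change ((herm a c b) * (skew p q z).adjugate).trace.im = _
  simp [herm, skew, Matrix.adjugate_fin_two, Matrix.trace_fin_two]
  ring

theorem wallForm_conj {g : Matrix (Fin 2) (Fin 2) ℂ} (hg : g.det = 1)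
    (v X : Matrix (Fin 2) (Fin 2) ℂ) :
    wallForm (g * v * g.conjTranspose) (g * X * g.conjTranspose) = wallForm v X := by
  change (g * X * g.conjTranspose * (g * v * g.conjTranspose).adjugate).trace.im =
    (X * v.adjugate).trace.im
  have hg' : g.conjTranspose.det = 1 := by simp [Matrix.det_conjTranspose, hg]
  congr 1
  rw [Matrix.adjugate_mul_distrib, Matrix.adjugate_mul_distrib]
  calc _ = (g * X * (g.conjTranspose * g.conjTranspose.adjugate) * v.adjugate *
          g.adjugate).trace := by simp only [Matrix.mul_assoc]
    _ = (g * (X * v.adjugate) * g.adjugate).trace := by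
        rw [Matrix.mul_adjugate, hg']; simp [Matrix.mul_assoc]
    _ = _ := by
        rw [Matrix.trace_mul_comm, ← Matrix.mul_assoc, Matrix.adjugate_mul, hg]
        simp

/-- The normal vector of the modular plane. -/
def matJ : Matrix (Fin 2) (Fin 2) ℂ := !![0, 1; -1, 0]

theorem matJ_eq_skew : matJ = skew 0 0 1 := by
  ext i j; fin_cases i <;> fin_cases j <;> simp [matJ, skew]

/-- The normal vector of the image of the modular plane under `g`. -/
def wallMat {d : ℕ} (g : SL(2, ringO d)) : Matrix (Fin 2) (Fin 2) ℂ :=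
  (toSLC d g).val * matJ * (toSLC d g).val.conjTranspose

theorem toSLC_val {d : ℕ} (g : SL(2, ringO d)) :
    (toSLC d g).val = !![(g.val 0 0 : ℂ), (g.val 0 1 : ℂ); (g.val 1 0 : ℂ), (g.val 1 1 : ℂ)] := by
  ext i j; fin_cases i <;> fin_cases j <;> rfl

theorem det_entries {d : ℕ} (g : SL(2, ringO d)) :
    (g.val 0 0 : ℂ) * (g.val 1 1 : ℂ) - (g.val 0 1 : ℂ) * (g.val 1 0 : ℂ) = 1 := by
  have := (toSLC d g).prop
  rwa [toSLC_val, Matrix.det_fin_two_of] at this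

theorem toSLC_det {d : ℕ} (g : SL(2, ringO d)) : (toSLC d g).val.det = 1 := (toSLC d g).prop

/-- Coordinates of a wall: `p`, `q` are multiples of `2δ`, and `z ∈ 𝒪_d`. -/
structure IsWallData (d : ℕ) (P Q : ℤ) (z : ℂ) : Prop where
  mem : z ∈ ringO d
  norm : Complex.normSq z - (2 * delta d * P) * (2 * delta d * Q) = 1
  re : ∃ m : ℤ, z.re = 1 + 2 * delta d ^ 2 * m

/-- For g with rows (a, b), (c, e) one finds p = 2 Im(a b̄), q = 2 Im(c ē), z = a ē - b c̄. The norm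
equation says det(gJg*) = 1. The congruence comes from Re(a ē) = Re(ae) + 2 Im a Im e together with
ae - bc = 1. -/
theorem exists_wallData {d : ℕ} (hd : Admissible d) (g : SL(2, ringO d)) :
    ∃ (P Q : ℤ) (z : ℂ), IsWallData d P Q z ∧
      wallMat g = skew (2 * delta d * P) (2 * delta d * Q) z := by
  have hdet := det_entries g
  have hval := toSLC_val g
  have ha : (g.val 0 0 : ℂ) ∈ ringO d := (g.val 0 0).2
  have hb : (g.val 0 1 : ℂ) ∈ ringO d := (g.val 0 1).2
  have hc : (g.val 1 0 : ℂ) ∈ ringO d := (g.val 1 0).2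
  have hd' : (g.val 1 1 : ℂ) ∈ ringO d := (g.val 1 1).2
  have hw : wallMat g = (toSLC d g).val * matJ * (toSLC d g).val.conjTranspose := rfl
  rw [hval] at hw
  generalize (g.val 0 0 : ℂ) = a at *
  generalize (g.val 0 1 : ℂ) = b at *
  generalize (g.val 1 0 : ℂ) = c at *
  generalize (g.val 1 1 : ℂ) = e at *
  obtain ⟨P, hP⟩ := hd.exists_int_im (mul_mem ha (hd.star_mem hb))
  obtain ⟨Q, hQ⟩ := hd.exists_int_im (mul_mem hc (hd.star_mem hd'))
  obtain ⟨a1, ha1⟩ := hd.exists_int_im ha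
  obtain ⟨b1, hb1⟩ := hd.exists_int_im hb
  obtain ⟨c1, hc1⟩ := hd.exists_int_im hc
  obtain ⟨e1, he1⟩ := hd.exists_int_im hd'
  have hre := congrArg Complex.re hdet
  have him := congrArg Complex.im hdet
  simp at hP hQ hre him
  refine ⟨P, Q, a * (starRingEnd ℂ) e - b * (starRingEnd ℂ) c, ⟨?_, ?_, ?_⟩, ?_⟩
  · exact sub_mem (mul_mem ha (hd.star_mem hd')) (mul_mem hb (hd.star_mem hc))
  · have e1 : 2 * delta d * P = 2 * (-(a.re * b.im) + a.im * b.re) := by rw [hP]; ring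
    have e2 : 2 * delta d * Q = 2 * (-(c.re * e.im) + c.im * e.re) := by rw [hQ]; ring
    rw [e1, e2, Complex.normSq_apply]
    simp
    linear_combination (a.re * e.re - a.im * e.im - (b.re * c.re - b.im * c.im) + 1) * hre +
      (a.re * e.im + a.im * e.re - (b.re * c.im + b.im * c.re)) * him
  · refine ⟨a1 * e1 - b1 * c1, ?_⟩
    simp
    rw [ha1, hb1, hc1, he1] at *
    linear_combination hre
  · rw [hw]
    ext i j
    fin_cases i <;> fin_cases j
    · apply Complex.ext
      · simp [matJ, skew, Matrix.mul_apply, Fin.sum_univ_two]; ring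
      · simp [matJ, skew, Matrix.mul_apply, Fin.sum_univ_two]
        linear_combination 2 * hP
    · simp [matJ, skew, Matrix.mul_apply, Fin.sum_univ_two]; ring
    · simp [matJ, skew, Matrix.mul_apply, Fin.sum_univ_two]; ring
    · apply Complex.ext
      · simp [matJ, skew, Matrix.mul_apply, Fin.sum_univ_two]; ring
      · simp [matJ, skew, Matrix.mul_apply, Fin.sum_univ_two]
        linear_combination 2 * hQ

namespace IsWallData

variable {d : ℕ} (hd : Admissible d) {P Q : ℤ} {z : ℂ} (h : IsWallData d P Q z)
include hd h

/-- The only other possibility, z = -1, violates Re z ≡ 1 mod 2δ² because 2δ² > 2. -/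
theorem eq_one_of_normSq (hz : Complex.normSq z = 1) : z = 1 := by
  rcases hd.eq_one_or_of_normSq h.mem hz with h1 | h1
  · exact h1
  · obtain ⟨m, hm⟩ := h.re
    rw [h1] at hm
    have h7 := hd.delta_sq
    simp at hm
    rcases lt_trichotomy m 0 with h0 | h0 | h0
    · have : (m : ℝ) ≤ -1 := by exact_mod_cast (by omega : m ≤ -1)
      nlinarith
    · rw [h0] at hm; norm_num at hm
    · have : (0 : ℝ) < m := by exact_mod_cast h0
      nlinarith

/-- The numbers congruent to 1 modulo 2δ² ≥ 7/2 other than 1 itself have absolute value greater than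
1. -/
theorem one_le_re_sq : 1 ≤ z.re ^ 2 := by
  obtain ⟨m, hm⟩ := h.re
  have h7 := hd.delta_sq
  rcases lt_trichotomy m 0 with h0 | h0 | h0
  · have : (m : ℝ) ≤ -1 := by exact_mod_cast (by omega : m ≤ -1)
    have : z.re ≤ -1 := by nlinarith
    nlinarith
  · rw [hm, h0]; norm_num
  · have : (0 : ℝ) < m := by exact_mod_cast h0
    have : 1 ≤ z.re := by nlinarith
    nlinarith

/-- At a point with b real the second equation reads aq + cp = 2b Im z. Since (Re z)² ≥ 1, pq = |z|²
- 1 ≥ (Im z)², while ac > b². The inequality between arithmetic and geometric means then leaves only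
p = q = Im z = 0, and z = 1. -/
theorem eq_matJ_of_common_zero {X : Matrix (Fin 2) (Fin 2) ℂ} (hX : X.PosDef)
    (h1 : wallForm matJ X = 0)
    (h2 : wallForm (skew (2 * delta d * P) (2 * delta d * Q) z) X = 0) :
    skew (2 * delta d * P) (2 * delta d * Q) z = matJ := by
  obtain ⟨a, c, b, rfl, ha, hc, hb⟩ := posDef_iff.1 hX
  rw [matJ_eq_skew, wallForm_skew] at h1
  rw [wallForm_skew] at h2
  have hre := h.one_le_re_sq hd
  have hn := h.norm
  have hone := h.eq_one_of_normSq hd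
  have hbim : b.im = 0 := by simpa using h1
  generalize 2 * delta d * (P : ℝ) = p at *
  generalize 2 * delta d * (Q : ℝ) = q at *
  rw [Complex.normSq_apply] at hb hn
  rw [hbim] at h2 hb
  have hpq : z.im ^ 2 ≤ p * q := by nlinarith
  have hq : q = 0 := by
    by_contra hq
    have hq2 : 0 < q ^ 2 := by positivity
    have e : q * (a * q + c * p + 2 * (0 * z.re - b.re * z.im)) = 0 := by rw [h2, mul_zero]
    -- The equation multiplied by cq becomes a sum of nonnegative terms, the first of them positive
    -- if q ≠ 0.
    have e2 : q ^ 2 * (a * c - b.re ^ 2) + (b.re * q - c * z.im) ^ 2 +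
        c ^ 2 * (p * q - z.im ^ 2) = 0 := by
      linear_combination c * e
    have : 0 < q ^ 2 * (a * c - b.re ^ 2) := mul_pos hq2 (by nlinarith)
    have : 0 ≤ c ^ 2 * (p * q - z.im ^ 2) := mul_nonneg (sq_nonneg c) (by linarith)
    nlinarith [sq_nonneg (b.re * q - c * z.im)]
  have hzi : z.im = 0 := by
    rw [hq, mul_zero] at hpq
    exact pow_eq_zero_iff two_ne_zero |>.1 (le_antisymm hpq (sq_nonneg _))
  have hp : p = 0 := by
    rw [hq, hzi] at h2
    simp at h2
    exact h2.resolve_left hc.ne'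
  have hz : z = 1 := hone (by rw [Complex.normSq_apply]; rw [hp, hq] at hn; linarith)
  rw [hp, hq, hz, matJ_eq_skew]

end IsWallData

/-! ### The wall space of a Bianchi group -/

/-- The walls of `Bi(d)`, given by their normal vectors. -/
def Wall (d : ℕ) : Type := {v : Matrix (Fin 2) (Fin 2) ℂ // ∃ g : SL(2, ringO d), v = wallMat g}

theorem wallMat_mul {d : ℕ} (g h : SL(2, ringO d)) :
    wallMat (g * h) = (toSLC d g).val * wallMat h * (toSLC d g).val.conjTranspose := by
  simp only [wallMat, map_mul, Matrix.SpecialLinearGroup.coe_mul, Matrix.conjTranspose_mul,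
    Matrix.mul_assoc]

theorem wallMat_one {d : ℕ} : wallMat (1 : SL(2, ringO d)) = matJ := by
  simp [wallMat]

/-- The action of `SL(2, 𝒪_d)` on matrices. -/
def actM {d : ℕ} (g : SL(2, ringO d)) (X : Matrix (Fin 2) (Fin 2) ℂ) :
    Matrix (Fin 2) (Fin 2) ℂ :=
  (toSLC d g).val * X * (toSLC d g).val.conjTranspose

theorem hermAct_apply {d : ℕ} (g : SL(2, ringO d)) (X : Matrix (Fin 2) (Fin 2) ℂ) :
    hermAct (toSLC d g) X = actM g X := rfl

theorem actM_one {d : ℕ} (X : Matrix (Fin 2) (Fin 2) ℂ) :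
    actM (1 : SL(2, ringO d)) X = X := by simp [actM]

theorem actM_mul {d : ℕ} (g h : SL(2, ringO d)) (X : Matrix (Fin 2) (Fin 2) ℂ) :
    actM (g * h) X = actM g (actM h X) := by
  simp only [actM, map_mul, Matrix.SpecialLinearGroup.coe_mul, Matrix.conjTranspose_mul,
    Matrix.mul_assoc]

theorem posDef_conj {g X : Matrix (Fin 2) (Fin 2) ℂ} (hg : g.det = 1) (hX : X.PosDef) :
    (g * X * g.conjTranspose).PosDef := by
  have hu : IsUnit g := by
    rw [Matrix.isUnit_iff_isUnit_det, hg]; exact isUnit_one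
  exact (Matrix.IsUnit.posDef_star_right_conjugate_iff hu).2 hX

theorem posDef_actM {d : ℕ} {g : SL(2, ringO d)} {X : Matrix (Fin 2) (Fin 2) ℂ}
    (hX : X.PosDef) : (actM g X).PosDef := posDef_conj (toSLC_det g) hX

theorem wallForm_actM {d : ℕ} (g : SL(2, ringO d)) (v X : Matrix (Fin 2) (Fin 2) ℂ) :
    wallForm (actM g v) (actM g X) = wallForm v X := wallForm_conj (toSLC_det g) v X

/-- The action of `SL(2, 𝒪_d)` on walls. -/
def wactM {d : ℕ} (g : SL(2, ringO d)) (v : Wall d) : Wall d :=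
  ⟨actM g v.1, by
    obtain ⟨h, hh⟩ := v.2
    exact ⟨g * h, by rw [wallMat_mul, ← hh]; rfl⟩⟩

theorem convex_posDef : Convex ℝ {X : Matrix (Fin 2) (Fin 2) ℂ | X.PosDef} := by
  rw [convex_iff_forall_pos]
  intro X hX Y hY a b ha hb _
  simp only [Set.mem_ofPred_eq] at *
  exact (hX.smul ha).add (hY.smul hb)

/-- Translating v to the modular plane reduces the claim to `eq_matJ_of_common_zero`. -/
theorem wall_disjoint {d : ℕ} (hd : Admissible d) (v w : Wall d) (hvw : v ≠ w)
    {X : Matrix (Fin 2) (Fin 2) ℂ} (hX : X.PosDef) (hv : wallForm v.1 X = 0) :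
    wallForm w.1 X ≠ 0 := by
  intro hw
  obtain ⟨h, hh⟩ := v.2
  obtain ⟨g, hg⟩ := w.2
  have e1 : v.1 = actM h matJ := by rw [hh]; rfl
  have hw1 : actM h⁻¹ w.1 = wallMat (h⁻¹ * g) := by rw [hg, wallMat_mul]; rfl
  have hX' : (actM h⁻¹ X).PosDef := posDef_actM hX
  have hinv : actM h⁻¹ v.1 = matJ := by
    rw [e1, ← actM_mul, inv_mul_cancel, actM_one]
  have hv' : wallForm matJ (actM h⁻¹ X) = 0 := by rw [← hinv, wallForm_actM, hv]
  have hw' : wallForm (wallMat (h⁻¹ * g)) (actM h⁻¹ X) = 0 := by rw [← hw1, wallForm_actM, hw]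
  obtain ⟨P, Q, z, hD, he⟩ := exists_wallData hd (h⁻¹ * g)
  rw [he] at hw'
  have := hD.eq_matJ_of_common_zero hd hX' hv' hw'
  apply hvw
  apply Subtype.ext
  rw [e1, ← this, ← he, ← hw1, ← actM_mul, mul_inv_cancel, actM_one]

/-- Real estimate behind local finiteness: a wall through a point of a bounded region has bounded
coordinates. -/
theorem wall_bound {α ε β a c p q : ℝ} {b z : ℂ} (hα : 0 < α) (hε : 0 < ε) (hβ : 0 ≤ β)
    (ha : α ≤ a) (hc : α ≤ c) (hD : ε ≤ a * c - Complex.normSq b) (hac : a * c ≤ β)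
    (hn : Complex.normSq z - p * q = 1)
    (h0 : a * q + c * p + 2 * (b.im * z.re - b.re * z.im) = 0) :
    Complex.normSq z ≤ 1 + β / ε ∧ p ^ 2 ≤ (4 * β * (1 + β / ε) + 4 * β) / α ^ 2 ∧
      q ^ 2 ≤ (4 * β * (1 + β / ε) + 4 * β) / α ^ 2 := by
  have hb : Complex.normSq b ≤ β := by linarith
  have hb0 := Complex.normSq_nonneg b
  have hz0 := Complex.normSq_nonneg z
  have hs : (a * q + c * p) ^ 2 ≤ 4 * (Complex.normSq b * Complex.normSq z) := by
    have : a * q + c * p = -2 * (b.im * z.re - b.re * z.im) := by linarith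
    rw [this, Complex.normSq_apply, Complex.normSq_apply]
    nlinarith [sq_nonneg (b.re * z.re + b.im * z.im)]
  have hpq : p * q = Complex.normSq z - 1 := by linarith
  have h4 : 4 * (a * c) * (p * q) ≤ (a * q + c * p) ^ 2 := by
    nlinarith [sq_nonneg (a * q - c * p)]
  -- 4ac·pq ≤ (aq + cp)² ≤ 4|b|²(1 + pq) gives (ac - |b|²)pq ≤ |b|² ≤ β.
  have hpq1 : ε * (p * q) ≤ β := by
    rw [hpq] at h4 ⊢
    by_cases hneg : Complex.normSq z - 1 ≤ 0
    · nlinarith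
    · nlinarith
  have hz : Complex.normSq z ≤ 1 + β / ε := by
    have : p * q ≤ β / ε := by rw [le_div_iff₀ hε]; linarith
    linarith
  have hs2 : (a * q + c * p) ^ 2 ≤ 4 * β * (1 + β / ε) := by
    refine hs.trans ?_
    have := mul_le_mul hb hz hz0 hβ
    linarith
  have hdiff : (a * q - c * p) ^ 2 ≤ 4 * β * (1 + β / ε) + 4 * β := by
    have e : (a * q - c * p) ^ 2 = (a * q + c * p) ^ 2 - 4 * (a * c) * (p * q) := by ring
    have : 0 ≤ a * c := by nlinarith
    rw [e, hpq]
    nlinarith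
  have hB : 0 ≤ 4 * β := by linarith
  refine ⟨hz, ?_, ?_⟩
  · rw [le_div_iff₀ (by positivity)]
    have h1 : (c * p) ^ 2 ≤ 4 * β * (1 + β / ε) + 4 * β := by
      nlinarith [sq_nonneg (a * q)]
    have h2 : p ^ 2 * α ^ 2 ≤ (c * p) ^ 2 := by
      rw [mul_pow, mul_comm]
      exact mul_le_mul_of_nonneg_right (pow_le_pow_left₀ hα.le hc 2) (sq_nonneg _)
    linarith
  · rw [le_div_iff₀ (by positivity)]
    have h1 : (a * q) ^ 2 ≤ 4 * β * (1 + β / ε) + 4 * β := by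
      nlinarith [sq_nonneg (c * p)]
    have h2 : q ^ 2 * α ^ 2 ≤ (a * q) ^ 2 := by
      rw [mul_pow, mul_comm]
      exact mul_le_mul_of_nonneg_right (pow_le_pow_left₀ hα.le ha 2) (sq_nonneg _)
    linarith

theorem finite_wallData {d : ℕ} (hd : Admissible d) (B B' : ℝ) :
    {v : Matrix (Fin 2) (Fin 2) ℂ | ∃ (P Q : ℤ) (z : ℂ), IsWallData d P Q z ∧
      v = skew (2 * delta d * P) (2 * delta d * Q) z ∧ Complex.normSq z ≤ B ∧
      (2 * delta d * P) ^ 2 ≤ B' ∧ (2 * delta d * Q) ^ 2 ≤ B'}.Finite := by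
  have h7 := hd.delta_sq
  set N : ℤ := ⌈B'⌉ with hN
  have hfin : ((fun x : (ℤ × ℤ) × ℂ => skew (2 * delta d * x.1.1) (2 * delta d * x.1.2) x.2) ''
      ((Set.Icc (-N) N ×ˢ Set.Icc (-N) N) ×ˢ {x : ℂ | x ∈ ringO d ∧ Complex.normSq x ≤ B})).Finite :=
    Set.Finite.image _ (((Set.finite_Icc _ _).prod (Set.finite_Icc _ _)).prod (hd.finite_bounded B))
  refine hfin.subset ?_
  rintro v ⟨P, Q, z, hD, rfl, hz, hP, hQ⟩
  have key : ∀ P : ℤ, (2 * delta d * P) ^ 2 ≤ B' → -N ≤ P ∧ P ≤ N := by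
    intro P hP
    have h1 : (P : ℝ) ^ 2 ≤ N := by
      have := Int.le_ceil B'
      rw [← hN] at this
      have : (2 * delta d * P) ^ 2 = 4 * delta d ^ 2 * (P : ℝ) ^ 2 := by ring
      nlinarith [sq_nonneg (P : ℝ)]
    have h2 : P ^ 2 ≤ N := by exact_mod_cast h1
    constructor <;> nlinarith
  exact ⟨((P, Q), z), ⟨⟨key P hP, key Q hQ⟩, ⟨hD.mem, hz⟩⟩, rfl⟩

theorem herm_smul_add (a c a' c' s t : ℝ) (b b' : ℂ) :
    s • herm a c b + t • herm a' c' b' =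
      herm (s * a + t * a') (s * c + t * c') (s * b + t * b') := by
  ext i j; fin_cases i <;> fin_cases j <;> simp [herm]

/-- Each wall in question meets the segment from X to Y. On this compact segment the determinant is
bounded below and the diagonal entries are bounded on both sides, so `wall_bound` confines the
coordinates of the wall to a finite set. -/
theorem finite_sep_wall {d : ℕ} (hd : Admissible d) {X Y : Matrix (Fin 2) (Fin 2) ℂ}
    (hX : X.PosDef) (hY : Y.PosDef) :
    {v : Wall d | wallForm v.1 X * wallForm v.1 Y ≤ 0}.Finite := by
  obtain ⟨a, c, b, hXe, ha, hc, hb⟩ := posDef_iff.1 hX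
  obtain ⟨a', c', b', hYe, ha', hc', hb'⟩ := posDef_iff.1 hY
  set f : ℝ → ℝ := fun t => ((1 - t) * a + t * a') * ((1 - t) * c + t * c') -
    Complex.normSq (((1 - t : ℝ) : ℂ) * b + t * b') with hf
  have hfc : Continuous f := by
    have : Continuous fun t : ℝ => Complex.normSq (((1 - t : ℝ) : ℂ) * b + t * b') :=
      Complex.continuous_normSq.comp (by fun_prop)
    fun_prop
  have hfpos : ∀ t ∈ Set.Icc (0 : ℝ) 1, 0 < f t := by
    intro t ht
    have hP : ((1 - t) • X + t • Y).PosDef :=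
      convex_posDef hX hY (by linarith [ht.2]) ht.1 (by ring)
    have hdet := hP.det_pos
    rw [hXe, hYe, herm_smul_add] at hdet
    rw [herm, Matrix.det_fin_two_of, Complex.mul_conj] at hdet
    rw [← Complex.ofReal_mul, ← Complex.ofReal_sub, Complex.zero_lt_real] at hdet
    exact hdet
  obtain ⟨t₀, ht₀, hmin⟩ := isCompact_Icc.exists_isMinOn (Set.nonempty_Icc.2 zero_le_one)
    hfc.continuousOn
  set α := min (min a a') (min c c') with hα
  have hαpos : 0 < α := by simp [hα, ha, ha', hc, hc']
  set β := max a a' * max c c' with hβ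
  have hβ0 : 0 ≤ β := by
    have := le_max_left a a'
    have := le_max_left c c'
    exact mul_nonneg (by linarith) (by linarith)
  have hfin := finite_wallData hd (1 + β / f t₀) ((4 * β * (1 + β / f t₀) + 4 * β) / α ^ 2)
  refine Set.Finite.of_finite_image (f := Subtype.val) (hfin.subset ?_) Subtype.val_injective.injOn
  rintro _ ⟨v, hv, rfl⟩
  simp only [Set.mem_ofPred_eq] at hv
  obtain ⟨g, hg⟩ := v.2
  obtain ⟨P, Q, z, hD, he⟩ := exists_wallData hd g
  obtain ⟨t, ht, h0⟩ : ∃ t ∈ Set.Icc (0 : ℝ) 1, wallForm v.1 ((1 - t) • X + t • Y) = 0 := by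
    simp only [map_add, map_smul, smul_eq_mul]
    generalize wallForm v.1 X = x at *
    generalize wallForm v.1 Y = y at *
    by_cases hxy : x = y
    · subst hxy
      have : x = 0 := by nlinarith [mul_self_nonneg x]
      exact ⟨0, by simp, by simp [this]⟩
    · have hne : x - y ≠ 0 := sub_ne_zero.2 hxy
      have hsq : 0 < (x - y) ^ 2 := by positivity
      -- The parameter is x/(x - y), written with a positive denominator.
      refine ⟨x * (x - y) / (x - y) ^ 2, ⟨?_, ?_⟩, ?_⟩
      · apply div_nonneg _ hsq.le
        nlinarith [mul_self_nonneg x]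
      · rw [div_le_one hsq]
        nlinarith [mul_self_nonneg y]
      · field_simp
        ring
  have hmem : a ≤ max a a' ∧ a' ≤ max a a' ∧ c ≤ max c c' ∧ c' ≤ max c c' :=
    ⟨le_max_left _ _, le_max_right _ _, le_max_left _ _, le_max_right _ _⟩
  have hmem' : α ≤ a ∧ α ≤ a' ∧ α ≤ c ∧ α ≤ c' := by
    simp [hα]
  obtain ⟨ht0, ht1⟩ := ht
  have ht1' : 0 ≤ 1 - t := by linarith
  rw [hg, he, hXe, hYe, herm_smul_add, wallForm_skew] at h0
  have hle1 : (1 - t) * a + t * a' ≤ max a a' := by nlinarith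
  have hle2 : (1 - t) * c + t * c' ≤ max c c' := by nlinarith
  have hlb1 : α ≤ (1 - t) * a + t * a' := by nlinarith
  have hlb2 : α ≤ (1 - t) * c + t * c' := by nlinarith
  have := wall_bound hαpos (hfpos t₀ ht₀) hβ0 hlb1 hlb2 (hmin ⟨ht0, ht1⟩)
    (mul_le_mul hle1 hle2 (by linarith) (by linarith)) hD.norm h0
  exact ⟨P, Q, z, hD, by rw [hg, he], this⟩

/-- The translates of the modular plane, as a wall space on the cone of positive definite
matrices. -/
def bianchiWalls {d : ℕ} (hd : Admissible d) :
    WallSpace (Matrix (Fin 2) (Fin 2) ℂ) (Wall d) where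
  cone := {X | X.PosDef}
  convex := convex_posDef
  form v := wallForm v.1
  disjoint v w hvw _ hX hv := wall_disjoint hd v w hvw hX hv
  finite_sep _ hX _ hY := finite_sep_wall hd hX hY

/-- The action of `SL(2, 𝒪_d)` on its wall space. -/
def bianchiAction {d : ℕ} (hd : Admissible d) :
    WallSpace.Action (bianchiWalls hd) SL(2, ringO d) where
  act := actM
  wact := wactM
  act_one := actM_one
  act_mul := actM_mul
  wact_one v := Subtype.ext (actM_one v.1)
  wact_mul g h v := Subtype.ext (actM_mul g h v.1)
  act_mem _ _ hX := posDef_actM hX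
  form_act g v X := wallForm_actM g v.1 X

/-! ### The chamber of the base point -/

/-- A wall with q ≠ 0 is a hemisphere of radius 1/|q|. The bound on s puts the point higher than its
top, where the form has the sign of q. -/
theorem wallForm_high {a c p q s : ℝ} {b z : ℂ} (hc : 0 < c) (hb : Complex.normSq b < a * c)
    (hn : Complex.normSq z - p * q = 1) (hs : c ≤ q ^ 2 * s) :
    0 < q * wallForm (skew p q z) (herm (a + s) c b) := by
  have hq : q ≠ 0 := by
    rintro rfl
    simp at hs
    linarith
  have hq2 : 0 < q ^ 2 := by positivity
  rw [wallForm_skew]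
  rw [Complex.normSq_apply] at hb hn
  have e : c * (q * ((a + s) * q + c * p + 2 * (b.im * z.re - b.re * z.im))) =
      q ^ 2 * (a * c - (b.re * b.re + b.im * b.im)) + c * (q ^ 2 * s - c) +
      ((q * b.re - c * z.im) ^ 2 + (q * b.im + c * z.re) ^ 2) := by
    linear_combination (-c ^ 2) * hn
  have h1 : 0 < q ^ 2 * (a * c - (b.re * b.re + b.im * b.im)) := mul_pos hq2 (by linarith)
  have h2 : 0 ≤ c * (q ^ 2 * s - c) := mul_nonneg hc.le (by linarith)
  have h3 : 0 < c * (q * ((a + s) * q + c * p + 2 * (b.im * z.re - b.re * z.im))) := by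
    rw [e]; positivity
  exact pos_of_mul_pos_right h3 hc.le

/-- The modular plane, as a wall. -/
def wallJ (d : ℕ) : Wall d := ⟨matJ, 1, wallMat_one.symm⟩

theorem wallForm_matJ (a c : ℝ) (b : ℂ) : wallForm matJ (herm a c b) = 2 * b.im := by
  rw [matJ_eq_skew, wallForm_skew]; simp

/-- The points b + j and j have height 1, above every hemispherical wall, since those have radius at
most 1/(2δ) < 1. A vertical wall has form 2δP + 2 Im b, whose sign is that of P as soon as |2 Im b|
≤ δ and P ≠ 0. So no wall but the modular plane comes between b + j and j. -/
theorem wallForm_mul_pos_of_ne {d : ℕ} (hd : Admissible d) {b : ℂ} (hb : |2 * b.im| ≤ delta d)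
    {v : Wall d} (hv : v ≠ wallJ d) :
    0 < wallForm v.1 (herm (Complex.normSq b + 1) 1 b) * wallForm v.1 (herm 1 1 0) := by
  obtain ⟨g, hg⟩ := v.2
  obtain ⟨P, Q, z, hD, he⟩ := exists_wallData hd g
  have hδ := hd.delta_pos
  have h7 := hd.delta_sq
  rw [hg, he]
  by_cases hQ : Q = 0
  · have hn := hD.norm
    have hz : z = 1 := hD.eq_one_of_normSq hd (by rw [hQ] at hn; simpa using hn)
    have hP : P ≠ 0 := by
      rintro rfl
      apply hv
      apply Subtype.ext
      rw [hg, he, hQ, hz]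
      simp [wallJ, matJ_eq_skew]
    rw [hQ, hz, wallForm_skew, wallForm_skew]
    simp only [Int.cast_zero, mul_zero, one_mul, zero_add, Complex.one_re, mul_one, Complex.one_im,
      sub_zero, Complex.zero_im, Complex.zero_re, add_zero]
    have hP1 : (1 : ℝ) ≤ |(P : ℝ)| := by exact_mod_cast Int.one_le_abs hP
    obtain ⟨h1, h2⟩ := abs_le.1 hb
    rcases le_or_gt 0 (P : ℝ) with h | h
    · rw [abs_of_nonneg h] at hP1
      exact mul_pos (by nlinarith) (by positivity)
    · rw [abs_of_neg h] at hP1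
      exact mul_pos_of_neg_of_neg (by nlinarith) (by nlinarith)
  · have hQ1 : (1 : ℝ) ≤ (Q : ℝ) ^ 2 := by
      have : 1 ≤ Q ^ 2 := by
        have := Int.one_le_abs hQ
        nlinarith [sq_abs Q]
      exact_mod_cast this
    have hs : (1 : ℝ) ≤ (2 * delta d * Q) ^ 2 * (1 / 2) := by
      have : (2 * delta d * Q) ^ 2 * (1 / 2) = 2 * delta d ^ 2 * (Q : ℝ) ^ 2 := by ring
      rw [this]; nlinarith
    -- The 1 in the corner is split: one half keeps the matrix positive definite, the other half is
    -- the amount s by which the point is raised.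
    have h1 := wallForm_high (a := Complex.normSq b + 1 / 2) (c := 1) (b := b) one_pos (by linarith)
      hD.norm hs
    have h2 := wallForm_high (a := 1 / 2) (c := 1) (b := 0) one_pos (by simp) hD.norm hs
    rw [show Complex.normSq b + 1 / 2 + 1 / 2 = Complex.normSq b + 1 by ring] at h1
    rw [show (1 : ℝ) / 2 + 1 / 2 = 1 by norm_num] at h2
    have h3 := mul_pos h1 h2
    have h4 : 0 < (2 * delta d * (Q : ℝ)) ^ 2 := by nlinarith
    refine pos_of_mul_pos_right (a := (2 * delta d * (Q : ℝ)) ^ 2) ?_ h4.le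
    convert h3 using 1
    ring

theorem posDef_herm_one (b : ℂ) : (herm (Complex.normSq b + 1) 1 b).PosDef :=
  posDef_iff.2 ⟨_, _, _, rfl, by have := Complex.normSq_nonneg b; linarith, one_pos, by linarith⟩

theorem posDef_herm_zero : (herm 1 1 0).PosDef :=
  posDef_iff.2 ⟨_, _, _, rfl, one_pos, one_pos, by simp⟩

theorem isAdjacent_wallJ {d : ℕ} (hd : Admissible d) {b : ℂ} (hb : |2 * b.im| ≤ delta d) :
    (bianchiWalls hd).IsAdjacent (herm (Complex.normSq b + 1) 1 b) (wallJ d) := by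
  refine WallSpace.isAdjacent_of_exists (p := herm 1 1 0) posDef_herm_zero ?_ fun v hv =>
    wallForm_mul_pos_of_ne hd hb hv
  change wallForm matJ _ = 0
  rw [wallForm_matJ]; simp

theorem isRegular_herm {d : ℕ} (hd : Admissible d) {b : ℂ} (hb : |2 * b.im| ≤ delta d)
    (hb0 : b.im ≠ 0) : (bianchiWalls hd).IsRegular (herm (Complex.normSq b + 1) 1 b) := by
  refine ⟨posDef_herm_one b, fun v => ?_⟩
  change wallForm v.1 _ ≠ 0
  by_cases hv : v = wallJ d
  · rw [hv]
    change wallForm matJ _ ≠ 0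
    rw [wallForm_matJ]; simpa using hb0
  · intro h0
    have := wallForm_mul_pos_of_ne hd hb hv
    rw [h0] at this
    simp at this

theorem basePoint_eq (d : ℕ) :
    basePoint d = herm (Complex.normSq (-tau d / 2) + 1) 1 (-tau d / 2) := by
  ext i j
  fin_cases i <;> fin_cases j
  · simp [basePoint, herm]; norm_num
  · simp [basePoint, herm]
  · simp [basePoint, herm]
    rw [map_ofNat]
  · simp [basePoint, herm]

theorem im_half_tau {d : ℕ} : (-tau d / 2).im = -delta d / 2 ∧ (tau d / 2).im = delta d / 2 := by
  constructor <;> simp [delta]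

theorem isRegular_base {d : ℕ} (hd : Admissible d) :
    (bianchiWalls hd).IsRegular (basePoint d) := by
  have hδ := hd.delta_pos
  rw [basePoint_eq]
  refine isRegular_herm hd ?_ ?_ <;> rw [im_half_tau.1]
  · rw [abs_le]; constructor <;> linarith
  · intro h; linarith

theorem isRegular_actM {d : ℕ} {hd : Admissible d} {X : Matrix (Fin 2) (Fin 2) ℂ}
    (h : (bianchiWalls hd).IsRegular X) (g : SL(2, ringO d)) :
    (bianchiWalls hd).IsRegular (actM g X) :=
  (bianchiAction hd).isRegular_act h

theorem isAdjacent_base {d : ℕ} (hd : Admissible d) :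
    (bianchiWalls hd).IsAdjacent (basePoint d) (wallJ d) := by
  have hδ := hd.delta_pos
  rw [basePoint_eq]
  refine isAdjacent_wallJ hd ?_
  rw [im_half_tau.1, abs_le]; constructor <;> linarith

theorem not_pos_base {d : ℕ} (hd : Admissible d) :
    ¬ (bianchiWalls hd).Pos (wallJ d) (basePoint d) := by
  have hδ := hd.delta_pos
  rw [basePoint_eq]
  change ¬ 0 < wallForm matJ _
  rw [wallForm_matJ, im_half_tau.1]
  linarith

/-- Upper unipotent matrices over `𝒪_d`. -/
def upperO {d : ℕ} (x : ringO d) : SL(2, ringO d) := ⟨!![1, x; 0, 1], by simp [Matrix.det_fin_two]⟩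

/-- The Weyl element over `𝒪_d`. -/
def weylO (d : ℕ) : SL(2, ringO d) := ⟨!![0, -1; 1, 0], by simp [Matrix.det_fin_two]⟩

theorem uElt_eq (d : ℕ) : uElt d = toBi d (upperO (tauO d)) := rfl
theorem tElt_eq (d : ℕ) : tElt d = toBi d (upperO 1) := rfl
theorem aElt_eq (d : ℕ) : aElt d = toBi d (weylO d) := rfl

theorem toSLC_upperO {d : ℕ} (x : ringO d) : (toSLC d (upperO x)).val = !![1, (x : ℂ); 0, 1] := by
  rw [toSLC_val]; simp [upperO]

theorem toSLC_weylO (d : ℕ) : (toSLC d (weylO d)).val = !![0, -1; 1, 0] := by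
  rw [toSLC_val]; simp [weylO]

theorem act_upperO_base (d : ℕ) :
    actM (upperO (tauO d)) (basePoint d) =
      herm (Complex.normSq (tau d / 2) + 1) 1 (tau d / 2) := by
  have ht : ((tauO d : ringO d) : ℂ) = tau d := rfl
  rw [actM, toSLC_upperO, basePoint_eq, ht]
  have h2 : (starRingEnd ℂ) (tau d) * tau d = Complex.normSq (tau d) := by
    rw [mul_comm, Complex.mul_conj]
  ext i j
  fin_cases i <;> fin_cases j
  · simp [herm, Matrix.mul_apply, Fin.sum_univ_two]
    rw [map_ofNat, ← h2]; ring
  · simp [herm, Matrix.mul_apply, Fin.sum_univ_two]; ring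
  · simp [herm, Matrix.mul_apply, Fin.sum_univ_two]; rw [map_ofNat]; ring
  · simp [herm, Matrix.mul_apply, Fin.sum_univ_two]

theorem isAdjacent_act_u_base {d : ℕ} (hd : Admissible d) :
    (bianchiWalls hd).IsAdjacent (actM (upperO (tauO d)) (basePoint d)) (wallJ d) := by
  have hδ := hd.delta_pos
  rw [act_upperO_base]
  refine isAdjacent_wallJ hd ?_
  rw [im_half_tau.2, abs_le]; constructor <;> linarith

theorem pos_act_u_base {d : ℕ} (hd : Admissible d) :
    (bianchiWalls hd).Pos (wallJ d) (actM (upperO (tauO d)) (basePoint d)) := by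
  have hδ := hd.delta_pos
  rw [act_upperO_base]
  change 0 < wallForm matJ _
  rw [wallForm_matJ, im_half_tau.2]
  linarith

theorem mem_cone {d : ℕ} {hd : Admissible d} {X : Matrix (Fin 2) (Fin 2) ℂ} (h : X.PosDef) :
    X ∈ (bianchiWalls hd).cone := h

theorem wallForm_one_wallJ {d : ℕ} {hd : Admissible d} :
    (bianchiWalls hd).form (wallJ d) (herm 1 1 0) = 0 := by
  change wallForm matJ _ = 0
  rw [wallForm_matJ]; simp

/-- The points -τ/2 + j and τ/2 + j are both adjacent to the modular plane, on opposite sides of it.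
-/
theorem sep_base_u {d : ℕ} (hd : Admissible d) :
    (bianchiWalls hd).sep (basePoint d) (actM (upperO (tauO d)) (basePoint d)) = {wallJ d} := by
  have hr := isRegular_base hd
  have hr' := isRegular_actM hr (upperO (tauO d))
  ext v
  rw [WallSpace.mem_sep hr hr', Finset.mem_singleton]
  by_cases hv : v = wallJ d
  · simp only [hv, iff_true]
    intro h
    exact not_pos_base hd (h.2 (pos_act_u_base hd))
  · simp only [hv, iff_false, not_not]
    have h1 := isAdjacent_base hd v hv _ (mem_cone posDef_herm_zero) wallForm_one_wallJ
    have h2 := isAdjacent_act_u_base hd v hv _ (mem_cone posDef_herm_zero) wallForm_one_wallJ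
    change 0 < _ ↔ 0 < _
    rcases mul_pos_iff.1 h1 with h1 | h1 <;> rcases mul_pos_iff.1 h2 with h2 | h2
    · exact iff_of_true h1.1 h2.1
    · linarith [h1.2, h2.2]
    · linarith [h1.2, h2.2]
    · exact iff_of_false h1.1.not_gt h2.1.not_gt

/-- The elements that map the chamber of the base point to itself. -/
def chamberStab {d : ℕ} (hd : Admissible d) : Set SL(2, ringO d) :=
  {g | (bianchiWalls hd).sep (basePoint d) (actM g (basePoint d)) = ∅}

/-- Fixing the normal vector, and not only its line, means fixing the wall together with its sides.
The chamber on a given side is then preserved. -/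
theorem mem_chamberStab_of_fix {d : ℕ} (hd : Admissible d) {g : SL(2, ringO d)} {w : Wall d}
    (hw : (bianchiWalls hd).IsAdjacent (basePoint d) w) {q : Matrix (Fin 2) (Fin 2) ℂ}
    (hq : q.PosDef) (hwq : wallForm w.1 q = 0) (hg : actM g w.1 = w.1) : g ∈ chamberStab hd := by
  have hr := isRegular_base hd
  have hr' := isRegular_actM hr g
  have hgw : (bianchiAction hd).wact g w = w := Subtype.ext hg
  have h2 := (bianchiAction hd).isAdjacent_act (g := g) hw
  rw [hgw] at h2
  refine WallSpace.sep_eq_empty_of_isAdjacent hr hr' hw h2 (mem_cone hq) hwq ?_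
  have := (bianchiAction hd).pos_act g w (basePoint d)
  rw [hgw] at this
  exact this.symm

theorem mem_chamberStab_of_fix_J {d : ℕ} (hd : Admissible d) {g : SL(2, ringO d)}
    (hg : actM g matJ = matJ) : g ∈ chamberStab hd :=
  mem_chamberStab_of_fix hd (isAdjacent_base hd) posDef_herm_zero
    (wallForm_one_wallJ (hd := hd)) hg

/-- The base chamber is also adjacent to the neighbouring wall u⁻¹P, whose oriented stabilizer is
the conjugate by u⁻¹ of that of P. -/
theorem conj_mem_chamberStab {d : ℕ} (hd : Admissible d) {g : SL(2, ringO d)}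
    (hg : actM g matJ = matJ) : (upperO (tauO d))⁻¹ * g * upperO (tauO d) ∈ chamberStab hd := by
  set u : SL(2, ringO d) := upperO (tauO d)
  have h1 := (bianchiAction hd).isAdjacent_act (g := u⁻¹) (isAdjacent_act_u_base hd)
  have e : (bianchiAction hd).act u⁻¹ (actM u (basePoint d)) = basePoint d :=
    (bianchiAction hd).act_inv_act u (basePoint d)
  rw [e] at h1
  refine mem_chamberStab_of_fix hd h1 (q := actM u⁻¹ (herm 1 1 0)) (posDef_actM posDef_herm_zero)
    ?_ ?_
  · change wallForm (actM u⁻¹ matJ) _ = 0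
    rw [wallForm_actM]
    exact wallForm_one_wallJ (hd := hd)
  · change actM (u⁻¹ * g * u) (actM u⁻¹ matJ) = actM u⁻¹ matJ
    rw [← actM_mul, mul_assoc, mul_assoc, mul_inv_cancel, mul_one, actM_mul, hg]

/-- Every chamber is a translate of the base chamber by an element of the group generated by the
stabilizer of the chamber and `u`. -/
theorem exists_mem_closure_sep {d : ℕ} (hd : Admissible d) {y : Matrix (Fin 2) (Fin 2) ℂ}
    (hy : (bianchiWalls hd).IsRegular y) :
    ∃ h ∈ Subgroup.closure (chamberStab hd ∪ {upperO (tauO d)}),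
      (bianchiWalls hd).sep (actM h (basePoint d)) y = ∅ := by
  exact (bianchiAction hd).exists_mem_closure_sep (isRegular_base hd) (isAdjacent_base hd)
    (isAdjacent_act_u_base hd) (not_pos_base hd) (pos_act_u_base hd) (mem_cone posDef_herm_zero)
    wallForm_one_wallJ (fun w => by
      obtain ⟨g, hg⟩ := w.2
      exact ⟨g, Subtype.ext (by rw [hg]; rfl)⟩) hy

theorem mem_chamberStab_iff {d : ℕ} (hd : Admissible d) {g h : SL(2, ringO d)} :
    g⁻¹ * h ∈ chamberStab hd ↔
      (bianchiWalls hd).sep (actM g (basePoint d)) (actM h (basePoint d)) = ∅ := by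
  have hr := isRegular_base hd
  have := (bianchiAction hd).sep_act_eq_empty (g := g) hr
    (isRegular_actM hr (g⁻¹ * h))
  have e : (bianchiAction hd).act g (actM (g⁻¹ * h) (basePoint d)) = actM h (basePoint d) :=
    (actM_mul g (g⁻¹ * h) _).symm.trans (by rw [mul_inv_cancel_left])
  rw [e] at this
  exact this.symm

theorem closure_chamberStab {d : ℕ} (hd : Admissible d) :
    Subgroup.closure (chamberStab hd ∪ {upperO (tauO d)}) = ⊤ := by
  rw [eq_top_iff]
  intro g _
  have hr := isRegular_actM (isRegular_base hd) g
  obtain ⟨h, hh, hs⟩ := exists_mem_closure_sep hd hr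
  have := (mem_chamberStab_iff hd).2 hs
  have := Subgroup.mul_mem _ hh (Subgroup.subset_closure (Or.inl this))
  rwa [mul_inv_cancel_left] at this

/-! ### Identification of the cut group -/

theorem mem_HR3_actM {d : ℕ} {g : SL(2, ringO d)} {X : Matrix (Fin 2) (Fin 2) ℂ} (hX : X ∈ HR3) :
    actM g X ∈ HR3 := by
  refine ⟨posDef_actM hX.1, ?_⟩
  simp [actM, Matrix.det_mul, hX.2, Matrix.det_conjTranspose]

theorem mem_walls_iff {d : ℕ} {X : Matrix (Fin 2) (Fin 2) ℂ} (hX : X ∈ HR3) :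
    X ∈ walls d ↔ ∃ v : Wall d, wallForm v.1 X = 0 := by
  simp only [walls, Set.mem_iUnion, Set.mem_image]
  constructor
  · rintro ⟨g, Y, ⟨hY, him⟩, rfl⟩
    refine ⟨⟨wallMat g, g, rfl⟩, ?_⟩
    obtain ⟨a, c, b, rfl, -⟩ := posDef_iff.1 hY.1
    change wallForm (actM g matJ) (actM g _) = 0
    rw [wallForm_actM, wallForm_matJ]
    have : b.im = 0 := him 0 1
    rw [this, mul_zero]
  · rintro ⟨⟨_, g, rfl⟩, hv⟩
    have hY : actM g⁻¹ X ∈ HR3 := mem_HR3_actM hX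
    refine ⟨g, actM g⁻¹ X, ⟨hY, ?_⟩, ?_⟩
    · obtain ⟨a, c, b, he, -⟩ := posDef_iff.1 hY.1
      have h1 : wallForm matJ (actM g⁻¹ X) = 0 := by
        rw [← wallForm_actM g, ← actM_mul, mul_inv_cancel, actM_one]
        exact hv
      rw [he, wallForm_matJ] at h1
      have hb : b.im = 0 := by linarith
      intro i j
      rw [he]
      fin_cases i <;> fin_cases j <;> simp [herm, hb]
    · rw [hermAct_apply, ← actM_mul, mul_inv_cancel, actM_one]

theorem continuous_wallForm (v : Matrix (Fin 2) (Fin 2) ℂ) : Continuous (wallForm v) :=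
  LinearMap.continuous_of_finiteDimensional _

theorem basePoint_mem_HR3 (d : ℕ) : basePoint d ∈ HR3 := by
  rw [basePoint_eq]
  refine ⟨posDef_herm_one _, ?_⟩
  rw [herm, Matrix.det_fin_two_of, Complex.mul_conj]
  push_cast; ring

/-- On the component no form vanishes, so each keeps its sign. Conversely, the points with the
prescribed signs form a convex cone, and rescaling to determinant one maps it continuously onto the
right-hand side, which is therefore connected. -/
theorem piece_eq {d : ℕ} (hd : Admissible d) :
    piece d = {X | X ∈ HR3 ∧ ∀ v : Wall d, 0 < wallForm v.1 X * wallForm v.1 (basePoint d)} := by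
  have hr := isRegular_base hd
  have hbw : basePoint d ∈ HR3 \ walls d := by
    refine ⟨basePoint_mem_HR3 d, ?_⟩
    rw [mem_walls_iff (basePoint_mem_HR3 d)]
    rintro ⟨v, hv⟩
    exact hr.2 v hv
  apply Set.Subset.antisymm
  · intro X hX
    have hsub := connectedComponentIn_subset (HR3 \ walls d) (basePoint d)
    refine ⟨(hsub hX).1, fun v => ?_⟩
    have hpre : IsPreconnected (piece d) := isPreconnected_connectedComponentIn
    have hb : basePoint d ∈ piece d := mem_connectedComponentIn hbw
    by_contra hneg
    obtain ⟨Y, hY, hY0⟩ : ∃ Y ∈ piece d, wallForm v.1 Y = 0 := by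
      have hc := (continuous_wallForm v.1).continuousOn (s := piece d)
      rcases le_total 0 (wallForm v.1 (basePoint d)) with h | h
      · have h' : wallForm v.1 X ≤ 0 := by
          by_contra h2
          have : 0 < wallForm v.1 (basePoint d) := lt_of_le_of_ne h (Ne.symm (hr.2 v))
          exact hneg (mul_pos (not_le.1 h2) this)
        exact hpre.intermediate_value hX hb hc ⟨h', h⟩
      · have h' : 0 ≤ wallForm v.1 X := by
          by_contra h2
          have : wallForm v.1 (basePoint d) < 0 := lt_of_le_of_ne h (hr.2 v)
          exact hneg (mul_pos_of_neg_of_neg (not_le.1 h2) this)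
        exact hpre.intermediate_value hb hX hc ⟨h, h'⟩
    exact (hsub hY).2 ((mem_walls_iff (hsub hY).1).2 ⟨v, hY0⟩)
  · set S : Set (Matrix (Fin 2) (Fin 2) ℂ) :=
      {X | X ∈ HR3 ∧ ∀ v : Wall d, 0 < wallForm v.1 X * wallForm v.1 (basePoint d)} with hS
    set K : Set (Matrix (Fin 2) (Fin 2) ℂ) :=
      {X | X.PosDef ∧ ∀ v : Wall d, 0 < wallForm v.1 X * wallForm v.1 (basePoint d)} with hK
    have hKc : Convex ℝ K := by
      rw [convex_iff_forall_pos]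
      intro X hX Y hY a b ha hb _
      refine ⟨(hX.1.smul ha).add (hY.1.smul hb), fun v => ?_⟩
      have h1 := hX.2 v
      have h2 := hY.2 v
      simp only [map_add, map_smul, smul_eq_mul]
      have := mul_pos ha h1
      have := mul_pos hb h2
      nlinarith
    set φ : Matrix (Fin 2) (Fin 2) ℂ → Matrix (Fin 2) (Fin 2) ℂ :=
      fun X => (Real.sqrt X.det.re)⁻¹ • X with hφ
    have hdet : ∀ X ∈ K, 0 < X.det.re ∧ X.det = (X.det.re : ℂ) := by
      intro X hX
      have h := hX.1.det_pos
      rw [Complex.lt_def] at h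
      exact ⟨h.1, by apply Complex.ext <;> simp [← h.2]⟩
    have hφc : ContinuousOn φ K := by
      have hdc : Continuous fun X : Matrix (Fin 2) (Fin 2) ℂ => X.det := continuous_id.matrix_det
      have hsc : Continuous fun X : Matrix (Fin 2) (Fin 2) ℂ => Real.sqrt X.det.re :=
        Real.continuous_sqrt.comp (Complex.continuous_re.comp hdc)
      have hinv : ContinuousOn (fun X : Matrix (Fin 2) (Fin 2) ℂ => (Real.sqrt X.det.re)⁻¹) K :=
        hsc.continuousOn.inv₀ fun X hX => (Real.sqrt_pos.2 (hdet X hX).1).ne'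
      have hid : ContinuousOn (fun X : Matrix (Fin 2) (Fin 2) ℂ => X) K := continuousOn_id
      exact hinv.smul hid
    have himg : φ '' K = S := by
      apply Set.Subset.antisymm
      · rintro _ ⟨X, hX, rfl⟩
        obtain ⟨h0, h1⟩ := hdet X hX
        have hs := Real.sqrt_pos.2 h0
        refine ⟨⟨hX.1.smul (inv_pos.2 hs), ?_⟩, fun v => ?_⟩
        · simp only [hφ]
          rw [Matrix.det_smul_of_tower, Fintype.card_fin, h1, inv_pow, Complex.ofReal_re,
            Real.sq_sqrt h0.le, Complex.real_smul, ← Complex.ofReal_mul,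
            inv_mul_cancel₀ h0.ne', Complex.ofReal_one]
        · simp only [hφ, map_smul, smul_eq_mul]
          have := hX.2 v
          have := inv_pos.2 hs
          rw [mul_assoc]
          positivity
      · rintro X ⟨hX, hv⟩
        exact ⟨X, ⟨hX.1, hv⟩, by simp [hφ, hX.2]⟩
    have hpre : IsPreconnected S := by
      rw [← himg]
      exact hKc.isPreconnected.image φ hφc
    refine hpre.subset_connectedComponentIn ⟨basePoint_mem_HR3 d, fun v => ?_⟩ ?_
    · exact mul_self_pos.2 (hr.2 v)
    · rintro X ⟨hX, hv⟩
      refine ⟨hX, ?_⟩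
      rw [mem_walls_iff hX]
      rintro ⟨v, h0⟩
      have := hv v
      rw [h0] at this
      simp at this

theorem isRegular_of_mem_piece {d : ℕ} (hd : Admissible d) {X : Matrix (Fin 2) (Fin 2) ℂ}
    (hX : X ∈ piece d) : (bianchiWalls hd).IsRegular X := by
  rw [piece_eq hd] at hX
  refine ⟨hX.1.1, fun v h0 => ?_⟩
  have h := hX.2 v
  have h0 : wallForm v.1 X = 0 := h0
  rw [h0] at h
  simp at h

theorem mem_piece_iff {d : ℕ} (hd : Admissible d) {X : Matrix (Fin 2) (Fin 2) ℂ} (hX : X ∈ HR3)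
    (hr : (bianchiWalls hd).IsRegular X) :
    X ∈ piece d ↔ (bianchiWalls hd).sep (basePoint d) X = ∅ := by
  have hb := isRegular_base hd
  rw [piece_eq hd, WallSpace.sep_eq_empty hb hr]
  constructor
  · rintro ⟨-, h⟩ v
    have h : 0 < (bianchiWalls hd).form v X * (bianchiWalls hd).form v (basePoint d) := h v
    unfold WallSpace.Pos
    rcases mul_pos_iff.1 h with h | h
    · exact iff_of_true h.2 h.1
    · exact iff_of_false h.2.not_gt h.1.not_gt
  · intro h
    exact ⟨hX, fun v => WallSpace.form_mul_pos hr hb (h v).symm⟩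

/-- An element permutes the chambers, so it preserves the component as soon as it keeps the base
point in its chamber. -/
theorem mem_pieceStabSL_iff {d : ℕ} (hd : Admissible d) {g : SL(2, ringO d)} :
    g ∈ pieceStabSL d ↔ g ∈ chamberStab hd := by
  have hb := isRegular_base hd
  have hbp : basePoint d ∈ piece d := by
    rw [mem_piece_iff hd (basePoint_mem_HR3 d) hb, WallSpace.sep_eq_empty hb hb]
    simp
  have key : ∀ g : SL(2, ringO d), g ∈ chamberStab hd → ∀ X ∈ piece d, actM g X ∈ piece d := by
    intro g hg X hX
    have hX1 : X ∈ HR3 := by rw [piece_eq hd] at hX; exact hX.1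
    have hXr := isRegular_of_mem_piece hd hX
    rw [mem_piece_iff hd hX1 hXr] at hX
    have h1 := ((bianchiAction hd).sep_act_eq_empty (g := g) hb hXr).2 hX
    rw [mem_piece_iff hd (mem_HR3_actM hX1) (isRegular_actM hXr g),
      WallSpace.sep_eq_empty hb (isRegular_actM hXr g)]
    have h2 := (WallSpace.sep_eq_empty hb (isRegular_actM hb g)).1 hg
    have h3 := (WallSpace.sep_eq_empty (isRegular_actM hb g) (isRegular_actM hXr g)).1 h1
    exact fun v => (h2 v).trans (h3 v)
  constructor
  · intro hg
    have hg : hermAct (toSLC d g) '' piece d = piece d := hg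
    have : actM g (basePoint d) ∈ piece d := by
      rw [← hg]; exact ⟨_, hbp, rfl⟩
    rwa [mem_piece_iff hd (mem_HR3_actM (basePoint_mem_HR3 d)) (isRegular_actM hb g)] at this
  · intro hg
    have hg' : g⁻¹ ∈ chamberStab hd := by
      have := (mem_chamberStab_iff hd (g := g) (h := 1)).2
      rw [mul_one] at this
      apply this
      rw [actM_one, WallSpace.sep_eq_empty (isRegular_actM hb g) hb]
      have h2 := (WallSpace.sep_eq_empty hb (isRegular_actM hb g)).1 hg
      exact fun v => (h2 v).symm
    change hermAct (toSLC d g) '' piece d = piece d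
    apply Set.Subset.antisymm
    · rintro _ ⟨X, hX, rfl⟩
      exact key g hg X hX
    · intro X hX
      refine ⟨actM g⁻¹ X, key _ hg' X hX, ?_⟩
      rw [hermAct_apply, ← actM_mul, mul_inv_cancel, actM_one]

theorem toBi_surjective (d : ℕ) : Function.Surjective (toBi d) := QuotientGroup.mk'_surjective _

theorem mem_cutGroup {d : ℕ} (hd : Admissible d) {g : SL(2, ringO d)} (hg : g ∈ chamberStab hd) :
    toBi d g ∈ cutGroup d :=
  Subgroup.mem_map_of_mem _ ((mem_pieceStabSL_iff hd).2 hg)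

/-- The Bianchi group is generated by the cut group and `u`. -/
theorem closure_cutGroup {d : ℕ} (hd : Admissible d) :
    Subgroup.closure ((cutGroup d : Set (Bi d)) ∪ {uElt d}) = ⊤ := by
  rw [eq_top_iff, ← MonoidHom.range_eq_top.2 (toBi_surjective d), MonoidHom.range_eq_map,
    ← closure_chamberStab hd, MonoidHom.map_closure]
  apply Subgroup.closure_mono
  rintro _ ⟨g, hg | hg, rfl⟩
  · exact Or.inl (mem_cutGroup hd hg)
  · rw [hg]; exact Or.inr rfl

theorem chamberStab_of_mem_cutGroup {d : ℕ} (hd : Admissible d) {γ : Bi d} (hγ : γ ∈ cutGroup d) :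
    ∃ g ∈ chamberStab hd, toBi d g = γ := by
  obtain ⟨g, hg, rfl⟩ := hγ
  exact ⟨g, (mem_pieceStabSL_iff hd).1 hg, rfl⟩

/-! ### Explicit values of the spin homomorphism -/

theorem U31_ext {g h : U31} (H : toMat g = toMat h) : g = h := Subtype.ext (Units.ext H)

@[simp] theorem toMat_one : toMat 1 = 1 := rfl
@[simp] theorem toMat_mul (g h : U31) : toMat (g * h) = toMat g * toMat h := rfl

theorem toMat_mul_inv (g : U31) : toMat g * toMat g⁻¹ = 1 := by
  rw [← toMat_mul, mul_inv_cancel, toMat_one]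

theorem toMat_inv_mul (g : U31) : toMat g⁻¹ * toMat g = 1 := by
  rw [← toMat_mul, inv_mul_cancel, toMat_one]

theorem toMat_mem (g : U31) : (toMat g).conjTranspose * siegelJ * toMat g = siegelJ := g.2

theorem siegelJ_mul_self : siegelJ * siegelJ = 1 := by
  ext i j
  fin_cases i <;> fin_cases j <;> simp [siegelJ, Matrix.mul_apply, Fin.sum_univ_four]

/-- A matrix that preserves the Siegel form, as an element of `U(3,1)`. -/
def mkU31 (M : Matrix (Fin 4) (Fin 4) ℂ) (h : M.conjTranspose * siegelJ * M = siegelJ) : U31 :=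
  ⟨⟨M, siegelJ * M.conjTranspose * siegelJ, by
      apply mul_eq_one_comm.1
      rw [Matrix.mul_assoc, Matrix.mul_assoc, ← Matrix.mul_assoc _ siegelJ M, h,
        siegelJ_mul_self], by
      rw [Matrix.mul_assoc, Matrix.mul_assoc, ← Matrix.mul_assoc _ siegelJ M, h,
        siegelJ_mul_self]⟩, h⟩

theorem toMat_inv (g : U31) : toMat g⁻¹ = siegelJ * (toMat g).conjTranspose * siegelJ := by
  have h : siegelJ * (toMat g).conjTranspose * siegelJ * toMat g = 1 := by
    rw [Matrix.mul_assoc, Matrix.mul_assoc, ← Matrix.mul_assoc _ siegelJ, toMat_mem,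
      siegelJ_mul_self]
  calc toMat g⁻¹ = siegelJ * (toMat g).conjTranspose * siegelJ * toMat g * toMat g⁻¹ := by
        rw [h, Matrix.one_mul]
    _ = _ := by rw [Matrix.mul_assoc, toMat_mul_inv, Matrix.mul_one]

theorem hermCoord_spinU (g : SL(2, ℂ)) (v : Fin 4 → ℂ) :
    hermCoord ((toMat (spinU g)).mulVec v) = g.val * hermCoord v * g.val.conjTranspose :=
  spinGL_mulVec g v

theorem toMat_spinU_eq {g : SL(2, ℂ)} {M : Matrix (Fin 4) (Fin 4) ℂ}
    (h : ∀ v, hermCoord (M.mulVec v) = g.val * hermCoord v * g.val.conjTranspose) :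
    toMat (spinU g) = M := by
  apply Matrix.toLin'.injective
  apply LinearMap.ext
  intro v
  apply hermCoord.injective
  rw [Matrix.toLin'_apply, Matrix.toLin'_apply, hermCoord_spinU, h]

theorem hermCoord_apply (v : Fin 4 → ℂ) :
    hermCoord v = !![v 0, (-v 1 + Complex.I * v 2) / (Real.sqrt 2 : ℂ);
    (-v 1 - Complex.I * v 2) / (Real.sqrt 2 : ℂ), -v 3] := rfl

theorem sqrtTwo_sq : (Real.sqrt 2 : ℂ) ^ 2 = 2 := by
  rw [← Complex.ofReal_pow, Real.sq_sqrt (by norm_num)]; norm_num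

theorem sqrtTwo_ne : (Real.sqrt 2 : ℂ) ≠ 0 := fun h => by
  have := sqrtTwo_sq; simp [h] at this

/-- Upper unipotent matrices. -/
def upperC (z : ℂ) : SL(2, ℂ) := ⟨!![1, z; 0, 1], by simp [Matrix.det_fin_two]⟩

/-- The Weyl element. -/
def weylC : SL(2, ℂ) := ⟨!![0, -1; 1, 0], by simp [Matrix.det_fin_two]⟩

theorem toSLC_upperO' {d : ℕ} (x : ringO d) : toSLC d (upperO x) = upperC x :=
  Subtype.ext (toSLC_upperO x)

theorem toSLC_weylO' (d : ℕ) : toSLC d (weylO d) = weylC := Subtype.ext (toSLC_weylO d)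

/-- The real horizontal Heisenberg translations. -/
def transMat (x y : ℝ) : Matrix (Fin 4) (Fin 4) ℂ :=
  !![1, -(Real.sqrt 2 * x : ℂ), (Real.sqrt 2 * y : ℂ), -((x : ℂ) ^ 2 + (y : ℂ) ^ 2);
    0, 1, 0, (Real.sqrt 2 * x : ℂ);
    0, 0, 1, -(Real.sqrt 2 * y : ℂ);
    0, 0, 0, 1]

theorem toMat_spinU_upperC (z : ℂ) : toMat (spinU (upperC z)) = transMat z.re z.im := by
  apply toMat_spinU_eq
  intro v
  have h2 := sqrtTwo_sq
  have h0 := sqrtTwo_ne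
  have hz : z = z.re + z.im * Complex.I := (Complex.re_add_im z).symm
  have hz' : (starRingEnd ℂ) z = z.re - z.im * Complex.I := by
    apply Complex.ext <;> simp
  rw [hermCoord_apply, hermCoord_apply]
  have hU : (upperC z).val = !![1, z; 0, 1] := rfl
  have hU' : (upperC z).val.conjTranspose = !![1, 0; (starRingEnd ℂ) z, 1] := by
    rw [hU]; ext i j; fin_cases i <;> fin_cases j <;> simp
  rw [hU', hU, hz']
  conv_rhs => rw [hz]
  simp only [Complex.add_re, Complex.add_im, Complex.ofReal_re, Complex.ofReal_im, Complex.mul_re,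
    Complex.mul_im, Complex.I_re, Complex.I_im, mul_zero, mul_one, sub_zero, add_zero, zero_add]
  generalize z.re = x
  generalize z.im = y
  have hI := Complex.I_sq
  ext i j
  fin_cases i <;> fin_cases j <;>
  simp [transMat, Matrix.mulVec, dotProduct, Fin.sum_univ_four]
  · field_simp
    linear_combination (-x * v 1 + y * v 2) * h2 +
      (2 * y * v 2 - (Real.sqrt 2 : ℂ) * v 3 * y ^ 2) * hI
  · field_simp
    ring
  · field_simp
    ring

theorem toMat_spinU_weylC : toMat (spinU weylC) = matA := by
  apply toMat_spinU_eq
  intro v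
  rw [hermCoord_apply, hermCoord_apply]
  have hU : weylC.val = !![0, -1; 1, 0] := rfl
  rw [hU]
  ext i j
  fin_cases i <;> fin_cases j <;>
  simp [matA, Matrix.mulVec, dotProduct, Fin.sum_univ_four, Matrix.mul_apply] <;> ring

/-- `SL(2, 𝒪_d) → U(3,1)`. -/
def spinO (d : ℕ) : SL(2, ringO d) →* U31 := spinU.comp (toSLC d)

theorem rho1_toBi (d : ℕ) (g : SL(2, ringO d)) : rho1 d (toBi d g) = spinO d g := rfl

/-- `Z₃(u)` as an element of `U(3,1)`. -/
def z3U (u : Circle) : U31 := mkU31 (matZ3 u) (by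
  have h : (starRingEnd ℂ) (u : ℂ) * u = 1 := by
    rw [mul_comm, Complex.mul_conj, Circle.normSq_coe]; simp
  ext i j
  fin_cases i <;> fin_cases j <;>
    simp [matZ3, siegelJ, Matrix.diagonal_conjTranspose, Matrix.diagonal_mul,
      Matrix.mul_diagonal, h])

@[simp] theorem toMat_z3U (u : Circle) : toMat (z3U u) = matZ3 u := rfl

/-- The third coordinate is the antisymmetric part of the matrix, so Z₃(u) multiplies that part by u
and fixes the symmetric part. -/
theorem hermCoord_matZ3 (u : ℂ) (v : Fin 4 → ℂ) :
    hermCoord ((matZ3 u).mulVec v) =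
      ((1 + u) / 2) • hermCoord v + ((1 - u) / 2) • (hermCoord v).transpose := by
  have h0 := sqrtTwo_ne
  rw [hermCoord_apply, hermCoord_apply]
  ext i j
  fin_cases i <;> fin_cases j <;> simp [matZ3, Matrix.mulVec_diagonal] <;> field_simp <;> ring

/-- For determinant one, gJgᵀ = J always holds. Comparison with gJg* = J gives g* = gᵀ, so g is real
and X ↦ gXg* commutes with transposition. -/
theorem commute_z3U {g : SL(2, ℂ)} (hg : g.val * matJ * g.val.conjTranspose = matJ) (u : Circle) :
    Commute (spinU g) (z3U u) := by
  have hdet : g.val.det = 1 := g.prop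
  have h1 : g.val * matJ * g.val.transpose = matJ := by
    rw [Matrix.det_fin_two] at hdet
    ext i j
    fin_cases i <;> fin_cases j <;>
      simp [matJ, Matrix.mul_apply, Fin.sum_univ_two]
    · ring
    · linear_combination hdet
    · linear_combination -hdet
    · ring
  have hreal : g.val.conjTranspose = g.val.transpose := by
    have hJ : matJ.det = 1 := by simp [matJ, Matrix.det_fin_two]
    have hu : IsUnit (g.val * matJ) := by
      rw [Matrix.isUnit_iff_isUnit_det, Matrix.det_mul, hdet, hJ, mul_one]; exact isUnit_one
    exact hu.mul_left_cancel (hg.trans h1.symm)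
  have hreal' : g.val.conjTranspose.transpose = g.val := by rw [hreal, Matrix.transpose_transpose]
  apply U31_ext
  rw [toMat_mul, toMat_mul]
  apply Matrix.toLin'.injective
  apply LinearMap.ext
  intro v
  apply hermCoord.injective
  simp only [Matrix.toLin'_apply, ← Matrix.mulVec_mulVec, toMat_z3U]
  rw [hermCoord_spinU, hermCoord_matZ3, hermCoord_matZ3, hermCoord_spinU, Matrix.transpose_mul,
    Matrix.transpose_mul, hreal', Matrix.mul_add, Matrix.add_mul]
  simp only [Matrix.mul_smul, Matrix.smul_mul, hreal, Matrix.mul_assoc]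

/-! ### The bending deformation -/

/-- The complex reflection in a wall. -/
def wallReflection {d : ℕ} (u : Circle) (v : Wall d) : U31 :=
  spinO d v.2.choose * z3U u * (spinO d v.2.choose)⁻¹

/-- Two elements that carry J to the same wall differ by one that fixes J, and this commutes with
Z₃(u). The choice in the definition is thus irrelevant. -/
theorem wallReflection_eq {d : ℕ} (u : Circle) {v : Wall d} {g : SL(2, ringO d)}
    (hg : v.1 = wallMat g) : wallReflection u v = spinO d g * z3U u * (spinO d g)⁻¹ := by
  set h := v.2.choose with hh
  have hv : v.1 = wallMat h := v.2.choose_spec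
  have hfix : actM (g⁻¹ * h) matJ = matJ := by
    rw [actM_mul]
    have : actM h matJ = actM g matJ := hv.symm.trans hg
    rw [this, ← actM_mul, inv_mul_cancel, actM_one]
  have hc : Commute (spinO d (g⁻¹ * h)) (z3U u) := commute_z3U hfix u
  rw [wallReflection, ← hh]
  rw [map_mul, map_inv] at hc
  have := hc.eq
  rw [eq_mul_inv_iff_mul_eq]
  have h3 : spinO d h * z3U u = spinO d g * z3U u * (spinO d g)⁻¹ * spinO d h := by
    calc spinO d h * z3U u = spinO d g * ((spinO d g)⁻¹ * spinO d h * z3U u) := by group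
      _ = _ := by rw [this]; group
  rw [h3]; group

theorem wallReflection_act {d : ℕ} (hd : Admissible d) (u : Circle) (g : SL(2, ringO d))
    (v : Wall d) : wallReflection u ((bianchiAction hd).wact g v) =
      spinO d g * wallReflection u v * (spinO d g)⁻¹ := by
  obtain ⟨h, hh⟩ := v.2
  have h1 : ((bianchiAction hd).wact g v).1 = wallMat (g * h) := by
    rw [wallMat_mul, ← hh]; rfl
  rw [wallReflection_eq u h1, wallReflection_eq u hh, map_mul]
  group

open Classical in
/-- The bending deformation, on `SL(2, 𝒪_d)`. -/
def bendSL {d : ℕ} (hd : Admissible d) (u : Circle) : SL(2, ringO d) →* U31 :=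
  (bianchiAction hd).bend (wallReflection_act hd u) (isRegular_base hd)

theorem bendSL_of_mem {d : ℕ} (hd : Admissible d) (u : Circle) {g : SL(2, ringO d)}
    (hg : g ∈ chamberStab hd) : bendSL hd u g = spinO d g := by
  classical
  exact (bianchiAction hd).bend_of_sep_empty (wallReflection_act hd u) (isRegular_base hd) hg

theorem bendSL_u {d : ℕ} (hd : Admissible d) (u : Circle) :
    bendSL hd u (upperO (tauO d)) = z3U u * spinO d (upperO (tauO d)) := by
  classical
  have h := (bianchiAction hd).bend_of_sep_singleton (wallReflection_act hd u) (isRegular_base hd)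
    (sep_base_u hd) (not_pos_base hd)
  have h1 : wallReflection u (wallJ d) = z3U u := by
    rw [wallReflection_eq u (g := 1) wallMat_one.symm]
    simp
  rw [h1] at h
  exact h

theorem actM_of_mem_center {d : ℕ} {g : SL(2, ringO d)} (hg : g ∈ Subgroup.center SL(2, ringO d))
    (X : Matrix (Fin 2) (Fin 2) ℂ) : actM g X = X := by
  have h1 : spinU (toSLC d g) = 1 := spinU_center d hg
  have h2 := hermCoord_spinU (toSLC d g) (hermCoord.symm X)
  rw [h1, toMat_one, Matrix.one_mulVec, LinearEquiv.apply_symm_apply] at h2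
  exact h2.symm

/-- The bending deformation. -/
def bendBi {d : ℕ} (hd : Admissible d) (u : Circle) : Bi d →* U31 :=
  QuotientGroup.lift _ (bendSL hd u) (by
    intro g hg
    have hb := isRegular_base hd
    rw [MonoidHom.mem_ker, bendSL_of_mem hd u]
    · exact spinU_center d hg
    · change (bianchiWalls hd).sep _ _ = ∅
      rw [actM_of_mem_center hg, WallSpace.sep_eq_empty hb hb]
      simp)

theorem bendBi_toBi {d : ℕ} (hd : Admissible d) (u : Circle) (g : SL(2, ringO d)) :
    bendBi hd u (toBi d g) = bendSL hd u g := rfl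

theorem isBending_bendBi {d : ℕ} (hd : Admissible d) (u : Circle) :
    IsBending d u (bendBi hd u) := by
  constructor
  · intro γ hγ
    obtain ⟨g, hg, rfl⟩ := chamberStab_of_mem_cutGroup hd hγ
    rw [bendBi_toBi, bendSL_of_mem hd u hg, rho1_toBi]
  · rw [uElt_eq, bendBi_toBi, bendSL_u, toMat_mul, rho1_toBi, toMat_z3U]

theorem eq_bendBi {d : ℕ} (hd : Admissible d) {u : Circle} {ρ : Bi d →* U31}
    (h : IsBending d u ρ) : ρ = bendBi hd u := by
  have h' := isBending_bendBi hd u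
  apply MonoidHom.eq_of_eqOn_dense (closure_cutGroup hd)
  rintro γ (hγ | hγ)
  · rw [h.1 γ hγ, h'.1 γ hγ]
  · rw [Set.mem_singleton_iff.1 hγ]
    exact U31_ext (h.2.trans h'.2.symm)

theorem weylO_mem {d : ℕ} (hd : Admissible d) : weylO d ∈ chamberStab hd := by
  apply mem_chamberStab_of_fix_J
  rw [actM, toSLC_weylO]
  ext i j
  fin_cases i <;> fin_cases j <;> simp [matJ, Matrix.mul_apply, Fin.sum_univ_two]

theorem upperO_int_mem {d : ℕ} (hd : Admissible d) (n : ℤ) : upperO (n : ringO d) ∈ chamberStab hd := by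
  apply mem_chamberStab_of_fix_J
  rw [actM, toSLC_upperO]
  ext i j
  fin_cases i <;> fin_cases j <;> simp [matJ, Matrix.mul_apply, Fin.sum_univ_two]

theorem transMat_one_zero : transMat 1 0 = matT := by
  simp [transMat, matT]

theorem matZ3_mul_transMat_tau (d : ℕ) (u : ℂ) :
    matZ3 u * transMat (tau d).re (tau d).im = matU d u := by
  have hs : (Real.sqrt d : ℂ) ^ 2 = d := by
    rw [← Complex.ofReal_pow, Real.sq_sqrt (Nat.cast_nonneg d)]; simp
  have hδ : (tau d).im = if d % 4 = 3 then Real.sqrt d / 2 else Real.sqrt d := delta_eq d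
  rw [tau_re, hδ, matU]
  split_ifs with h
  · ext i j
    fin_cases i <;> fin_cases j <;> simp [matZ3, transMat, Matrix.diagonal_mul] <;> try ring1
    linear_combination (-1 / 4 : ℂ) * hs
  · ext i j
    fin_cases i <;> fin_cases j <;> simp [matZ3, transMat, Matrix.diagonal_mul, hs]

/-! ### Values of a bending deformation on the generators. -/

section Values

variable {d : ℕ} (hd : Admissible d) {u : Circle} {ρ : Bi d →* U31} (h : IsBending d u ρ)
include hd h

theorem bending_toBi_of_mem {g : SL(2, ringO d)} (hg : g ∈ chamberStab hd) :
    ρ (toBi d g) = spinO d g := by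
  rw [h.1 _ (mem_cutGroup hd hg), rho1_toBi]

theorem bending_a : toMat (ρ (aElt d)) = matA := by
  rw [aElt_eq, bending_toBi_of_mem hd h (weylO_mem hd)]
  change toMat (spinU (toSLC d (weylO d))) = _
  rw [toSLC_weylO', toMat_spinU_weylC]

theorem bending_t : toMat (ρ (tElt d)) = matT := by
  have := upperO_int_mem hd 1
  rw [Int.cast_one] at this
  rw [tElt_eq, bending_toBi_of_mem hd h this]
  change toMat (spinU (toSLC d (upperO 1))) = _
  rw [toSLC_upperO', toMat_spinU_upperC, ← transMat_one_zero]
  simp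

omit hd in
theorem bending_u : toMat (ρ (uElt d)) = matU d u := by
  rw [h.2, uElt_eq, rho1_toBi]
  change matZ3 u * toMat (spinU (toSLC d (upperO (tauO d)))) = _
  rw [toSLC_upperO', toMat_spinU_upperC]
  exact matZ3_mul_transMat_tau d u

omit hd in
theorem bending_trace : (toMat (ρ (uElt d))).trace = 3 + u := by
  rw [bending_u h, matU]
  split_ifs <;> simp [Matrix.trace, Fin.sum_univ_four] <;> ring

end Values

theorem not_conjugate_of_ne {d : ℕ} {u u' : Circle} {ρ ρ' : Bi d →* U31}
    (h : IsBending d u ρ) (h' : IsBending d u' ρ') (hne : u ≠ u') :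
    ¬ ∃ g : GL (Fin 4) ℂ, ∀ γ, g * (ρ γ).val * g⁻¹ = (ρ' γ).val := by
  rintro ⟨g, hg⟩
  have h1 := bending_trace h
  have h2 := bending_trace h'
  have h3 := congrArg (fun x : GL (Fin 4) ℂ => x.val.trace) (hg (uElt d))
  simp only [Units.val_mul] at h3
  rw [Matrix.trace_mul_comm, ← Matrix.mul_assoc, Units.inv_mul, Matrix.one_mul] at h3
  apply hne
  apply Circle.ext
  have h4 : (toMat (ρ (uElt d))).trace = (toMat (ρ' (uElt d))).trace := h3
  rw [h1, h2] at h4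
  exact add_left_cancel h4

/-! ### Generators in the Euclidean cases -/

theorem upperO_val {d : ℕ} (x : ringO d) : (upperO x).val = !![1, x; 0, 1] := rfl

theorem weylO_val (d : ℕ) : (weylO d).val = !![0, -1; 1, 0] := rfl

theorem upperO_add {d : ℕ} (x y : ringO d) : upperO (x + y) = upperO x * upperO y := by
  apply Subtype.ext
  change (upperO (x + y)).val = (upperO x).val * (upperO y).val
  rw [upperO_val, upperO_val, upperO_val]
  simp [add_comm]

theorem upperO_zero {d : ℕ} : upperO (0 : ringO d) = 1 := by
  apply Subtype.ext
  ext i j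
  fin_cases i <;> fin_cases j <;> simp [upperO]

theorem upperO_neg {d : ℕ} (x : ringO d) : upperO (-x) = (upperO x)⁻¹ := by
  rw [eq_inv_iff_mul_eq_one, ← upperO_add, neg_add_cancel, upperO_zero]

theorem upperO_mem {d : ℕ} (hd : Admissible d) {H : Subgroup SL(2, ringO d)}
    (h1 : upperO 1 ∈ H) (hτ : upperO (tauO d) ∈ H) (x : ringO d) : upperO x ∈ H := by
  let S : AddSubgroup (ringO d) :=
    { carrier := {x | upperO x ∈ H}
      zero_mem' := by simp only [Set.mem_ofPred_eq, upperO_zero]; exact H.one_mem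
      add_mem' := fun {a b} ha hb => by
        simp only [Set.mem_ofPred_eq] at *
        rw [upperO_add]; exact H.mul_mem ha hb
      neg_mem' := fun {a} ha => by
        simp only [Set.mem_ofPred_eq] at *
        rw [upperO_neg]; exact H.inv_mem ha }
  obtain ⟨m, n, hx⟩ := exists_int_tau_of_mem hd.squarefree x.2
  have hx' : x = m • (1 : ringO d) + n • tauO d := by
    apply Subtype.ext
    rw [hx]
    simp [tauO]
  have h1S : (1 : ringO d) ∈ S := h1
  have hτS : tauO d ∈ S := hτ
  have : x ∈ S := by
    rw [hx']
    exact add_mem (zsmul_mem h1S m) (zsmul_mem hτS n)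
  exact this

theorem weylO_sq (d : ℕ) : weylO d * weylO d = -1 := by
  apply Subtype.ext
  change (weylO d).val * (weylO d).val = -1
  rw [weylO_val]
  ext i j
  fin_cases i <;> fin_cases j <;> simp

theorem Admissible.eq_one_or_of_mul {d : ℕ} (hd : Admissible d) {x y : ringO d} (h : x * y = 1) :
    x = 1 ∨ x = -1 := by
  obtain ⟨m, hm⟩ := hd.exists_nat_normSq x.2
  obtain ⟨n, hn⟩ := hd.exists_nat_normSq y.2
  have h1 : (x : ℂ) * (y : ℂ) = 1 := by
    have := congrArg (fun z : ringO d => (z : ℂ)) h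
    simpa using this
  have h2 : Complex.normSq x * Complex.normSq y = 1 := by
    rw [← Complex.normSq_mul, h1, Complex.normSq_one]
  rw [hm, hn] at h2
  have h3 : m * n = 1 := by exact_mod_cast h2
  have h4 : m = 1 := Nat.eq_one_of_mul_eq_one_right h3
  rw [h4] at hm
  rcases hd.eq_one_or_of_normSq x.2 (by simpa using hm) with h | h
  · left; exact Subtype.ext h
  · right; exact Subtype.ext (by simpa using h)

/-- An element with vanishing lower left entry is a translation, up to sign. -/
theorem eq_upperO_of_lower_zero {d : ℕ} (hd : Admissible d) {g : SL(2, ringO d)}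
    (h : g.val 1 0 = 0) : ∃ x, g = upperO x ∨ g = -upperO x := by
  have hdet : g.val 0 0 * g.val 1 1 = 1 := by
    have := g.prop
    rw [Matrix.det_fin_two, h, mul_zero, sub_zero] at this
    exact this
  rcases hd.eq_one_or_of_mul hdet with h0 | h0
  · have h1 : g.val 1 1 = 1 := by rw [h0, one_mul] at hdet; exact hdet
    refine ⟨g.val 0 1, Or.inl ?_⟩
    apply Subtype.ext
    ext i j
    fin_cases i <;> fin_cases j <;> simp [upperO, h, h0, h1]
  · have h1 : g.val 1 1 = -1 := by
      rw [h0, neg_one_mul] at hdet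
      exact neg_eq_iff_eq_neg.1 hdet
    refine ⟨-g.val 0 1, Or.inr ?_⟩
    apply Subtype.ext
    change g.val = -(upperO (-g.val 0 1)).val
    rw [upperO_val]
    ext i j
    fin_cases i <;> fin_cases j <;> simp [h, h0, h1]

/-- Rounding the coordinates with respect to 1 and τ leaves an error of norm at most 1/4 + δ²/4 < 1.
-/
theorem exists_close {d : ℕ} (hd : Admissible d) (h3 : delta d ^ 2 < 3) (z : ℂ) :
    ∃ q : ringO d, Complex.normSq (z - q) < 1 := by
  have hδ := hd.delta_pos
  set n : ℤ := round (z.im / delta d) with hn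
  set m : ℤ := round (z.re - n * (tau d).re) with hm
  have h1 := abs_sub_round (z.im / delta d)
  have h2 := abs_sub_round (z.re - n * (tau d).re)
  rw [← hn] at h1
  rw [← hm] at h2
  refine ⟨(m : ringO d) + (n : ringO d) * tauO d, ?_⟩
  have e : ((((m : ringO d) + (n : ringO d) * tauO d : ringO d)) : ℂ) = m + n * tau d := by
    simp [tauO]
  rw [e, Complex.normSq_apply]
  have him : (z - (m + n * tau d)).im = (z.im / delta d - n) * delta d := by
    have : (tau d).im = delta d := rfl
    simp [this]
    field_simp
  have hre : (z - (m + n * tau d)).re = (z.re - n * (tau d).re) - m := by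
    simp; ring
  rw [him, hre]
  generalize z.re - n * (tau d).re - m = a at *
  generalize z.im / delta d - n = b at *
  have ha : a * a ≤ 1 / 4 := by nlinarith [sq_abs a, abs_nonneg a]
  have hb : b * b ≤ 1 / 4 := by nlinarith [sq_abs b, abs_nonneg b]
  nlinarith [sq_nonneg (delta d)]

/-- Euclid's algorithm on the first column: a translation followed by the Weyl element lowers the
norm of the lower left entry until it is zero, where ± a translation remains. -/
theorem eq_top_of_euclidean {d : ℕ} (hd : Admissible d) (h3 : delta d ^ 2 < 3)
    {H : Subgroup SL(2, ringO d)} (ha : weylO d ∈ H) (h1 : upperO 1 ∈ H)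
    (hτ : upperO (tauO d) ∈ H) : H = ⊤ := by
  have hup := upperO_mem hd h1 hτ
  rw [eq_top_iff]
  intro g _
  obtain ⟨n, hn⟩ := hd.exists_nat_normSq (g.val 1 0).2
  induction n using Nat.strong_induction_on generalizing g with
  | _ n ih =>
  by_cases h0 : g.val 1 0 = 0
  · obtain ⟨x, rfl | rfl⟩ := eq_upperO_of_lower_zero hd h0
    · exact hup x
    · have : -upperO x = weylO d * weylO d * upperO x := by rw [weylO_sq, neg_one_mul]
      rw [this]
      exact H.mul_mem (H.mul_mem ha ha) (hup x)
  · have h0' : (g.val 1 0 : ℂ) ≠ 0 := fun h => h0 (Subtype.ext h)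
    obtain ⟨q, hq⟩ := exists_close hd h3 ((g.val 0 0 : ℂ) / (g.val 1 0 : ℂ))
    set g' := weylO d * upperO (-q) * g with hg'
    have hent : (g'.val 1 0 : ℂ) = (g.val 0 0 : ℂ) - q * (g.val 1 0 : ℂ) := by
      have : g'.val = (weylO d).val * (upperO (-q)).val * g.val := rfl
      rw [this, weylO_val, upperO_val]
      simp [Matrix.mul_apply, Fin.sum_univ_two]
      ring
    obtain ⟨n', hn'⟩ := hd.exists_nat_normSq (g'.val 1 0).2
    have hlt : n' < n := by
      have e : (g'.val 1 0 : ℂ) = ((g.val 0 0 : ℂ) / (g.val 1 0 : ℂ) - q) * (g.val 1 0 : ℂ) := by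
        rw [hent]; field_simp
      have : Complex.normSq (g'.val 1 0 : ℂ) < Complex.normSq (g.val 1 0 : ℂ) := by
        rw [e, Complex.normSq_mul]
        have := Complex.normSq_pos.2 h0'
        nlinarith
      rw [hn', hn] at this
      exact_mod_cast this
    have hmem := ih n' hlt (g := g') trivial hn'
    have : g = (weylO d * upperO (-q))⁻¹ * g' := by rw [hg']; group
    rw [this]
    exact H.mul_mem (H.inv_mem (H.mul_mem ha (hup _))) hmem

theorem eq_of_generators {d : ℕ} (hd : Admissible d) (h3 : delta d ^ 2 < 3) {ρ ρ' : Bi d →* U31}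
    (ha : ρ (aElt d) = ρ' (aElt d)) (ht : ρ (tElt d) = ρ' (tElt d))
    (hu : ρ (uElt d) = ρ' (uElt d)) : ρ = ρ' := by
  have h := eq_top_of_euclidean hd h3
    (H := MonoidHom.eqLocus (ρ.comp (toBi d)) (ρ'.comp (toBi d))) ha ht hu
  refine MonoidHom.ext fun γ => ?_
  obtain ⟨g, rfl⟩ := toBi_surjective d γ
  have : g ∈ MonoidHom.eqLocus (ρ.comp (toBi d)) (ρ'.comp (toBi d)) := by rw [h]; trivial
  exact this

theorem delta_sq_lt {d : ℕ} (h : d = 2 ∨ d = 7 ∨ d = 11) : delta d ^ 2 < 3 := by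
  rcases h with rfl | rfl | rfl <;> rw [delta_eq] <;> norm_num [div_pow]

theorem existsUnique_of_generators {d : ℕ} (hd : Admissible d) (h : d = 2 ∨ d = 7 ∨ d = 11)
    (u : Circle) : ∃! ρ : Bi d →* U31,
      toMat (ρ (aElt d)) = matA ∧ toMat (ρ (tElt d)) = matT ∧ toMat (ρ (uElt d)) = matU d u := by
  have hb := isBending_bendBi hd u
  refine ⟨bendBi hd u, ⟨bending_a hd hb, bending_t hd hb, bending_u hb⟩, ?_⟩
  rintro ρ ⟨ha, ht, hu⟩
  exact eq_of_generators hd (delta_sq_lt h) (U31_ext (ha.trans (bending_a hd hb).symm))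
    (U31_ext (ht.trans (bending_t hd hb).symm)) (U31_ext (hu.trans (bending_u hb).symm))

/-! ### Fixed points in complex hyperbolic space -/

theorem normForm_apply (v : Fin 4 → ℂ) :
    normForm v = 2 * (v 0 * (starRingEnd ℂ) (v 3)).re + Complex.normSq (v 1) +
      Complex.normSq (v 2) := by
  simp [normForm, siegelJ, dotProduct, Matrix.mulVec, Fin.sum_univ_four, Complex.normSq_apply]
  ring

theorem normForm_smul (a : ℂ) (v : Fin 4 → ℂ) :
    normForm (a • v) = Complex.normSq a * normForm v := by
  rw [normForm_apply, normForm_apply]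
  simp [Complex.normSq_apply]
  ring

theorem normForm_mulVec (g : U31) (v : Fin 4 → ℂ) :
    normForm ((toMat g).mulVec v) = normForm v := by
  unfold normForm
  rw [Matrix.star_mulVec, ← Matrix.dotProduct_mulVec, Matrix.mulVec_mulVec, Matrix.mulVec_mulVec,
    toMat_mem]

theorem normForm_rep {v : Fin 4 → ℂ} (hv : v ≠ 0) :
    ∃ r : ℝ, 0 < r ∧ normForm (Projectivization.mk ℂ v hv).rep = r * normForm v := by
  obtain ⟨a, ha⟩ := Projectivization.exists_smul_eq_mk_rep ℂ v hv
  refine ⟨Complex.normSq a, Complex.normSq_pos.2 a.ne_zero, ?_⟩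
  rw [← ha, ← normForm_smul]
  rfl

theorem mk_mem_HC3 {v : Fin 4 → ℂ} (hv : v ≠ 0) :
    Projectivization.mk ℂ v hv ∈ HC3 ↔ normForm v < 0 := by
  obtain ⟨r, hr, h⟩ := normForm_rep hv
  change normForm _ < 0 ↔ _
  rw [h]
  constructor
  · intro h; nlinarith
  · intro h; nlinarith

theorem mk_mem_boundary {v : Fin 4 → ℂ} (hv : v ≠ 0) :
    Projectivization.mk ℂ v hv ∈ boundaryHC3 ↔ normForm v = 0 := by
  obtain ⟨r, hr, h⟩ := normForm_rep hv
  change normForm _ = 0 ↔ _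
  rw [h, mul_eq_zero]
  exact ⟨fun h => h.resolve_left hr.ne', Or.inr⟩

theorem fixes_mk {g : U31} {v : Fin 4 → ℂ} (hv : v ≠ 0) :
    Fixes g (Projectivization.mk ℂ v hv) ↔ ∃ μ : ℂ, (toMat g).mulVec v = μ • v := by
  unfold Fixes
  rw [Projectivization.smul_mk, Projectivization.mk_eq_mk_iff']
  constructor
  · rintro ⟨μ, h⟩
    exact ⟨μ, h.symm⟩
  · rintro ⟨μ, h⟩
    exact ⟨μ, h.symm⟩

theorem smul_mem_HC3 {k : U31} {p : ℙ ℂ (Fin 4 → ℂ)} (hp : p ∈ HC3) : k.val • p ∈ HC3 := by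
  induction p using Projectivization.ind with
  | h v hv =>
    rw [Projectivization.smul_mk, mk_mem_HC3]
    rw [mk_mem_HC3] at hp
    change normForm ((toMat k).mulVec v) < 0
    rwa [normForm_mulVec]

theorem smul_mem_boundary {k : U31} {p : ℙ ℂ (Fin 4 → ℂ)} (hp : p ∈ boundaryHC3) :
    k.val • p ∈ boundaryHC3 := by
  induction p using Projectivization.ind with
  | h v hv =>
    rw [Projectivization.smul_mk, mk_mem_boundary]
    rw [mk_mem_boundary] at hp
    change normForm ((toMat k).mulVec v) = 0
    rwa [normForm_mulVec]

theorem fixes_conj {k g : U31} {p : ℙ ℂ (Fin 4 → ℂ)} :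
    Fixes (k * g * k⁻¹) p ↔ Fixes g (k⁻¹.val • p) := by
  unfold Fixes
  rw [show (k * g * k⁻¹).val = k.val * (g.val * k⁻¹.val) by simp [mul_assoc], mul_smul, mul_smul,
    smul_eq_iff_eq_inv_smul]
  rfl

theorem inv_val_smul_smul (k : U31) (p : ℙ ℂ (Fin 4 → ℂ)) : k⁻¹.val • k.val • p = p := by
  rw [smul_smul]
  have : k⁻¹.val * k.val = 1 := by simp
  rw [this, one_smul]

theorem val_smul_inv_smul (k : U31) (p : ℙ ℂ (Fin 4 → ℂ)) : k.val • k⁻¹.val • p = p := by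
  rw [smul_smul]
  have : k.val * k⁻¹.val = 1 := by simp
  rw [this, one_smul]

theorem IsParabolic.conj {g : U31} (hg : IsParabolic g) (k : U31) : IsParabolic (k * g * k⁻¹) := by
  obtain ⟨h1, p, ⟨hp, hfix⟩, huniq⟩ := hg
  refine ⟨fun q hq h => h1 _ (smul_mem_HC3 hq) (fixes_conj.1 h), k.val • p,
    ⟨smul_mem_boundary hp, ?_⟩, ?_⟩
  · rw [fixes_conj, inv_val_smul_smul]
    exact hfix
  · rintro q ⟨hq, hqf⟩
    have := huniq _ ⟨smul_mem_boundary (k := k⁻¹) hq, fixes_conj.1 hqf⟩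
    rw [← this, val_smul_inv_smul]

theorem IsBoundaryElliptic.conj {g : U31} (hg : IsBoundaryElliptic g) (k : U31) :
    IsBoundaryElliptic (k * g * k⁻¹) := by
  obtain ⟨⟨⟨p, hp, hpf⟩, q, hq, hqf⟩, r, hr, hrf⟩ := hg
  refine ⟨⟨⟨k.val • p, smul_mem_HC3 hp, ?_⟩, k.val • q, smul_mem_HC3 hq, ?_⟩, k.val • r,
    smul_mem_boundary hr, ?_⟩
  · rwa [fixes_conj, inv_val_smul_smul]
  · rwa [fixes_conj, inv_val_smul_smul]
  · rwa [fixes_conj, inv_val_smul_smul]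

/-- A vector with v₃ = 0 has norm |v₁|² + |v₂|² ≥ 0, and it is null only on the line of e₁. So e₁ is
the only possible fixed point in the closed ball. -/
theorem isParabolic_of_eigen {g : U31}
    (h1 : ∃ μ : ℂ, (toMat g).mulVec ![1, 0, 0, 0] = μ • ![1, 0, 0, 0])
    (h2 : ∀ (v : Fin 4 → ℂ) (μ : ℂ), v 3 ≠ 0 → (toMat g).mulVec v ≠ μ • v) : IsParabolic g := by
  have he : (![1, 0, 0, 0] : Fin 4 → ℂ) ≠ 0 := fun h => by simpa using congrFun h 0
  constructor
  · intro p hp hf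
    induction p using Projectivization.ind with
    | h v hv =>
      rw [mk_mem_HC3] at hp
      obtain ⟨μ, hμ⟩ := (fixes_mk hv).1 hf
      refine h2 v μ ?_ hμ
      intro h3
      rw [normForm_apply, h3] at hp
      simp at hp
      linarith [Complex.normSq_nonneg (v 1), Complex.normSq_nonneg (v 2)]
  · refine ⟨Projectivization.mk ℂ _ he, ⟨?_, ?_⟩, ?_⟩
    · rw [mk_mem_boundary, normForm_apply]; simp
    · exact (fixes_mk he).2 h1
    · rintro p ⟨hp, hf⟩
      induction p using Projectivization.ind with
      | h v hv =>
        rw [mk_mem_boundary] at hp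
        obtain ⟨μ, hμ⟩ := (fixes_mk hv).1 hf
        have h3 : v 3 = 0 := by
          by_contra h3
          exact h2 v μ h3 hμ
        rw [normForm_apply, h3] at hp
        simp at hp
        have n1 := Complex.normSq_nonneg (v 1)
        have n2 := Complex.normSq_nonneg (v 2)
        have h4 : v 1 = 0 := Complex.normSq_eq_zero.1 (by linarith)
        have h5 : v 2 = 0 := Complex.normSq_eq_zero.1 (by linarith)
        rw [Projectivization.mk_eq_mk_iff']
        refine ⟨v 0, ?_⟩
        ext i
        fin_cases i <;> simp [h3, h4, h5]

/-! ### Conjugacy classes in `SL(2, ℂ)` -/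

/-- Diagonal matrices. -/
def diagC (l : ℂˣ) : SL(2, ℂ) := ⟨!![(l : ℂ), 0; 0, ((l⁻¹ : ℂˣ) : ℂ)], by simp [Matrix.det_fin_two]⟩

theorem diagC_val (l : ℂˣ) : (diagC l).val = !![(l : ℂ), 0; 0, ((l⁻¹ : ℂˣ) : ℂ)] := rfl
theorem upperC_val (z : ℂ) : (upperC z).val = !![1, z; 0, 1] := rfl
theorem weylC_val : weylC.val = !![0, -1; 1, 0] := rfl

theorem SL2_ext {g h : SL(2, ℂ)} (H : g.val = h.val) : g = h := Subtype.ext H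

theorem SL2_mul_val (g h : SL(2, ℂ)) : (g * h).val = g.val * h.val := rfl

theorem upperC_add (x y : ℂ) : upperC (x + y) = upperC x * upperC y := by
  apply SL2_ext
  rw [SL2_mul_val, upperC_val, upperC_val, upperC_val]
  simp [add_comm]

theorem upperC_zero : upperC 0 = 1 := by
  apply SL2_ext
  rw [upperC_val]
  ext i j
  fin_cases i <;> fin_cases j <;> simp

theorem upperC_neg (x : ℂ) : upperC (-x) = (upperC x)⁻¹ := by
  rw [eq_inv_iff_mul_eq_one, ← upperC_add, neg_add_cancel, upperC_zero]

theorem exists_triangular (g : SL(2, ℂ)) (h : g.val 1 0 = 0) :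
    ∃ (l : ℂˣ) (z : ℂ), g = diagC l * upperC z := by
  have hdet : g.val 0 0 * g.val 1 1 = 1 := by
    have := g.prop
    rw [Matrix.det_fin_two, h, mul_zero, sub_zero] at this
    exact this
  have h0 : g.val 0 0 ≠ 0 := left_ne_zero_of_mul_eq_one hdet
  refine ⟨Units.mk0 _ h0, (g.val 0 0)⁻¹ * g.val 0 1, ?_⟩
  apply SL2_ext
  rw [SL2_mul_val, diagC_val, upperC_val]
  ext i j
  fin_cases i <;> fin_cases j
  · simp
  · simp; field_simp
  · simp [h]
  · simp
    exact eq_inv_of_mul_eq_one_right hdet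

theorem exists_conj_triangular (g : SL(2, ℂ)) :
    ∃ (h : SL(2, ℂ)) (l : ℂˣ) (z : ℂ), h * g * h⁻¹ = diagC l * upperC z := by
  by_cases h0 : g.val 1 0 = 0
  · obtain ⟨l, z, h⟩ := exists_triangular g h0
    exact ⟨1, l, z, by simpa using h⟩
  -- The roots of this quadratic are the fixed points of the Möbius transformation; one of them is
  -- moved to ∞.
  · obtain ⟨z, hz⟩ := IsAlgClosed.exists_root
      (Polynomial.C (g.val 1 0) * Polynomial.X ^ 2 +
        Polynomial.C (g.val 1 1 - g.val 0 0) * Polynomial.X + Polynomial.C (-g.val 0 1)) (by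
        rw [Polynomial.degree_quadratic h0]; norm_num)
    have hz' : g.val 1 0 * z ^ 2 + (g.val 1 1 - g.val 0 0) * z - g.val 0 1 = 0 := by
      simp at hz
      linear_combination hz
    set h := upperC z * weylC with hh
    have hinv : h⁻¹ = weylC⁻¹ * upperC (-z) := by rw [hh, mul_inv_rev, upperC_neg]
    have hw : (weylC⁻¹).val = !![0, 1; -1, 0] := by
      rw [Matrix.SpecialLinearGroup.coe_inv, weylC_val, Matrix.adjugate_fin_two_of]; simp
    obtain ⟨l, w, hl⟩ := exists_triangular (h⁻¹ * g * h) (by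
      rw [SL2_mul_val, SL2_mul_val, hinv, hh, SL2_mul_val, SL2_mul_val, hw, weylC_val, upperC_val,
        upperC_val]
      simp [Matrix.vecMul, dotProduct, Matrix.mul_apply, Fin.sum_univ_two]
      linear_combination hz')
    exact ⟨h⁻¹, l, w, by rw [inv_inv]; exact hl⟩

theorem exists_normal_form (g : SL(2, ℂ)) :
    ∃ (h : SL(2, ℂ)) (l : ℂˣ), (((l : ℂ) ^ 2 ≠ 1) ∧ h * g * h⁻¹ = diagC l) ∨
      ((l : ℂ) ^ 2 = 1 ∧ ∃ z, h * g * h⁻¹ = diagC l * upperC z) := by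
  obtain ⟨h, l, z, hg⟩ := exists_conj_triangular g
  by_cases hl : (l : ℂ) ^ 2 = 1
  · exact ⟨h, l, Or.inr ⟨hl, z, hg⟩⟩
  · have hl' : (l : ℂ) ^ 2 - 1 ≠ 0 := sub_ne_zero.2 hl
    -- The translation that moves the second fixed point to 0, so that the conjugate is diagonal.
    set w : ℂ := (l : ℂ) ^ 2 * z / ((l : ℂ) ^ 2 - 1) with hw
    refine ⟨upperC w * h, l, Or.inl ⟨hl, ?_⟩⟩
    have e : upperC w * h * g * (upperC w * h)⁻¹ = upperC w * (h * g * h⁻¹) * upperC (-w) := by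
      rw [upperC_neg]; group
    rw [e, hg]
    apply SL2_ext
    rw [SL2_mul_val, SL2_mul_val, SL2_mul_val, diagC_val, upperC_val, upperC_val, upperC_val]
    have hl0 := l.ne_zero
    ext i j
    fin_cases i <;> fin_cases j <;> simp
    rw [hw]
    field_simp
    ring

/-- `hermCoord` intertwines the two actions: eigenvectors. -/
theorem spinU_eigen_iff {g : SL(2, ℂ)} {v : Fin 4 → ℂ} {μ : ℂ} :
    (toMat (spinU g)).mulVec v = μ • v ↔
      g.val * hermCoord v * g.val.conjTranspose = μ • hermCoord v := by
  rw [← hermCoord.injective.eq_iff, hermCoord_spinU, map_smul]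

theorem diagC_conj_apply (l : ℂˣ) (X : Matrix (Fin 2) (Fin 2) ℂ) :
    (diagC l).val * X * (diagC l).val.conjTranspose =
      !![(Complex.normSq l : ℂ) * X 0 0, l * (starRingEnd ℂ) ((l⁻¹ : ℂˣ) : ℂ) * X 0 1;
        ((l⁻¹ : ℂˣ) : ℂ) * (starRingEnd ℂ) l * X 1 0, (Complex.normSq ((l⁻¹ : ℂˣ) : ℂ) : ℂ) * X 1 1] := by
  rw [diagC_val, ← Complex.mul_conj, ← Complex.mul_conj]
  ext i j
  fin_cases i <;> fin_cases j <;> simp [Matrix.vecMul, dotProduct, Matrix.mul_apply, Fin.sum_univ_two] <;> ring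

/-- Both e₁ and e₄ are null eigenvectors. -/
theorem not_isParabolic_diagC (l : ℂˣ) : ¬ IsParabolic (spinU (diagC l)) := by
  rintro ⟨h1, p, -, huniq⟩
  have n1 : (![1, 0, 0, 0] : Fin 4 → ℂ) ≠ 0 := fun h => by simpa using congrFun h 0
  have n4 : (![0, 0, 0, 1] : Fin 4 → ℂ) ≠ 0 := fun h => by simpa using congrFun h 3
  have e1 := huniq (Projectivization.mk ℂ _ n1)
    ⟨by rw [mk_mem_boundary, normForm_apply]; simp, (fixes_mk n1).2 ⟨Complex.normSq l, by
      rw [spinU_eigen_iff, diagC_conj_apply, hermCoord_apply]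
      ext i j; fin_cases i <;> fin_cases j <;> simp⟩⟩
  have e4 := huniq (Projectivization.mk ℂ _ n4)
    ⟨by rw [mk_mem_boundary, normForm_apply]; simp,
      (fixes_mk n4).2 ⟨Complex.normSq ((l⁻¹ : ℂˣ) : ℂ), by
      rw [spinU_eigen_iff, diagC_conj_apply, hermCoord_apply]
      ext i j; fin_cases i <;> fin_cases j <;> simp⟩⟩
  have := e1.trans e4.symm
  rw [Projectivization.mk_eq_mk_iff'] at this
  obtain ⟨a, ha⟩ := this
  simpa using congrFun ha 0

theorem spinU_diagC_of_sq {l : ℂˣ} (hl : (l : ℂ) ^ 2 = 1) : spinU (diagC l) = 1 := by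
  apply U31_ext
  rw [toMat_one]
  apply toMat_spinU_eq
  intro v
  rw [Matrix.one_mulVec]
  have h : (diagC l).val = (l : ℂ) • 1 := by
    have : ((l⁻¹ : ℂˣ) : ℂ) = l := by
      rw [Units.val_inv_eq_inv_val]
      exact (eq_inv_of_mul_eq_one_left (by rw [← sq]; exact hl)).symm
    rw [diagC_val, this]
    ext i j; fin_cases i <;> fin_cases j <;> simp
  have h2 : (l : ℂ) * (starRingEnd ℂ) (l : ℂ) = 1 := by
    rcases sq_eq_one_iff.1 hl with h | h <;> simp [h]
  rw [h]
  simp [smul_smul]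
  rw [mul_comm, h2, one_smul]

/-! ### Elliptic elements -/

/-- This turns a fixed point in complex hyperbolic space into one in real hyperbolic space. A
negative eigenvector has nonzero first and last coordinates. For the diagonal normal form this
forces |l|² = |l|⁻², and for the unipotent one it forces z = 0. Either way the normal form fixes the
identity matrix. -/
theorem exists_posDef_fixed {g : SL(2, ℂ)} (hg : ∃ p ∈ HC3, Fixes (spinU g) p) :
    ∃ X : Matrix (Fin 2) (Fin 2) ℂ, X.PosDef ∧ g.val * X * g.val.conjTranspose = X := by
  obtain ⟨h, l, hcase⟩ := exists_normal_form g
  set g' := h * g * h⁻¹ with hg'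
  suffices hs : g'.val * 1 * g'.val.conjTranspose = 1 by
    refine ⟨(h⁻¹).val * 1 * (h⁻¹).val.conjTranspose,
      posDef_conj (h⁻¹).prop Matrix.PosDef.one, ?_⟩
    have e : g.val * (h⁻¹).val = (h⁻¹).val * g'.val := by
      have e' : g * h⁻¹ = h⁻¹ * g' := by rw [hg']; group
      rw [← SL2_mul_val, ← SL2_mul_val, e']
    calc g.val * ((h⁻¹).val * 1 * (h⁻¹).val.conjTranspose) * g.val.conjTranspose
        = (g.val * (h⁻¹).val) * 1 * (g.val * (h⁻¹).val).conjTranspose := by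
          rw [Matrix.conjTranspose_mul]; simp only [Matrix.mul_assoc]
      _ = (h⁻¹).val * (g'.val * 1 * g'.val.conjTranspose) * (h⁻¹).val.conjTranspose := by
          rw [e, Matrix.conjTranspose_mul]; simp only [Matrix.mul_assoc]
      _ = _ := by rw [hs]
  obtain ⟨p, hp, hpf⟩ := hg
  have hfix : ∃ q ∈ HC3, Fixes (spinU g') q := by
    refine ⟨(spinU h).val • p, smul_mem_HC3 hp, ?_⟩
    rw [hg', map_mul, map_mul, map_inv, fixes_conj, inv_val_smul_smul]
    exact hpf
  obtain ⟨q, hq, hqf⟩ := hfix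
  induction q using Projectivization.ind with
  | h v hv =>
  rw [mk_mem_HC3, normForm_apply] at hq
  obtain ⟨μ, hμ⟩ := (fixes_mk hv).1 hqf
  have n1 := Complex.normSq_nonneg (v 1)
  have n2 := Complex.normSq_nonneg (v 2)
  have h0 : v 0 ≠ 0 := by rintro h; rw [h] at hq; simp at hq; linarith
  have h3 : v 3 ≠ 0 := by rintro h; rw [h] at hq; simp at hq; linarith
  rcases hcase with ⟨-, he⟩ | ⟨hl, z, he⟩
  · rw [he, spinU_eigen_iff, diagC_conj_apply, hermCoord_apply] at hμ
    have e0 := congrFun (congrFun hμ 0) 0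
    have e1 := congrFun (congrFun hμ 1) 1
    simp at e0 e1
    have k0 : (Complex.normSq l : ℂ) = μ := by
      rcases e0 with h | h
      · exact h
      · exact absurd h h0
    have k1 : ((Complex.normSq l : ℂ))⁻¹ = μ := by
      rcases e1 with h | h
      · exact h
      · exact absurd h h3
    have hl0 : Complex.normSq l ≠ 0 := (Complex.normSq_pos.2 l.ne_zero).ne'
    have hl1 : Complex.normSq l = 1 := by
      have h : (Complex.normSq l : ℂ)⁻¹ = Complex.normSq l := k1.trans k0.symm
      have h' : (Complex.normSq l)⁻¹ = Complex.normSq l := by exact_mod_cast h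
      have h2 : Complex.normSq l * Complex.normSq l = 1 := by
        nth_rewrite 1 [← h']
        exact inv_mul_cancel₀ hl0
      nlinarith [Complex.normSq_nonneg l]
    rw [he, diagC_conj_apply]
    ext i j
    fin_cases i <;> fin_cases j <;> simp [hl1]
  · rw [he, map_mul, spinU_diagC_of_sq hl, one_mul, toMat_spinU_upperC] at hμ
    have m3 := congrFun hμ 3
    have m1 := congrFun hμ 1
    have m2 := congrFun hμ 2
    simp [transMat, Matrix.mulVec, dotProduct, Fin.sum_univ_four] at m1 m2 m3
    have hμ1 : μ = 1 := by
      have : (μ - 1) * v 3 = 0 := by linear_combination -m3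
      rcases mul_eq_zero.1 this with h | h
      · exact sub_eq_zero.1 h
      · exact absurd h h3
    rw [hμ1] at m1 m2
    simp [h3] at m1 m2
    have hz : z = 0 := Complex.ext m1 m2
    have hl1 : Complex.normSq l = 1 := by
      rcases sq_eq_one_iff.1 hl with h | h <;> simp [h]
    have he' : g' = diagC l := by rw [he, hz, upperC_zero, mul_one]
    rw [he', diagC_conj_apply]
    ext i j
    fin_cases i <;> fin_cases j <;> simp [hl1]

theorem mem_chamberStab_of_sep {d : ℕ} (hd : Admissible d) {X : Matrix (Fin 2) (Fin 2) ℂ}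
    (hX : (bianchiWalls hd).IsRegular X) {k g : SL(2, ringO d)}
    (hs : (bianchiWalls hd).sep (actM k (basePoint d)) X = ∅)
    (hg : (bianchiWalls hd).sep X (actM g X) = ∅) : k⁻¹ * g * k ∈ chamberStab hd := by
  have hb := isRegular_base hd
  have hkb := isRegular_actM hb k
  rw [mul_assoc, mem_chamberStab_iff, actM_mul]
  have h1 := ((bianchiAction hd).sep_act_eq_empty (g := g) hkb hX).2 hs
  have h1' := (WallSpace.sep_eq_empty (isRegular_actM hkb g) (isRegular_actM hX g)).1 h1
  rw [WallSpace.sep_eq_empty hkb hX] at hs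
  rw [WallSpace.sep_eq_empty hX (isRegular_actM hX g)] at hg
  rw [WallSpace.sep_eq_empty hkb (isRegular_actM hkb g)]
  exact fun v => (hs v).trans ((hg v).trans (h1' v).symm)

theorem exists_mem_chamberStab {d : ℕ} (hd : Admissible d) {X : Matrix (Fin 2) (Fin 2) ℂ}
    (hX : (bianchiWalls hd).IsRegular X) :
    ∃ k : SL(2, ringO d), ∀ g, (bianchiWalls hd).sep X (actM g X) = ∅ →
      k⁻¹ * g * k ∈ chamberStab hd := by
  obtain ⟨k, -, hk⟩ := exists_mem_closure_sep hd hX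
  exact ⟨k, fun g hg => mem_chamberStab_of_sep hd hX hk hg⟩

/-- If the fixed point is in a chamber, that chamber is preserved. If it is on a wall, disjointness
forces g to fix the wall with its normal vector, and a conjugate of g fixes J. -/
theorem exists_mem_chamberStab_of_fixed {d : ℕ} (hd : Admissible d) {X : Matrix (Fin 2) (Fin 2) ℂ}
    (hX : X.PosDef) {g : SL(2, ringO d)} (hg : actM g X = X) :
    ∃ k : SL(2, ringO d), k⁻¹ * g * k ∈ chamberStab hd := by
  by_cases hr : (bianchiWalls hd).IsRegular X
  · obtain ⟨k, hk⟩ := exists_mem_chamberStab hd hr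
    refine ⟨k, hk g ?_⟩
    rw [hg, WallSpace.sep_eq_empty hr hr]
    simp
  · have : ∃ v, (bianchiWalls hd).form v X = 0 := by
      by_contra h
      exact hr ⟨hX, fun v hv => h ⟨v, hv⟩⟩
    obtain ⟨v, hv⟩ := this
    have hgv : (bianchiAction hd).wact g v = v := by
      by_contra hne
      refine (bianchiWalls hd).disjoint _ _ hne X hX ?_ hv
      have := (bianchiAction hd).form_act g v X
      rw [hv] at this
      change (bianchiWalls hd).form _ (actM g X) = 0 at this
      rwa [hg] at this
    obtain ⟨k, hk⟩ := v.2
    refine ⟨k, mem_chamberStab_of_fix_J hd ?_⟩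
    have h1 : actM g (actM k matJ) = actM k matJ := by
      have := congrArg Subtype.val hgv
      change actM g v.1 = v.1 at this
      rw [hk] at this
      exact this
    rw [actM_mul, actM_mul, h1, ← actM_mul, inv_mul_cancel, actM_one]

/-- ρ and ρ₁ agree on k⁻¹gk, so their values at g are conjugate in U(3,1). The dynamical type of
ρ₁(g) is thereby inherited by ρ(g). -/
theorem conj_of_mem_chamberStab {d : ℕ} (hd : Admissible d) {u : Circle} {ρ : Bi d →* U31}
    (h : IsBending d u ρ) {g k : SL(2, ringO d)} (hk : k⁻¹ * g * k ∈ chamberStab hd) :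
    ρ (toBi d g) = (ρ (toBi d k) * (rho1 d (toBi d k))⁻¹) * rho1 d (toBi d g) *
      (ρ (toBi d k) * (rho1 d (toBi d k))⁻¹)⁻¹ := by
  have h1 := h.1 _ (mem_cutGroup hd hk)
  simp only [map_mul, map_inv] at h1
  have h2 : ρ (toBi d g) = ρ (toBi d k) * ((ρ (toBi d k))⁻¹ * ρ (toBi d g) * ρ (toBi d k)) *
    (ρ (toBi d k))⁻¹ := by group
  rw [h2, h1]
  group

theorem isBoundaryElliptic_bending {d : ℕ} (hd : Admissible d) {u : Circle} {ρ : Bi d →* U31}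
    (h : IsBending d u ρ) {γ : Bi d} (hγ : IsBoundaryElliptic (rho1 d γ)) :
    IsBoundaryElliptic (ρ γ) := by
  obtain ⟨g, rfl⟩ := toBi_surjective d γ
  obtain ⟨X, hX, hgX⟩ := exists_posDef_fixed (g := toSLC d g) hγ.1.2
  obtain ⟨k, hk⟩ := exists_mem_chamberStab_of_fixed hd hX (g := g) hgX
  rw [conj_of_mem_chamberStab hd h hk]
  exact hγ.conj _

/-! ### Horoballs -/

/-- The degenerate Hermitian matrix `ξ ξ*`. -/
def nullMat (ξ : Fin 2 → ℂ) : Matrix (Fin 2) (Fin 2) ℂ := Matrix.vecMulVec ξ (star ξ)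

theorem conj_nullMat (g : Matrix (Fin 2) (Fin 2) ℂ) (ξ : Fin 2 → ℂ) :
    g * nullMat ξ * g.conjTranspose = nullMat (g.mulVec ξ) := by
  rw [nullMat, Matrix.mul_vecMulVec, Matrix.vecMulVec_mul, nullMat, Matrix.star_mulVec]

theorem nullMat_e1 : nullMat ![1, 0] = herm 1 0 0 := by
  ext i j; fin_cases i <;> fin_cases j <;> simp [nullMat, herm, Matrix.vecMulVec]

theorem exists_SL2_mulVec_eq {ξ : Fin 2 → ℂ} (hξ : ξ ≠ 0) :
    ∃ h : SL(2, ℂ), h.val.mulVec ξ = ![1, 0] := by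
  by_cases h0 : ξ 0 = 0
  · have h1 : ξ 1 ≠ 0 := by
      intro h1; apply hξ; ext i; fin_cases i <;> simp [h0, h1]
    refine ⟨⟨!![0, (ξ 1)⁻¹; -ξ 1, 0], by simp [Matrix.det_fin_two, h1]⟩, ?_⟩
    ext i; fin_cases i <;> simp [Matrix.mulVec, dotProduct, h0, h1]
  · refine ⟨⟨!![(ξ 0)⁻¹, 0; -ξ 1, ξ 0], by simp [Matrix.det_fin_two, h0]⟩, ?_⟩
    ext i; fin_cases i <;> simp [Matrix.mulVec, dotProduct, h0]
    ring

theorem exists_eq_skew {v : Matrix (Fin 2) (Fin 2) ℂ} (hv : v.conjTranspose = -v)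
    (hdet : v.det = 1) : ∃ (p q : ℝ) (z : ℂ), v = skew p q z ∧ Complex.normSq z - p * q = 1 := by
  have e : ∀ i j, (starRingEnd ℂ) (v j i) = -v i j := fun i j => by
    have := congrFun (congrFun hv i) j
    simpa [Matrix.conjTranspose_apply] using this
  have e0 : v 0 0 = Complex.I * ((v 0 0).im : ℂ) := by
    have := congrArg Complex.re (e 0 0)
    simp at this
    apply Complex.ext
    · simp; linarith
    · simp
  have e1 : v 1 1 = Complex.I * ((v 1 1).im : ℂ) := by
    have := congrArg Complex.re (e 1 1)
    simp at this
    apply Complex.ext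
    · simp; linarith
    · simp
  have e10 : v 1 0 = -(starRingEnd ℂ) (v 0 1) := by rw [e 1 0, neg_neg]
  refine ⟨(v 0 0).im, (v 1 1).im, v 0 1, ?_, ?_⟩
  · ext i j; fin_cases i <;> fin_cases j
    · exact e0
    · rfl
    · exact e10
    · exact e1
  · rw [Matrix.det_fin_two, e10, mul_neg, Complex.mul_conj, e0, e1] at hdet
    have := congrArg Complex.re hdet
    simp at this
    linarith

theorem wall_skew {d : ℕ} (v : Wall d) : v.1.conjTranspose = -v.1 ∧ v.1.det = 1 := by
  obtain ⟨g, hg⟩ := v.2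
  have hJ : matJ.conjTranspose = -matJ := by
    ext i j; fin_cases i <;> fin_cases j <;> simp [matJ]
  rw [hg, wallMat]
  constructor
  · simp only [Matrix.conjTranspose_mul, Matrix.conjTranspose_conjTranspose, hJ]
    simp [Matrix.mul_assoc]
  · rw [Matrix.det_mul, Matrix.det_mul, toSLC_det, Matrix.det_conjTranspose, toSLC_det]
    simp [matJ, Matrix.det_fin_two]

/-- Move the cusp ξ to ∞ by h. The coordinate q of the moved wall is its form at ξξ*, so |q| ≥ δ,
and adding sξξ* raises the point: `wallForm_high` applies. -/
theorem wallForm_horoball {d : ℕ} (hd : Admissible d) {ξ : Fin 2 → ℂ} {h : SL(2, ℂ)}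
    (hh : h.val.mulVec ξ = ![1, 0]) (v : Wall d) (hκ : delta d ≤ |wallForm v.1 (nullMat ξ)|)
    {Z : Matrix (Fin 2) (Fin 2) ℂ} (hZ : Z.PosDef) {s : ℝ} (hs0 : 0 ≤ s)
    (hs : ((h.val * Z * h.val.conjTranspose) 1 1).re ≤ delta d ^ 2 * s) :
    0 < wallForm v.1 (nullMat ξ) * wallForm v.1 (Z + s • nullMat ξ) := by
  have hdet : h.val.det = 1 := h.prop
  have hdet' : h.val.conjTranspose.det = 1 := by simp [Matrix.det_conjTranspose, hdet]
  obtain ⟨hv1, hv2⟩ := wall_skew v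
  obtain ⟨p, q, z, he, hn⟩ := exists_eq_skew (v := h.val * v.1 * h.val.conjTranspose)
    (by simp only [Matrix.conjTranspose_mul, Matrix.conjTranspose_conjTranspose, hv1]
        simp [Matrix.mul_assoc])
    (by rw [Matrix.det_mul, Matrix.det_mul, hdet, hdet', hv2]; norm_num)
  have hZ' := posDef_conj hdet hZ
  obtain ⟨a, c, b, hZe, ha, hc, hb⟩ := posDef_iff.1 hZ'
  have e1 : wallForm v.1 (nullMat ξ) = q := by
    rw [← wallForm_conj hdet, conj_nullMat, hh, he, nullMat_e1, wallForm_skew]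
    simp
  have e2 : wallForm v.1 (Z + s • nullMat ξ) = wallForm (skew p q z) (herm (a + s) c b) := by
    rw [← wallForm_conj hdet, Matrix.mul_add, Matrix.add_mul, hZe, he, Matrix.mul_smul,
      Matrix.smul_mul, conj_nullMat, hh, nullMat_e1]
    congr 1
    ext i j; fin_cases i <;> fin_cases j <;> simp [herm]
  rw [e1] at hκ ⊢
  rw [e2]
  rw [hZe] at hs
  apply wallForm_high hc hb hn
  have h1 : c ≤ delta d ^ 2 * s := by simpa [herm] using hs
  have h2 : delta d ^ 2 ≤ q ^ 2 := by
    rw [← sq_abs q]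
    exact pow_le_pow_left₀ hd.delta_pos.le hκ 2
  exact h1.trans (mul_le_mul_of_nonneg_right h2 hs0)

theorem delta_le_of_ne_zero {d : ℕ} (hd : Admissible d) {x : ℂ} (hx : x ∈ ringO d)
    (h0 : x.im ≠ 0) : delta d ≤ |x.im| := by
  obtain ⟨n, hn⟩ := hd.exists_int_im hx
  rw [hn] at h0 ⊢
  have hδ := hd.delta_pos
  have hn0 : n ≠ 0 := by rintro rfl; simp at h0
  have : (1 : ℝ) ≤ |(n : ℝ)| := by exact_mod_cast Int.one_le_abs hn0
  rw [abs_mul, abs_of_pos hδ]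
  nlinarith

theorem wall_entry_mem {d : ℕ} (hd : Admissible d) (v : Wall d) (i j : Fin 2) :
    v.1 i j ∈ ringO d := by
  obtain ⟨g, hg⟩ := v.2
  have hent : ∀ i j, (toSLC d g).val i j ∈ ringO d := fun i j => (g.val i j).2
  have hent' : ∀ i j, (toSLC d g).val.conjTranspose i j ∈ ringO d := fun i j =>
    hd.star_mem (hent j i)
  have hJ : ∀ i j, matJ i j ∈ ringO d := by
    intro i j
    fin_cases i <;> fin_cases j <;> simp [matJ]
  have hmul : ∀ A B : Matrix (Fin 2) (Fin 2) ℂ, (∀ i j, A i j ∈ ringO d) →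
      (∀ i j, B i j ∈ ringO d) → ∀ i j, (A * B) i j ∈ ringO d := by
    intro A B hA hB i j
    rw [Matrix.mul_apply]
    exact sum_mem fun k _ => mul_mem (hA i k) (hB k j)
  rw [hg, wallMat]
  exact hmul _ _ (hmul _ _ hent hJ) hent' i j

/-- The value is the imaginary part of an element of 𝒪_d, hence a multiple of δ. This is a uniform
gap: a single horoball at ξ avoids all the walls that do not pass through ξ. -/
theorem delta_le_wallForm_nullMat {d : ℕ} (hd : Admissible d) (v : Wall d) {ξ : Fin 2 → ℂ}
    (hξ : ∀ i, ξ i ∈ ringO d) (h0 : wallForm v.1 (nullMat ξ) ≠ 0) :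
    delta d ≤ |wallForm v.1 (nullMat ξ)| := by
  refine delta_le_of_ne_zero hd (x := (nullMat ξ * v.1.adjugate).trace) ?_ h0
  have hv := wall_entry_mem hd v
  have hf : ∀ i j, nullMat ξ i j ∈ ringO d := fun i j => mul_mem (hξ i) (hd.star_mem (hξ j))
  simp only [Matrix.trace_fin_two, Matrix.adjugate_fin_two, Matrix.mul_apply, Fin.sum_univ_two,
    Matrix.of_apply, Matrix.cons_val_zero, Matrix.cons_val_one, Matrix.cons_val']
  exact add_mem (add_mem (mul_mem (hf _ _) (hv _ _)) (mul_mem (hf _ _) (neg_mem (hv _ _))))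
    (add_mem (mul_mem (hf _ _) (neg_mem (hv _ _))) (mul_mem (hf _ _) (hv _ _)))

/-- If no wall passes through the cusp `ξ`, its stabilizer fixes a chamber. -/
theorem exists_stab_of_no_wall {d : ℕ} (hd : Admissible d) {ξ : Fin 2 → ℂ}
    (hξ : ∀ i, ξ i ∈ ringO d) (hξ0 : ξ ≠ 0)
    (hno : ∀ v : Wall d, wallForm v.1 (nullMat ξ) ≠ 0) :
    ∃ k : SL(2, ringO d), ∀ g, (∃ ε : ℂ, ε ^ 2 = 1 ∧ (toSLC d g).val.mulVec ξ = ε • ξ) →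
      k⁻¹ * g * k ∈ chamberStab hd := by
  obtain ⟨h, hh⟩ := exists_SL2_mulVec_eq hξ0
  have hb := isRegular_base hd
  have hb1 : (basePoint d).PosDef := hb.1
  set c := ((h.val * basePoint d * h.val.conjTranspose) 1 1).re with hc
  have hδ := hd.delta_pos
  -- Large enough for base point + sξξ* to lie in the horoball where every form has its sign at ξ.
  set s := |c| / delta d ^ 2 with hs
  have hs0 : 0 ≤ s := by positivity
  have hsc : c ≤ delta d ^ 2 * s := by
    rw [hs, mul_div_cancel₀ _ (by positivity)]; exact le_abs_self c
  have key : ∀ v : Wall d, delta d ≤ |wallForm v.1 (nullMat ξ)| := fun v =>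
    delta_le_wallForm_nullMat hd v hξ (hno v)
  set X := basePoint d + s • nullMat ξ with hX
  have hXp : X.PosDef := by
    refine hb1.add_posSemidef ?_
    exact (Matrix.posSemidef_vecMulVec_self_star ξ).smul hs0
  have hform := fun v : Wall d => wallForm_horoball hd hh v (key v) hb1 hs0 hsc
  have hXr : (bianchiWalls hd).IsRegular X := by
    refine ⟨hXp, fun v h0 => ?_⟩
    have h0 : wallForm v.1 X = 0 := h0
    have := hform v
    rw [h0] at this
    simp at this
  obtain ⟨k, hk⟩ := exists_mem_chamberStab hd hXr
  refine ⟨k, fun g hg => hk g ?_⟩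
  obtain ⟨ε, hε, hgξ⟩ := hg
  have hε2 : ε * (starRingEnd ℂ) ε = 1 := by
    rcases sq_eq_one_iff.1 hε with h | h <;> simp [h]
  have hnull : nullMat (ε • ξ) = nullMat ξ := by
    ext i j
    simp only [nullMat, Matrix.vecMulVec_apply, Pi.smul_apply, smul_eq_mul, Pi.star_apply,
      star_mul']
    have : star ε = (starRingEnd ℂ) ε := rfl
    rw [this]
    linear_combination (ξ i * star (ξ j)) * hε2
  have hgX : actM g X = actM g (basePoint d) + s • nullMat ξ := by
    rw [hX, actM, Matrix.mul_add, Matrix.add_mul, Matrix.mul_smul, Matrix.smul_mul, conj_nullMat,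
      hgξ, hnull]
    rfl
  -- Seen from ∞, g is upper triangular with diagonal entries ε = ±1. It preserves the lower right
  -- entry, so the same s serves for the translate of the base point.
  have hcg : ((h.val * actM g (basePoint d) * h.val.conjTranspose) 1 1).re = c := by
    set g' : SL(2, ℂ) := h * toSLC d g * h⁻¹ with hg'
    have hg'e : g'.val.mulVec ![1, 0] = ε • ![1, 0] := by
      rw [← hh, hg', SL2_mul_val, SL2_mul_val, Matrix.mulVec_mulVec]
      have : h.val * (toSLC d g).val * (h⁻¹).val * h.val = h.val * (toSLC d g).val := by
        have e' : h * toSLC d g * h⁻¹ * h = h * toSLC d g := by group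
        rw [← SL2_mul_val, ← SL2_mul_val, ← SL2_mul_val, e']
      rw [this, ← Matrix.mulVec_mulVec, hgξ, Matrix.mulVec_smul]
    have e0 := congrFun hg'e 0
    have e1 := congrFun hg'e 1
    simp [Matrix.mulVec, dotProduct] at e0 e1
    have e11 : g'.val 1 1 = ε := by
      have hd' := g'.prop
      rw [Matrix.det_fin_two, e0, e1, mul_zero, sub_zero] at hd'
      have : ε * ε = 1 := by rw [← sq]; exact hε
      have hε0 : ε ≠ 0 := left_ne_zero_of_mul_eq_one this
      exact mul_left_cancel₀ hε0 (hd'.trans this.symm)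
    have e3 : h.val * actM g (basePoint d) * h.val.conjTranspose =
        g'.val * (h.val * basePoint d * h.val.conjTranspose) * g'.val.conjTranspose := by
      have h4 : g'.val * h.val = h.val * (toSLC d g).val := by
        have e' : g' * h = h * toSLC d g := by rw [hg']; group
        rw [← SL2_mul_val, ← SL2_mul_val, e']
      calc _ = (h.val * (toSLC d g).val) * basePoint d *
            (h.val * (toSLC d g).val).conjTranspose := by
            rw [Matrix.conjTranspose_mul, actM]; simp only [Matrix.mul_assoc]
        _ = _ := by
            rw [← h4, Matrix.conjTranspose_mul]; simp only [Matrix.mul_assoc]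
    rw [e3, hc]
    generalize h.val * basePoint d * h.val.conjTranspose = M
    have : (g'.val * M * g'.val.conjTranspose) 1 1 = M 1 1 := by
      simp only [Matrix.mul_apply, Fin.sum_univ_two, Matrix.conjTranspose_apply, e1, e11]
      have : star ε = (starRingEnd ℂ) ε := rfl
      rw [this]
      simp
      linear_combination (M 1 1) * hε2
    rw [this]
  have hform' := fun v : Wall d => wallForm_horoball hd hh v (key v)
    (posDef_actM (g := g) hb1) hs0 (by rw [hcg]; exact hsc)
  rw [WallSpace.sep_eq_empty hXr (isRegular_actM hXr g)]
  intro v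
  have h1 := hform v
  have h2 := hform' v
  rw [← hgX] at h2
  rw [← hX] at h1
  change 0 < wallForm v.1 X ↔ 0 < wallForm v.1 (actM g X)
  rcases mul_pos_iff.1 h1 with h1 | h1 <;> rcases mul_pos_iff.1 h2 with h2 | h2
  · exact iff_of_true h1.2 h2.2
  · linarith [h1.1, h2.1]
  · linarith [h1.1, h2.1]
  · exact iff_of_false h1.2.not_gt h2.2.not_gt

/-- If a wall passes through the cusp `ξ`, then `ξ` is equivalent to `∞`. -/
theorem exists_lower_zero_of_wall {d : ℕ} (hd : Admissible d) {ξ : Fin 2 → ℂ}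
    (hξ : ∀ i, ξ i ∈ ringO d) {v : Wall d} (hv : wallForm v.1 (nullMat ξ) = 0) :
    ∃ h : SL(2, ringO d), (toSLC d h).val.mulVec ξ 1 = 0 := by
  obtain ⟨k, hk⟩ := v.2
  set η := (toSLC d k⁻¹).val.mulVec ξ with hη
  have hηm : ∀ i, η i ∈ ringO d := by
    intro i
    rw [hη, Matrix.mulVec, dotProduct]
    exact sum_mem fun j _ => mul_mem ((k⁻¹).val i j).2 (hξ j)
  have h1 : wallForm matJ (nullMat η) = 0 := by
    have e : actM k⁻¹ v.1 = matJ := by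
      rw [hk]
      change actM k⁻¹ (actM k matJ) = matJ
      rw [← actM_mul, inv_mul_cancel, actM_one]
    rw [hη, ← conj_nullMat, ← e]
    change wallForm (actM k⁻¹ v.1) (actM k⁻¹ (nullMat ξ)) = 0
    rw [wallForm_actM, hv]
  have h2 : nullMat η = herm (Complex.normSq (η 0)) (Complex.normSq (η 1))
      (η 0 * (starRingEnd ℂ) (η 1)) := by
    ext i j
    fin_cases i <;> fin_cases j <;>
      simp [nullMat, herm, Matrix.vecMulVec_apply, ← Complex.mul_conj, mul_comm]
  rw [h2, wallForm_matJ] at h1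
  have h3 : (η 0 * (starRingEnd ℂ) (η 1)).im = 0 := by linarith
  suffices hs : ∃ h : SL(2, ringO d), (toSLC d h).val.mulVec η 1 = 0 by
    obtain ⟨h, hh⟩ := hs
    refine ⟨h * k⁻¹, ?_⟩
    rw [map_mul, SL2_mul_val, ← Matrix.mulVec_mulVec]
    exact hh
  by_cases h0 : η 1 = 0
  · exact ⟨1, by simpa using h0⟩
  -- The translated cusp is real, hence rational: η₀/η₁ = n/|η₁|². In lowest terms, Bézout's
  -- identity completes (-N', n') to a matrix of SL(2,ℤ) that sends it to ∞.
  obtain ⟨n, hn⟩ := hd.exists_int_of_im_eq_zero (mul_mem (hηm 0) (hd.star_mem (hηm 1))) h3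
  obtain ⟨N, hN⟩ := hd.exists_nat_normSq (hηm 1)
  have hN0 : (N : ℤ) ≠ 0 := by
    intro h
    apply h0
    rw [← Complex.normSq_eq_zero, hN]
    exact_mod_cast h
  have hrel : (N : ℂ) * η 0 = n * η 1 := by
    have e : (starRingEnd ℂ) (η 1) * η 1 = N := by
      rw [mul_comm, Complex.mul_conj, hN]; simp
    rw [← hn, ← e]; ring
  obtain ⟨N', n', hcop, hNe, hne⟩ : ∃ N' n' : ℤ, IsCoprime N' n' ∧
      (N : ℤ) = N' * (Int.gcd N n : ℤ) ∧ n = n' * (Int.gcd N n : ℤ) := by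
    have hg : 0 < Int.gcd N n := Int.gcd_pos_of_ne_zero_left _ hN0
    obtain ⟨m', n', h1, h2, h3⟩ := Int.exists_gcd_one hg
    exact ⟨m', n', Int.isCoprime_iff_gcd_eq_one.2 h1, h2, h3⟩
  have hgpos : ((Int.gcd N n : ℤ) : ℂ) ≠ 0 := by
    have : 0 < Int.gcd N n := Int.gcd_pos_of_ne_zero_left _ hN0
    exact_mod_cast this.ne'
  have hrel' : (N' : ℂ) * η 0 = n' * η 1 := by
    apply mul_left_cancel₀ hgpos
    have e1 : (N : ℂ) = N' * ((Int.gcd N n : ℤ) : ℂ) := by exact_mod_cast congrArg (Int.cast (R := ℂ)) hNe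
    have e2 : (n : ℂ) = n' * ((Int.gcd N n : ℤ) : ℂ) := by
      conv_lhs => rw [hne]
      push_cast; ring
    rw [e1, e2] at hrel
    linear_combination hrel
  obtain ⟨a, b, hab⟩ := hcop
  obtain ⟨m, hm⟩ : ∃ m : SL(2, ringO d), m.val = !![(b : ringO d), (a : ringO d);
      -(N' : ringO d), (n' : ringO d)] := by
    refine ⟨⟨_, ?_⟩, rfl⟩
    rw [Matrix.det_fin_two_of]
    have : ((a * N' + b * n' : ℤ) : ringO d) = 1 := by rw [hab]; simp
    push_cast at this
    linear_combination this
  refine ⟨m, ?_⟩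
  rw [toSLC_val, hm]
  simp [Matrix.mulVec, dotProduct]
  linear_combination -hrel'

/-! ### Parabolic elements -/

/-- The normal form of g has a double eigenvalue l = ±1. By Cayley–Hamilton (g - l)² = 0, so any
nonzero column of g - l is an eigenvector, and its entries are in 𝒪_d. -/
theorem exists_fixed_of_isParabolic {d : ℕ} {g : SL(2, ringO d)} (hg : IsParabolic (spinO d g)) :
    ∃ (ε : ℂ) (ξ : Fin 2 → ℂ), ε ^ 2 = 1 ∧ ξ ≠ 0 ∧ (∀ i, ξ i ∈ ringO d) ∧
      (toSLC d g).val.mulVec ξ = ε • ξ ∧ ∀ l : ℂˣ, toSLC d g ≠ diagC l := by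
  have hnd : ∀ l : ℂˣ, toSLC d g ≠ diagC l := by
    intro l hl
    apply not_isParabolic_diagC l
    rw [← hl]
    exact hg
  obtain ⟨h, l, ⟨-, he⟩ | ⟨hl, z, he⟩⟩ := exists_normal_form (toSLC d g)
  · exfalso
    apply not_isParabolic_diagC l
    rw [← he, map_mul, map_mul, map_inv]
    exact hg.conj _
  set G := toSLC d g with hG
  have hent : ∀ i j, G.val i j ∈ ringO d := fun i j => (g.val i j).2
  have hl' : ((l⁻¹ : ℂˣ) : ℂ) = l := by
    rw [Units.val_inv_eq_inv_val]
    exact (eq_inv_of_mul_eq_one_left (by rw [← sq]; exact hl)).symm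
  have hlm : (l : ℂ) ∈ ringO d := by
    rcases sq_eq_one_iff.1 hl with h | h <;> rw [h]
    · exact one_mem _
    · exact neg_mem (one_mem _)
  have htr : G.val 0 0 + G.val 1 1 = 2 * l := by
    have e1 : (h.val * G.val * (h⁻¹).val).trace = G.val.trace := by
      rw [Matrix.trace_mul_comm, ← Matrix.mul_assoc, ← SL2_mul_val, inv_mul_cancel]
      simp
    rw [← SL2_mul_val, ← SL2_mul_val, he, SL2_mul_val, diagC_val, upperC_val,
      Matrix.trace_fin_two, Matrix.trace_fin_two] at e1
    rw [← e1]
    simp [Matrix.mul_apply, Fin.sum_univ_two, hl']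
    ring
  have hdet : G.val 0 0 * G.val 1 1 - G.val 0 1 * G.val 1 0 = 1 := by
    have := G.prop
    rwa [Matrix.det_fin_two] at this
  -- If the first column of g - l is zero, the second is used; it is nonzero because g is not
  -- scalar.
  by_cases hcol : G.val 0 0 - l = 0 ∧ G.val 1 0 = 0
  · refine ⟨l, ![G.val 0 1, G.val 1 1 - l], hl, ?_, ?_, ?_, hnd⟩
    · intro h0
      have h1 : G.val 0 1 = 0 := by simpa using congrFun h0 0
      have h2 : G.val 1 1 - l = 0 := by simpa using congrFun h0 1
      apply hnd l
      apply SL2_ext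
      rw [diagC_val, hl']
      ext i j
      fin_cases i <;> fin_cases j
      · simpa using sub_eq_zero.1 hcol.1
      · simpa using h1
      · simpa using hcol.2
      · simpa using sub_eq_zero.1 h2
    · intro i
      fin_cases i
      · exact hent 0 1
      · exact sub_mem (hent 1 1) hlm
    · ext i
      fin_cases i <;> simp [Matrix.mulVec, dotProduct, Fin.sum_univ_two]
      · linear_combination G.val 0 1 * htr
      · linear_combination G.val 1 1 * htr - hdet + hl
  · refine ⟨l, ![G.val 0 0 - l, G.val 1 0], hl, ?_, ?_, ?_, hnd⟩
    · intro h0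
      exact hcol ⟨by simpa using congrFun h0 0, by simpa using congrFun h0 1⟩
    · intro i
      fin_cases i
      · exact sub_mem (hent 0 0) hlm
      · exact hent 1 0
    · ext i
      fin_cases i <;> simp [Matrix.mulVec, dotProduct, Fin.sum_univ_two]
      · linear_combination G.val 0 0 * htr - hdet + hl
      · linear_combination G.val 1 0 * htr

theorem toBi_neg {d : ℕ} (g : SL(2, ringO d)) : toBi d (-g) = toBi d g := by
  have h : -g = g * (-1) := by simp
  have hc : toBi d (-1) = 1 := by
    refine (QuotientGroup.eq_one_iff _).2 ?_
    rw [Subgroup.mem_center_iff]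
    intro x
    simp
  rw [h, map_mul, hc, mul_one]

theorem exists_conj_upperO {d : ℕ} (hd : Admissible d) {ξ : Fin 2 → ℂ} (hξ0 : ξ ≠ 0)
    {h g : SL(2, ringO d)} (hh : (toSLC d h).val.mulVec ξ 1 = 0) {ε : ℂ}
    (hg : (toSLC d g).val.mulVec ξ = ε • ξ) :
    ∃ x : ringO d, h * g * h⁻¹ = upperO x ∨ h * g * h⁻¹ = -upperO x := by
  apply eq_upperO_of_lower_zero hd
  set η := (toSLC d h).val.mulVec ξ with hη
  have hinv : (toSLC d h⁻¹).val.mulVec η = ξ := by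
    rw [hη, Matrix.mulVec_mulVec, ← SL2_mul_val, ← map_mul, inv_mul_cancel, map_one]
    exact Matrix.one_mulVec ξ
  have h0 : η 0 ≠ 0 := by
    intro h0
    apply hξ0
    have : η = 0 := by ext i; fin_cases i; exacts [h0, hh]
    rw [← hinv, this, Matrix.mulVec_zero]
  have e : (toSLC d (h * g * h⁻¹)).val.mulVec η = ε • η := by
    rw [map_mul, map_mul, SL2_mul_val, SL2_mul_val, ← Matrix.mulVec_mulVec, hinv,
      ← Matrix.mulVec_mulVec, hg, Matrix.mulVec_smul]
  have e1 := congrFun e 1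
  simp only [Matrix.mulVec, dotProduct, Fin.sum_univ_two, hh, mul_zero, add_zero, Pi.smul_apply,
    smul_eq_mul, mul_eq_zero, h0, or_false] at e1
  exact Subtype.ext e1

theorem bending_upperO {d : ℕ} (ρ : Bi d →* U31) (m n : ℤ) :
    ρ (toBi d (upperO ((m : ringO d) + n * tauO d))) = ρ (tElt d) ^ m * ρ (uElt d) ^ n := by
  have hz : ∀ (x : ringO d) (n : ℤ), upperO ((n : ringO d) * x) = upperO x ^ n := by
    intro x n
    induction n with
    | zero => simp [upperO_zero]
    | succ n ih =>
      rw [zpow_add_one, ← ih, ← upperO_add]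
      congr 1
      push_cast; ring
    | pred n ih =>
      rw [zpow_sub_one, ← ih, ← upperO_neg, ← upperO_add]
      congr 1
      push_cast; ring
  rw [upperO_add, hz, map_mul, map_mul, map_zpow, map_zpow, uElt_eq, tElt_eq, ← map_zpow, ← map_zpow,
    ← map_zpow, ← map_zpow, ← hz 1, mul_one]

/-- The matrices to which the image of the stabilizer of `∞` is conjugate. -/
def cuspMat (x y ζ : ℂ) : Matrix (Fin 4) (Fin 4) ℂ :=
  !![1, -(Real.sqrt 2 * x : ℂ), 0, y - x ^ 2; 0, 1, 0, (Real.sqrt 2 * x : ℂ); 0, 0, ζ, 0; 0, 0, 0, 1]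

/-- The conjugating matrix. -/
def cuspConj (k s : ℂ) : Matrix (Fin 4) (Fin 4) ℂ :=
  !![1, 0, k, 0; 0, 1, 0, 0; 0, 0, 1, s; 0, 0, 0, 1]

/-- The inverse of the conjugating matrix. -/
def cuspConjInv (k s : ℂ) : Matrix (Fin 4) (Fin 4) ℂ :=
  !![1, 0, -k, k * s; 0, 1, 0, 0; 0, 0, 1, -s; 0, 0, 0, 1]

theorem cuspConjInv_mul (k s : ℂ) : cuspConjInv k s * cuspConj k s = 1 := by
  ext i j
  fin_cases i <;> fin_cases j <;> simp [cuspConjInv, cuspConj, Matrix.mul_apply, Fin.sum_univ_four]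

theorem cuspConj_mul (k s : ℂ) : cuspConj k s * cuspConjInv k s = 1 :=
  mul_eq_one_comm.1 (cuspConjInv_mul k s)

/-- With the corner entry written as y - x², the cross term 2xx' of the product is absorbed and y
becomes additive. -/
theorem cuspMat_mul (x y ζ x' y' ζ' : ℂ) :
    cuspMat x y ζ * cuspMat x' y' ζ' = cuspMat (x + x') (y + y') (ζ * ζ') := by
  have h2 := sqrtTwo_sq
  ext i j
  fin_cases i <;> fin_cases j <;> simp [cuspMat, Matrix.mul_apply, Fin.sum_univ_four] <;>
    first | ring1 | linear_combination (-(x * x')) * h2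

theorem cuspMat_one : cuspMat 0 0 1 = 1 := by
  ext i j
  fin_cases i <;> fin_cases j <;> simp [cuspMat]

/-! ### Elements in the normal form of a cusp group. -/

section Cusp

variable {k s : ℂ}

theorem cusp_mul {g g' : U31} {x y ζ x' y' ζ' : ℂ}
    (h : toMat g * cuspConj k s = cuspConj k s * cuspMat x y ζ)
    (h' : toMat g' * cuspConj k s = cuspConj k s * cuspMat x' y' ζ') :
    toMat (g * g') * cuspConj k s = cuspConj k s * cuspMat (x + x') (y + y') (ζ * ζ') := by
  rw [toMat_mul, Matrix.mul_assoc, h', ← Matrix.mul_assoc, h, Matrix.mul_assoc, cuspMat_mul]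

theorem cusp_inv {g : U31} {x y ζ : ℂ} (hζ : ζ ≠ 0)
    (h : toMat g * cuspConj k s = cuspConj k s * cuspMat x y ζ) :
    toMat g⁻¹ * cuspConj k s = cuspConj k s * cuspMat (-x) (-y) ζ⁻¹ := by
  have e : cuspMat x y ζ * cuspMat (-x) (-y) ζ⁻¹ = 1 := by
    rw [cuspMat_mul, mul_inv_cancel₀ hζ, add_neg_cancel, add_neg_cancel, cuspMat_one]
  calc toMat g⁻¹ * cuspConj k s
      = toMat g⁻¹ * (cuspConj k s * (cuspMat x y ζ * cuspMat (-x) (-y) ζ⁻¹)) := by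
        rw [e, Matrix.mul_one]
    _ = (toMat g⁻¹ * toMat g) * cuspConj k s * cuspMat (-x) (-y) ζ⁻¹ := by
        rw [← Matrix.mul_assoc (cuspConj k s), ← h]; simp only [Matrix.mul_assoc]
    _ = _ := by rw [toMat_inv_mul, Matrix.one_mul]

theorem cusp_zpow {g : U31} {x y ζ : ℂ} (hζ : ζ ≠ 0)
    (h : toMat g * cuspConj k s = cuspConj k s * cuspMat x y ζ) (n : ℤ) :
    toMat (g ^ n) * cuspConj k s = cuspConj k s * cuspMat (n * x) (n * y) (ζ ^ n) := by
  induction n with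
  | zero => simp [cuspMat_one]
  | succ n ih =>
    rw [zpow_add_one, zpow_add_one₀ hζ]
    convert cusp_mul ih h using 3 <;> push_cast <;> ring
  | pred n ih =>
    rw [zpow_sub_one, zpow_sub_one₀ hζ]
    convert cusp_mul ih (cusp_inv hζ h) using 3 <;> push_cast <;> ring

theorem cusp_t {g : U31} (hg : toMat g = matT) :
    toMat g * cuspConj k s = cuspConj k s * cuspMat 1 0 1 := by
  rw [hg]
  ext i j
  fin_cases i <;> fin_cases j <;>
    simp [matT, cuspConj, cuspMat, Matrix.mul_apply, Fin.sum_univ_four]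

/-- An eigenvector with nonzero last coordinate has eigenvalue 1. The rows 1 and 0 of the normal
form then give x = 0 and y = 0. -/
theorem isParabolic_of_cusp {g : U31} {x y ζ : ℂ}
    (h : toMat g * cuspConj k s = cuspConj k s * cuspMat x y ζ) (hxy : x ≠ 0 ∨ y ≠ 0) :
    IsParabolic g := by
  apply isParabolic_of_eigen
  · refine ⟨1, ?_⟩
    have e1 : (cuspConj k s).mulVec ![1, 0, 0, 0] = ![1, 0, 0, 0] := by
      ext i; fin_cases i <;> simp [cuspConj, Matrix.mulVec, dotProduct, Fin.sum_univ_four]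
    have e2 : (cuspMat x y ζ).mulVec ![1, 0, 0, 0] = ![1, 0, 0, 0] := by
      ext i; fin_cases i <;> simp [cuspMat, Matrix.mulVec, dotProduct, Fin.sum_univ_four]
    nth_rewrite 1 [← e1]
    rw [Matrix.mulVec_mulVec, h, ← Matrix.mulVec_mulVec, e2, e1, one_smul]
  · intro v μ hv3 hμ
    have h' : cuspConjInv k s * toMat g = cuspMat x y ζ * cuspConjInv k s := by
      calc _ = cuspConjInv k s * (toMat g * cuspConj k s) * cuspConjInv k s := by
            rw [Matrix.mul_assoc, Matrix.mul_assoc, cuspConj_mul, Matrix.mul_one]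
        _ = (cuspConjInv k s * cuspConj k s) * cuspMat x y ζ * cuspConjInv k s := by
            rw [h]; simp only [Matrix.mul_assoc]
        _ = _ := by rw [cuspConjInv_mul, Matrix.one_mul]
    set w := (cuspConjInv k s).mulVec v with hw
    have hw3 : w 3 = v 3 := by
      simp [hw, cuspConjInv, dotProduct, Fin.sum_univ_four]
    have he : (cuspMat x y ζ).mulVec w = μ • w := by
      rw [hw, Matrix.mulVec_mulVec, ← h', ← Matrix.mulVec_mulVec, hμ, Matrix.mulVec_smul]
    have hne : w 3 ≠ 0 := by rwa [hw3]
    have e3 := congrFun he 3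
    have e1 := congrFun he 1
    have e0 := congrFun he 0
    simp [cuspMat, Matrix.mulVec, dotProduct, Fin.sum_univ_four] at e0 e1 e3
    have hμ1 : μ = 1 := by
      have : (μ - 1) * w 3 = 0 := by linear_combination -e3
      exact sub_eq_zero.1 ((mul_eq_zero.1 this).resolve_right hne)
    subst hμ1
    have hx : x = 0 := by
      have : (Real.sqrt 2 : ℂ) * x * w 3 = 0 := by linear_combination e1
      have := (mul_eq_zero.1 this).resolve_right hne
      exact (mul_eq_zero.1 this).resolve_left sqrtTwo_ne
    subst hx
    have hy : y = 0 := by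
      have : y * w 3 = 0 := by linear_combination e0
      exact (mul_eq_zero.1 this).resolve_right hne
    simp [hy] at hxy

end Cusp

/-- The slope of the vertical translations in the image of the stabilizer of `∞`. -/
def cuspSlope (d : ℕ) (u : ℂ) : ℂ := -((delta d : ℂ) ^ 2 * (1 + u)) / (1 - u)

theorem cuspSlope_ne_zero {d : ℕ} (hd : Admissible d) {u : ℂ} (h1 : u ≠ 1) (h2 : u ≠ -1) :
    cuspSlope d u ≠ 0 := by
  have hδ : (delta d : ℂ) ≠ 0 := by exact_mod_cast hd.delta_pos.ne'
  have h1' : 1 - u ≠ 0 := sub_ne_zero.2 h1.symm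
  have h2' : 1 + u ≠ 0 := fun h => h2 (by linear_combination h)
  unfold cuspSlope
  exact div_ne_zero (neg_ne_zero.2 (mul_ne_zero (pow_ne_zero 2 hδ) h2')) h1'

/-- For u ≠ 1 the eigenline of U_u with eigenvalue u splits off. The conjugation that splits it
leaves T₁ in normal form, so both generators are normalized at once. -/
theorem exists_cuspConj {d : ℕ} (hd : Admissible d) {u : Circle} {ρ : Bi d →* U31}
    (h : IsBending d u ρ) (h1 : (u : ℂ) ≠ 1) :
    ∃ k s : ℂ, ∀ m n : ℤ, toMat (ρ (tElt d) ^ m * ρ (uElt d) ^ n) * cuspConj k s =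
      cuspConj k s * cuspMat (m + n * (tau d).re) (n * cuspSlope d u) ((u : ℂ) ^ n) := by
  have h1' : (u : ℂ) - 1 ≠ 0 := sub_ne_zero.2 h1
  have h1'' : 1 - (u : ℂ) ≠ 0 := sub_ne_zero.2 h1.symm
  -- Solutions of k(u - 1) = √2 δ and s(1 - u) = -u√2 δ, the conditions at the entries (0,2) and
  -- (2,3).
  refine ⟨Real.sqrt 2 * delta d / (u - 1), -(u * (Real.sqrt 2 * delta d)) / (1 - u), fun m n => ?_⟩
  have ht := cusp_t (k := Real.sqrt 2 * delta d / (u - 1))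
    (s := -(u * (Real.sqrt 2 * delta d)) / (1 - u)) (bending_t hd h)
  have hu : toMat (ρ (uElt d)) * cuspConj (Real.sqrt 2 * delta d / (u - 1))
      (-(u * (Real.sqrt 2 * delta d)) / (1 - u)) =
      cuspConj (Real.sqrt 2 * delta d / (u - 1)) (-(u * (Real.sqrt 2 * delta d)) / (1 - u)) *
        cuspMat (tau d).re (cuspSlope d u) u := by
    rw [bending_u h, ← matZ3_mul_transMat_tau]
    have hδ : (tau d).im = delta d := rfl
    have h2 := sqrtTwo_sq
    rw [hδ]
    ext i j
    fin_cases i <;> fin_cases j <;>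
      simp [matZ3, transMat, cuspConj, cuspMat, cuspSlope, Matrix.mul_apply,
        Fin.sum_univ_four]
    · field_simp
      ring
    · field_simp
      rw [h2]
      ring
    · field_simp
      ring
  have := cusp_mul (cusp_zpow one_ne_zero ht m) (cusp_zpow u.coe_ne_zero hu n)
  simpa using this

theorem eq_rho1_of_isBending_one {d : ℕ} (hd : Admissible d) {ρ : Bi d →* U31} {u : Circle}
    (h : IsBending d u ρ) (h1 : (u : ℂ) = 1) : ρ = rho1 d := by
  have h' : IsBending d u (rho1 d) := by
    refine ⟨fun _ _ => rfl, ?_⟩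
    have : matZ3 u = 1 := by
      ext i j
      fin_cases i <;> fin_cases j <;> simp [matZ3, h1]
    rw [this, Matrix.one_mul]
  rw [eq_bendBi hd h, ← eq_bendBi hd h']

/-- Elements of the stabilizer of a cusp on a wall are conjugate to translations. -/
theorem exists_conj_translation {d : ℕ} (hd : Admissible d) (ρ : Bi d →* U31)
    {ξ : Fin 2 → ℂ} (hξ0 : ξ ≠ 0) {h g : SL(2, ringO d)}
    (hh : (toSLC d h).val.mulVec ξ 1 = 0) {ε : ℂ} (hg : (toSLC d g).val.mulVec ξ = ε • ξ) :
    ∃ m n : ℤ, (ρ (toBi d g) = (ρ (toBi d h))⁻¹ * (ρ (tElt d) ^ m * ρ (uElt d) ^ n) *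
      (ρ (toBi d h))⁻¹⁻¹) ∧ toBi d g = (toBi d h)⁻¹ * toBi d (upperO ((m : ringO d) + n * tauO d)) *
        toBi d h := by
  obtain ⟨x, hx⟩ := exists_conj_upperO hd hξ0 hh hg
  obtain ⟨m, n, hmn⟩ := exists_int_tau_of_mem hd.squarefree x.2
  have hx' : x = (m : ringO d) + n * tauO d := by
    apply Subtype.ext; rw [hmn]; simp [tauO]
  have e : toBi d h * toBi d g * (toBi d h)⁻¹ = toBi d (upperO x) := by
    rw [← map_inv, ← map_mul, ← map_mul]
    rcases hx with h | h <;> rw [h]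
    exact toBi_neg _
  have e2 : toBi d g = (toBi d h)⁻¹ * toBi d (upperO x) * toBi d h := by rw [← e]; group
  refine ⟨m, n, ?_, by rw [e2, hx']⟩
  rw [← bending_upperO, ← hx', e2]
  simp only [map_mul, map_inv, inv_inv]

theorem isParabolic_bending {d : ℕ} (hd : Admissible d) {u : Circle} {ρ : Bi d →* U31}
    (h : IsBending d u ρ) (hu : (u : ℂ) ≠ -1) {γ : Bi d} (hγ : IsParabolic (rho1 d γ)) :
    IsParabolic (ρ γ) := by
  by_cases h1 : (u : ℂ) = 1
  · rwa [eq_rho1_of_isBending_one hd h h1]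
  obtain ⟨g, rfl⟩ := toBi_surjective d γ
  obtain ⟨ε, ξ, hε, hξ0, hξ, hgξ, hnd⟩ := exists_fixed_of_isParabolic (g := g) hγ
  -- Without a wall through the cusp, ρ(g) is conjugate to ρ₁(g). Otherwise the cusp is equivalent
  -- to ∞ and the normal form decides: its parameters m + n Re τ and n · slope both vanish only for
  -- the identity.
  by_cases hno : ∀ v : Wall d, wallForm v.1 (nullMat ξ) ≠ 0
  · obtain ⟨k, hk⟩ := exists_stab_of_no_wall hd hξ hξ0 hno
    rw [conj_of_mem_chamberStab hd h (hk g ⟨ε, hε, hgξ⟩)]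
    exact hγ.conj _
  · push Not at hno
    obtain ⟨v, hv⟩ := hno
    obtain ⟨k, hk⟩ := exists_lower_zero_of_wall hd hξ hv
    obtain ⟨m, n, hmn, hmn'⟩ := exists_conj_translation hd ρ hξ0 hk hgξ
    rw [hmn]
    apply IsParabolic.conj
    obtain ⟨a, s, has⟩ := exists_cuspConj hd h h1
    refine isParabolic_of_cusp (has m n) ?_
    by_contra hcon
    push Not at hcon
    obtain ⟨hx, hy⟩ := hcon
    have hn : n = 0 := by
      exact_mod_cast (mul_eq_zero.1 hy).resolve_right (cuspSlope_ne_zero hd h1 hu)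
    subst hn
    have hm : m = 0 := by simpa using hx
    subst hm
    have : toBi d g = 1 := by
      rw [hmn']
      simp [upperO_zero]
    rw [this, map_one] at hγ
    obtain ⟨p, hp⟩ : ∃ p : ℙ ℂ (Fin 4 → ℂ), p ∈ HC3 := by
      have n1 : (![1, 0, 0, -1] : Fin 4 → ℂ) ≠ 0 := fun h => by simpa using congrFun h 0
      refine ⟨Projectivization.mk ℂ _ n1, ?_⟩
      rw [mk_mem_HC3, normForm_apply]
      simp
    exact hγ.1 p hp (one_smul _ p)

theorem isParabolicPreserving_bending {d : ℕ} (hd : Admissible d) {u : Circle} {ρ : Bi d →* U31}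
    (h : IsBending d u ρ) (hu : (u : ℂ) ≠ -1) : IsParabolicPreserving (rho1 d) ρ :=
  ⟨fun _ hγ => isParabolic_bending hd h hu hγ, fun _ hγ => isBoundaryElliptic_bending hd h hγ⟩

/-! ### Discreteness of the images of the parabolic subgroups -/

theorem continuous_toMat : Continuous toMat :=
  Units.continuous_val.comp continuous_subtype_val

theorem discreteTopology_of_nhds_one {H : Subgroup U31} {V : Set (Matrix (Fin 4) (Fin 4) ℂ)}
    (hV : IsOpen V) (h1 : 1 ∈ V) (h : ∀ g ∈ H, toMat g ∈ V → g = 1) : DiscreteTopology H := by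
  apply discreteTopology_of_isOpen_singleton_one
  have : ({1} : Set H) = (fun g : H => toMat g.1) ⁻¹' V := by
    ext g
    constructor
    · rintro rfl
      exact h1
    · intro hg
      exact Subtype.ext (h g.1 g.2 hg)
  rw [this]
  exact hV.preimage (continuous_toMat.comp continuous_subtype_val)

theorem toMat_spinU_corner (g : SL(2, ℂ)) :
    toMat (spinU g) 3 0 = -(Complex.normSq (g.val 1 0) : ℂ) ∧
      toMat (spinU g) 0 3 = -(Complex.normSq (g.val 0 1) : ℂ) := by
  have h1 := hermCoord_spinU g ![1, 0, 0, 0]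
  have h2 := hermCoord_spinU g ![0, 0, 0, 1]
  rw [hermCoord_apply, hermCoord_apply] at h1 h2
  have e1 := congrFun (congrFun h1 1) 1
  have e2 := congrFun (congrFun h2 0) 0
  simp [Matrix.mulVec, dotProduct, Fin.sum_univ_four, Matrix.mul_apply, Fin.sum_univ_two] at e1 e2
  rw [Complex.mul_conj] at e1 e2
  exact ⟨by rw [← e1, neg_neg], e2⟩

/-- The two corners are minus the norms of the off-diagonal entries of g, hence integers. If both
are small, g is diagonal with unit entries, that is ±1. -/
theorem spinO_eq_one_of_corner {d : ℕ} (hd : Admissible d) {g : SL(2, ringO d)}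
    (h1 : ‖toMat (spinO d g) 3 0‖ < 1) (h2 : ‖toMat (spinO d g) 0 3‖ < 1) : spinO d g = 1 := by
  obtain ⟨e1, e2⟩ := toMat_spinU_corner (toSLC d g)
  change ‖toMat (spinU (toSLC d g)) 3 0‖ < 1 at h1
  change ‖toMat (spinU (toSLC d g)) 0 3‖ < 1 at h2
  have key : ∀ i j, ‖-(Complex.normSq ((toSLC d g).val i j) : ℂ)‖ < 1 → g.val i j = 0 := by
    intro i j hij
    obtain ⟨n, hn⟩ := hd.exists_nat_normSq (g.val i j).2
    have e : (toSLC d g).val i j = g.val i j := rfl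
    rw [e, hn] at hij
    simp at hij
    apply Subtype.ext
    rw [hij] at hn
    simpa using hn
  rw [e1] at h1
  rw [e2] at h2
  have h10 := key _ _ h1
  have h01 := key _ _ h2
  rw [← rho1_toBi]
  obtain ⟨x, hx⟩ := eq_upperO_of_lower_zero hd h10
  have hx0 : x = 0 := by
    rcases hx with h | h
    · rw [h] at h01; simpa [upperO] using h01
    · rw [h] at h01
      have h01 : -x = 0 := h01
      exact neg_eq_zero.1 h01
  rw [hx0, upperO_zero] at hx
  have : toBi d g = 1 := by
    rcases hx with h | h <;> rw [h]
    · exact map_one _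
    · rw [toBi_neg, map_one]
  rw [this, map_one]

theorem discreteTopology_of_conj_rho1 {d : ℕ} (hd : Admissible d) {H : Subgroup U31} (k : U31)
    (h : ∀ g ∈ H, ∃ γ, g = k * rho1 d γ * k⁻¹) : DiscreteTopology H := by
  set f : Matrix (Fin 4) (Fin 4) ℂ → Matrix (Fin 4) (Fin 4) ℂ :=
    fun M => toMat k⁻¹ * M * toMat k with hf
  have hfc : Continuous f := by fun_prop
  clear_value f
  refine discreteTopology_of_nhds_one (V := {M | ‖f M 3 0‖ < 1 ∧ ‖f M 0 3‖ < 1}) ?_ ?_ ?_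
  · exact (isOpen_lt (hfc.matrix_elem 3 0).norm continuous_const).inter
      (isOpen_lt (hfc.matrix_elem 0 3).norm continuous_const)
  · have : f 1 = 1 := by rw [hf]; simp [toMat_inv_mul]
    simp [this]
  · rintro g hg ⟨h1, h2⟩
    obtain ⟨γ, hγ⟩ := h g hg
    obtain ⟨g', rfl⟩ := toBi_surjective d γ
    have : f (toMat g) = toMat (spinO d g') := by
      rw [hf]
      change toMat k⁻¹ * toMat g * toMat k = _
      rw [← toMat_mul, ← toMat_mul, hγ, ← rho1_toBi]
      congr 1
      group
    rw [this] at h1 h2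
    rw [hγ, rho1_toBi, spinO_eq_one_of_corner hd h1 h2]
    simp

/-- In the normal form the entry (1,3) is √2 m, and for m = 0 the entry (0,3) is nc. Near the
identity both integers vanish. -/
theorem discreteTopology_of_conj_cusp {H : Subgroup U31} (κ : U31) {k s c : ℂ} (hc : c ≠ 0)
    (h : ∀ g ∈ H, ∃ (g' : U31) (m n : ℤ) (ζ : ℂ), g = κ * g' * κ⁻¹ ∧
      toMat g' * cuspConj k s = cuspConj k s * cuspMat m (n * c) ζ ∧ (m = 0 → n = 0 → g' = 1)) :
    DiscreteTopology H := by
  obtain ⟨f, hf⟩ : ∃ f : Matrix (Fin 4) (Fin 4) ℂ → Matrix (Fin 4) (Fin 4) ℂ,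
      f = fun M => cuspConjInv k s * (toMat κ⁻¹ * M * toMat κ) * cuspConj k s := ⟨_, rfl⟩
  have hfc : Continuous f := by
    rw [hf]
    exact (continuous_const.matrix_mul ((continuous_const.matrix_mul continuous_id).matrix_mul
      continuous_const)).matrix_mul continuous_const
  have h13 : IsOpen {M | ‖f M 1 3‖ < 1} :=
    isOpen_lt (hfc.matrix_elem 1 3).norm continuous_const
  have h03 : IsOpen {M | ‖f M 0 3‖ < ‖c‖} :=
    isOpen_lt (hfc.matrix_elem 0 3).norm continuous_const
  refine discreteTopology_of_nhds_one (h13.inter h03) ?_ ?_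
  · have : f 1 = 1 := by rw [hf]; simp [toMat_inv_mul, cuspConjInv_mul]
    simp [this, hc]
  · rintro g hg ⟨h1, h2⟩
    obtain ⟨g', m, n, ζ, hg', hE, hone⟩ := h g hg
    have : f (toMat g) = cuspMat m (n * c) ζ := by
      rw [hf]
      change cuspConjInv k s * (toMat κ⁻¹ * toMat g * toMat κ) * cuspConj k s = _
      have e : κ⁻¹ * g * κ = g' := by rw [hg']; group
      rw [← toMat_mul, ← toMat_mul, e, Matrix.mul_assoc, hE, ← Matrix.mul_assoc, cuspConjInv_mul,
        Matrix.one_mul]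
    replace h1 : ‖f (toMat g) 1 3‖ < 1 := h1
    replace h2 : ‖f (toMat g) 0 3‖ < ‖c‖ := h2
    rw [this] at h1 h2
    have hsm : ∀ z : ℤ, |(z : ℝ)| < 1 → z = 0 := fun z hz =>
      Int.abs_lt_one_iff.1 (by exact_mod_cast hz)
    have hm : m = 0 := by
      apply hsm
      simp [cuspMat] at h1
      have h3 : (1 : ℝ) ≤ |Real.sqrt 2| := by
        rw [abs_of_nonneg (Real.sqrt_nonneg 2)]
        exact Real.one_le_sqrt.2 (by norm_num)
      nlinarith [abs_nonneg (m : ℝ)]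
    have hn : n = 0 := by
      apply hsm
      have hc' := norm_pos_iff.2 hc
      simp [cuspMat, hm] at h2
      nlinarith
    rw [hg', hone hm hn]
    simp

theorem exists_eigen_of_fixes {d : ℕ} {g : SL(2, ringO d)} {ξ : Fin 2 → ℂ} (hξ0 : ξ ≠ 0) {μ : ℂ}
    (h : (toSLC d g).val * nullMat ξ * (toSLC d g).val.conjTranspose = μ • nullMat ξ) :
    ∃ l : ℂ, (toSLC d g).val.mulVec ξ = l • ξ := by
  rw [conj_nullMat] at h
  set η := (toSLC d g).val.mulVec ξ with hη
  have hη0 : η ≠ 0 := by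
    intro h0
    apply hξ0
    have : (toSLC d g⁻¹).val.mulVec η = ξ := by
      rw [hη, Matrix.mulVec_mulVec, ← SL2_mul_val, ← map_mul, inv_mul_cancel, map_one]
      exact Matrix.one_mulVec ξ
    rw [← this, h0, Matrix.mulVec_zero]
  obtain ⟨j, hj⟩ : ∃ j, η j ≠ 0 := by
    by_contra hcon
    push Not at hcon
    exact hη0 (funext hcon)
  have hj' : (starRingEnd ℂ) (η j) ≠ 0 := (map_ne_zero _).2 hj
  refine ⟨μ * (starRingEnd ℂ) (ξ j) / (starRingEnd ℂ) (η j), ?_⟩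
  ext i
  have e := congrFun (congrFun h i) j
  simp only [nullMat, Matrix.vecMulVec_apply, Matrix.smul_apply, smul_eq_mul, Pi.star_apply,
    RCLike.star_def] at e
  rw [Pi.smul_apply, smul_eq_mul]
  field_simp
  linear_combination e

/-- The eigenvalue is in the quadratic field, being a quotient of coordinates, and is integral as a
root of the characteristic polynomial. So it is a unit of 𝒪_d. -/
theorem sq_eq_one_of_eigen {d : ℕ} (hd : Admissible d) {g : SL(2, ringO d)} {ξ : Fin 2 → ℂ}
    (hξ0 : ξ ≠ 0) (hξ : ∀ i, ξ i ∈ ringO d) {l : ℂ}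
    (h : (toSLC d g).val.mulVec ξ = l • ξ) : l ^ 2 = 1 := by
  set G := toSLC d g with hG
  have hent : ∀ i j, G.val i j ∈ ringO d := fun i j => (g.val i j).2
  obtain ⟨j, hj⟩ : ∃ j, ξ j ≠ 0 := by
    by_contra hcon
    push Not at hcon
    exact hξ0 (funext hcon)
  have hK : ∀ {x}, x ∈ ringO d → x ∈ quadField d := fun hx => (Subring.mem_inf.1 hx).2
  have hlK : l ∈ quadField d := by
    have e : l = G.val.mulVec ξ j / ξ j := by
      rw [h, Pi.smul_apply, smul_eq_mul, mul_div_cancel_right₀ _ hj]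
    rw [e]
    refine div_mem (hK ?_) (hK (hξ j))
    rw [Matrix.mulVec, dotProduct]
    exact sum_mem fun i _ => mul_mem (hent j i) (hξ i)
  have hdet : G.val 0 0 * G.val 1 1 - G.val 0 1 * G.val 1 0 = 1 := by
    have := G.prop
    rwa [Matrix.det_fin_two] at this
  have hchar : l ^ 2 - (G.val 0 0 + G.val 1 1) * l + 1 = 0 := by
    have e0 := congrFun h 0
    have e1 := congrFun h 1
    simp [Matrix.mulVec, dotProduct, Fin.sum_univ_two] at e0 e1
    have : ∀ i, (l ^ 2 - (G.val 0 0 + G.val 1 1) * l + 1) * ξ i = 0 := by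
      intro i
      fin_cases i
      · change (l ^ 2 - (G.val 0 0 + G.val 1 1) * l + 1) * ξ 0 = 0
        linear_combination (-l + G.val 1 1) * e0 - G.val 0 1 * e1 - ξ 0 * hdet
      · change (l ^ 2 - (G.val 0 0 + G.val 1 1) * l + 1) * ξ 1 = 0
        linear_combination (-l + G.val 0 0) * e1 - G.val 1 0 * e0 - ξ 1 * hdet
    exact (mul_eq_zero.1 (this j)).resolve_right hj
  have hint : IsIntegral ℤ l := by
    have hG' : ∀ i j, G.val i j ∈ integralClosure ℤ ℂ := fun i j =>
      (Subring.mem_inf.1 (hent i j)).1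
    have : IsIntegral (integralClosure ℤ ℂ) l := by
      set t : integralClosure ℤ ℂ := ⟨G.val 0 0 + G.val 1 1, add_mem (hG' 0 0) (hG' 1 1)⟩ with ht
      refine ⟨Polynomial.X ^ 2 + (-Polynomial.C t * Polynomial.X + 1), ?_, ?_⟩
      · apply Polynomial.monic_X_pow_add
        compute_degree!
      · have e : (algebraMap (integralClosure ℤ ℂ) ℂ) t = G.val 0 0 + G.val 1 1 := rfl
        simp [e]
        linear_combination hchar
    exact isIntegral_trans _ this
  have hl : l ∈ ringO d := Subring.mem_inf.2 ⟨hint, hlK⟩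
  have hinv : (⟨l, hl⟩ : ringO d) * (⟨G.val 0 0 + G.val 1 1, add_mem (hent 0 0) (hent 1 1)⟩ -
      ⟨l, hl⟩) = 1 := by
    apply Subtype.ext
    change l * (G.val 0 0 + G.val 1 1 - l) = 1
    linear_combination -hchar
  rcases hd.eq_one_or_of_mul hinv with h | h
  · have : l = 1 := congrArg Subtype.val h
    rw [this, one_pow]
  · have : l = -1 := congrArg Subtype.val h
    rw [this]; norm_num

/-- The fixed point of a parabolic element is unique, so p is the point of ξξ* and its stabilizer
acts on ξ by ±1. If no wall passes through ξ, the image is conjugate into that of ρ₁. Otherwise it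
is in the normal form, where Re τ = 0 makes x = m an integer. -/
theorem discreteTopology_map_bending {d : ℕ} (hd : Admissible d) (hmod : (tau d).re = 0)
    {u : Circle} {ρ : Bi d →* U31} (h : IsBending d u ρ) (hu : (u : ℂ) ≠ -1) {P : Subgroup (Bi d)}
    (hP : IsParabolicSubgroup (rho1 d) P) : DiscreteTopology (P.map ρ) := by
  by_cases h1 : (u : ℂ) = 1
  · apply discreteTopology_of_conj_rho1 hd 1
    rintro _ ⟨γ, -, rfl⟩
    exact ⟨γ, by rw [eq_rho1_of_isBending_one hd h h1]; simp⟩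
  obtain ⟨p, hp, ⟨γ₀, hγ₀, hfix⟩, rfl⟩ := hP
  obtain ⟨g₀, rfl⟩ := toBi_surjective d γ₀
  obtain ⟨ε, ξ, hε, hξ0, hξ, hgξ, -⟩ := exists_fixed_of_isParabolic (g := g₀) hγ₀
  have hε2 : ε * (starRingEnd ℂ) ε = 1 := by
    rcases sq_eq_one_iff.1 hε with h | h <;> simp [h]
  set w : Fin 4 → ℂ := hermCoord.symm (nullMat ξ) with hw
  have hwξ : hermCoord w = nullMat ξ := LinearEquiv.apply_symm_apply _ _
  have hw0 : w ≠ 0 := by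
    intro h0
    rw [h0, map_zero] at hwξ
    apply hξ0
    ext i
    have := congrFun (congrFun hwξ i) i
    simp [nullMat, Matrix.vecMulVec_apply] at this
    exact this
  have hp' : Projectivization.mk ℂ w hw0 = p := by
    refine hγ₀.2.unique ⟨?_, ?_⟩ ⟨hp, hfix⟩
    · rw [mk_mem_boundary]
      unfold normForm
      rw [form_eq_trace, hwξ]
      have e : (nullMat ξ).conjTranspose = nullMat ξ := by
        ext i j; simp [nullMat, Matrix.vecMulVec_apply, mul_comm]
      have e2 : (nullMat ξ).det = 0 := by
        rw [Matrix.det_fin_two]; simp [nullMat, Matrix.vecMulVec_apply]; ring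
      rw [e, Matrix.mul_adjugate, e2]
      simp
    · rw [fixes_mk]
      refine ⟨1, ?_⟩
      rw [rho1_toBi]
      refine spinU_eigen_iff.2 ?_
      rw [hwξ, conj_nullMat, hgξ, one_smul]
      ext i j
      simp only [nullMat, Matrix.vecMulVec_apply, Pi.smul_apply, smul_eq_mul, Pi.star_apply,
        star_mul', RCLike.star_def]
      linear_combination (ξ i * (starRingEnd ℂ) (ξ j)) * hε2
  have hstab : ∀ g : SL(2, ringO d), toBi d g ∈ pointStab (rho1 d) p →
      ∃ l : ℂ, l ^ 2 = 1 ∧ (toSLC d g).val.mulVec ξ = l • ξ := by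
    intro g hg
    have hg' : Fixes (rho1 d (toBi d g)) p := hg
    rw [← hp', fixes_mk] at hg'
    obtain ⟨μ, hμ⟩ := hg'
    have := spinU_eigen_iff.1 hμ
    rw [hwξ] at this
    obtain ⟨l, hl⟩ := exists_eigen_of_fixes hξ0 this
    exact ⟨l, sq_eq_one_of_eigen hd hξ0 hξ hl, hl⟩
  by_cases hno : ∀ v : Wall d, wallForm v.1 (nullMat ξ) ≠ 0
  · obtain ⟨k, hk⟩ := exists_stab_of_no_wall hd hξ hξ0 hno
    apply discreteTopology_of_conj_rho1 hd (ρ (toBi d k) * (rho1 d (toBi d k))⁻¹)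
    rintro _ ⟨γ, hγ, rfl⟩
    obtain ⟨g, rfl⟩ := toBi_surjective d γ
    exact ⟨_, conj_of_mem_chamberStab hd h (hk g (hstab g hγ))⟩
  · push Not at hno
    obtain ⟨v, hv⟩ := hno
    obtain ⟨k, hk⟩ := exists_lower_zero_of_wall hd hξ hv
    obtain ⟨a, s, has⟩ := exists_cuspConj hd h h1
    apply discreteTopology_of_conj_cusp (ρ (toBi d k))⁻¹ (cuspSlope_ne_zero hd h1 hu) (k := a)
      (s := s)
    rintro _ ⟨γ, hγ, rfl⟩
    obtain ⟨g, rfl⟩ := toBi_surjective d γ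
    obtain ⟨l, -, hl⟩ := hstab g hγ
    obtain ⟨m, n, hmn, -⟩ := exists_conj_translation hd ρ hξ0 hk hl
    refine ⟨_, m, n, (u : ℂ) ^ n, hmn, ?_, ?_⟩
    · have := has m n
      rwa [hmod, Complex.ofReal_zero, mul_zero, add_zero] at this
    · rintro rfl rfl
      simp

theorem isStronglyParabolicPreserving_bending {d : ℕ} (hd : Admissible d)
    (hmod : d % 4 = 1 ∨ d % 4 = 2) {u : Circle} {ρ : Bi d →* U31} (h : IsBending d u ρ)
    (hu : (u : ℂ) ≠ -1) : IsStronglyParabolicPreserving (rho1 d) ρ := by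
  refine ⟨isParabolicPreserving_bending hd h hu, fun P hP =>
    discreteTopology_map_bending hd ?_ h hu hP⟩
  rw [tau_re, if_neg (by omega)]

/-! ### Generation of `SU(3,1)` by the Heisenberg group and a Weyl element -/

/-- The elements of the Heisenberg group, the unipotent radical of the stabilizer of `∞`. -/
def heisMat (v w b : ℂ) : Matrix (Fin 4) (Fin 4) ℂ :=
  !![1, -(starRingEnd ℂ) v, -(starRingEnd ℂ) w, b; 0, 1, 0, v; 0, 0, 1, w; 0, 0, 0, 1]

/-- The condition under which `heisMat v w b` is in `U(3,1)`. -/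
def IsHeis (v w b : ℂ) : Prop :=
  b + (starRingEnd ℂ) b = -(v * (starRingEnd ℂ) v + w * (starRingEnd ℂ) w)

/-- `heisMat v w b` as an element of `U(3,1)`. -/
def heisU {v w b : ℂ} (h : IsHeis v w b) : U31 := mkU31 (heisMat v w b) (by
  unfold IsHeis at h
  ext i j
  fin_cases i <;> fin_cases j <;>
    simp [heisMat, siegelJ, Matrix.mul_apply, Fin.sum_univ_four, Matrix.conjTranspose_apply]
  linear_combination h)

@[simp] theorem toMat_heisU {v w b : ℂ} (h : IsHeis v w b) : toMat (heisU h) = heisMat v w b := rfl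

/-- The matrix of a Weyl element of `SU(3,1)`. -/
def weylMat : Matrix (Fin 4) (Fin 4) ℂ :=
  !![0, 0, 0, Complex.I; 0, 1, 0, 0; 0, 0, 1, 0; Complex.I, 0, 0, 0]

/-- A Weyl element of `SU(3,1)`. -/
def weylU : U31 := mkU31 weylMat (by
  ext i j
  fin_cases i <;> fin_cases j <;>
    simp [weylMat, siegelJ, Matrix.mul_apply, Fin.sum_univ_four, Matrix.conjTranspose_apply])

@[simp] theorem toMat_weylU : toMat weylU = weylMat := rfl

/-- Block diagonal matrices. -/
def blockMat (c p q r s k : ℂ) : Matrix (Fin 4) (Fin 4) ℂ :=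
  !![c, 0, 0, 0; 0, p, q, 0; 0, r, s, 0; 0, 0, 0, k]

theorem toMat_mem_apply (g : U31) (i j : Fin 4) :
    (starRingEnd ℂ) (toMat g 0 i) * toMat g 3 j + (starRingEnd ℂ) (toMat g 1 i) * toMat g 1 j +
      (starRingEnd ℂ) (toMat g 2 i) * toMat g 2 j + (starRingEnd ℂ) (toMat g 3 i) * toMat g 0 j =
      siegelJ i j := by
  rw [← congrFun (congrFun (toMat_mem g) i) j]
  simp [siegelJ, Matrix.mul_apply, Fin.sum_univ_four, Matrix.conjTranspose_apply]
  ring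

/-- Such a P fixes ∞. Unitarity clears the rest of the last row, and a Heisenberg translation clears
the last column; unitarity again clears the first row. -/
theorem exists_heis_mul_eq_block {P : U31} (h1 : toMat P 1 0 = 0) (h2 : toMat P 2 0 = 0)
    (h3 : toMat P 3 0 = 0) : ∃ (v w b : ℂ) (h : IsHeis v w b),
      toMat (heisU h * P) = blockMat (toMat P 0 0) (toMat P 1 1) (toMat P 1 2) (toMat P 2 1)
        (toMat P 2 2) (toMat P 3 3) := by
  have u01 := toMat_mem_apply P 0 1
  have u02 := toMat_mem_apply P 0 2
  have u03 := toMat_mem_apply P 0 3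
  have u33 := toMat_mem_apply P 3 3
  have u13 := toMat_mem_apply P 1 3
  have u23 := toMat_mem_apply P 2 3
  simp only [h1, h2, h3, map_zero, zero_mul, add_zero] at u01 u02 u03
  simp only [siegelJ, Matrix.of_apply, Matrix.cons_val_zero, Matrix.cons_val_one, Matrix.cons_val',
    Matrix.cons_val, mul_eq_zero, map_eq_zero] at u01 u02 u03 u33 u13 u23
  have hc : toMat P 0 0 ≠ 0 := by
    intro h; rw [h] at u03; simp at u03
  have hk : toMat P 3 3 ≠ 0 := right_ne_zero_of_mul_eq_one u03
  have hk' : (starRingEnd ℂ) (toMat P 3 3) ≠ 0 := (map_ne_zero _).2 hk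
  have e31 := u01.resolve_left hc
  have e32 := u02.resolve_left hc
  rw [e31] at u13
  rw [e32] at u23
  simp only [map_zero, zero_mul, add_zero] at u13 u23
  set k := toMat P 3 3 with hkdef
  set v := toMat P 1 3 with hv
  set w := toMat P 2 3 with hw
  set s := toMat P 0 3 with hs
  have hconj13 : toMat P 0 1 * (starRingEnd ℂ) k + toMat P 1 1 * (starRingEnd ℂ) v +
      toMat P 2 1 * (starRingEnd ℂ) w = 0 := by
    have := congrArg (starRingEnd ℂ) u13
    simpa using this
  have hconj23 : toMat P 0 2 * (starRingEnd ℂ) k + toMat P 1 2 * (starRingEnd ℂ) v +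
      toMat P 2 2 * (starRingEnd ℂ) w = 0 := by
    have := congrArg (starRingEnd ℂ) u23
    simpa using this
  have hheis : IsHeis (-(v / k)) (-(w / k)) ((starRingEnd ℂ) (s / k)) := by
    unfold IsHeis
    simp only [map_neg, map_div₀, Complex.conj_conj]
    field_simp
    linear_combination u33
  refine ⟨_, _, _, hheis, ?_⟩
  rw [toMat_mul, toMat_heisU]
  ext i j
  fin_cases i <;> fin_cases j <;>
    simp [heisMat, blockMat, Matrix.mul_apply, Fin.sum_univ_four, h1, h2, h3, e31, e32,
      ← hkdef, ← hv, ← hw, ← hs] <;> field_simp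
  · linear_combination hconj13
  · linear_combination hconj23
  · linear_combination u33
  · ring
  · ring

theorem blockMat_mul (c p q r s k c' p' q' r' s' k' : ℂ) :
    blockMat c p q r s k * blockMat c' p' q' r' s' k' =
      blockMat (c * c') (p * p' + q * r') (p * q' + q * s') (r * p' + s * r') (r * q' + s * s')
        (k * k') := by
  ext i j
  fin_cases i <;> fin_cases j <;> simp [blockMat, Matrix.mul_apply, Fin.sum_univ_four]

theorem det_heisU {v w b : ℂ} (h : IsHeis v w b) : (toMat (heisU h)).det = 1 := by
  simp [heisMat, Matrix.det_succ_row_zero, Fin.sum_univ_succ]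

theorem det_weylU : (toMat weylU).det = 1 := by
  simp [weylMat, Matrix.det_succ_row_zero, Fin.sum_univ_succ, Fin.succAbove]
  linear_combination -Complex.I_sq

theorem det_toMat_mul (g h : U31) : (toMat (g * h)).det = (toMat g).det * (toMat h).det := by
  rw [toMat_mul, Matrix.det_mul]

section Generation

variable {H : Subgroup U31} (hN : ∀ {v w b : ℂ} (h : IsHeis v w b), heisU h ∈ H) (hW : weylU ∈ H)
include hN hW

/-- The middle block is the complex reflection x ↦ x + ξ⟨ξ, x⟩/a with ξ = (v, w); the condition
`IsHeis` is what makes it unitary. It arises from a Weyl–Heisenberg word whose parameters are tuned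
so that the word fixes ∞. -/
theorem exists_block_reflection {v w a : ℂ} (h : IsHeis v w a) (ha : a ≠ 0) :
    ∃ M ∈ H, (toMat M).det = 1 ∧ ∃ k, toMat M = blockMat (-Complex.I * a) (1 + v * (starRingEnd ℂ) v / a)
      (v * (starRingEnd ℂ) w / a) (w * (starRingEnd ℂ) v / a) (1 + w * (starRingEnd ℂ) w / a) k := by
  have ha' : (starRingEnd ℂ) a ≠ 0 := (map_ne_zero _).2 ha
  have hI := Complex.I_sq
  have h1 : IsHeis (Complex.I * v / a) (Complex.I * w / a) ((starRingEnd ℂ) a)⁻¹ := by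
    unfold IsHeis at *
    simp only [map_mul, map_div₀, map_inv₀, Complex.conj_conj, Complex.conj_I]
    field_simp
    linear_combination h - (v * (starRingEnd ℂ) v + w * (starRingEnd ℂ) w) * hI
  set P := weylU * heisU h1 * weylU * heisU h * weylU with hP
  have hPH : P ∈ H := H.mul_mem (H.mul_mem (H.mul_mem (H.mul_mem hW (hN h1)) hW) (hN h)) hW
  have e : toMat P = weylMat * (heisMat (Complex.I * v / a) (Complex.I * w / a)
      ((starRingEnd ℂ) a)⁻¹ * (weylMat * (heisMat v w a * weylMat))) := by
    rw [hP]
    simp only [toMat_mul, toMat_heisU, toMat_weylU, Matrix.mul_assoc]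
  have e1 : heisMat v w a * weylMat = !![Complex.I * a, -(starRingEnd ℂ) v, -(starRingEnd ℂ) w,
      Complex.I; Complex.I * v, 1, 0, 0; Complex.I * w, 0, 1, 0; Complex.I, 0, 0, 0] := by
    ext i j
    fin_cases i <;> fin_cases j <;>
      simp [heisMat, weylMat, Matrix.mul_apply, Fin.sum_univ_four, mul_comm]
  have e2 : weylMat * (heisMat v w a * weylMat) = !![-1, 0, 0, 0; Complex.I * v, 1, 0, 0;
      Complex.I * w, 0, 1, 0; -a, -Complex.I * (starRingEnd ℂ) v, -Complex.I * (starRingEnd ℂ) w,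
      -1] := by
    rw [e1]
    ext i j
    fin_cases i <;> fin_cases j <;>
      simp [weylMat, Matrix.mul_apply, Fin.sum_univ_four]
    linear_combination a * hI
  have hm : ∀ i j, toMat P i j = _ := fun i j => congrFun (congrFun e i) j
  rw [e2] at hm
  unfold IsHeis at h
  have p10 : toMat P 1 0 = 0 := by
    rw [hm]; simp [heisMat, weylMat, Matrix.mul_apply, Fin.sum_univ_four]; field_simp; ring
  have p20 : toMat P 2 0 = 0 := by
    rw [hm]; simp [heisMat, weylMat, Matrix.mul_apply, Fin.sum_univ_four]; field_simp; ring
  have p30 : toMat P 3 0 = 0 := by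
    rw [hm]; simp [heisMat, weylMat, Matrix.mul_apply, Fin.sum_univ_four]; field_simp
    linear_combination -h + (v * (starRingEnd ℂ) v + w * (starRingEnd ℂ) w) * hI
  have p00 : toMat P 0 0 = -Complex.I * a := by
    rw [hm]; simp [heisMat, weylMat, Matrix.mul_apply, Fin.sum_univ_four]
  have p11 : toMat P 1 1 = 1 + v * (starRingEnd ℂ) v / a := by
    rw [hm]; simp [heisMat, weylMat, Matrix.mul_apply, Fin.sum_univ_four]
    linear_combination (-v * (starRingEnd ℂ) v / a) * hI
  have p12 : toMat P 1 2 = v * (starRingEnd ℂ) w / a := by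
    rw [hm]; simp [heisMat, weylMat, Matrix.mul_apply, Fin.sum_univ_four]
    linear_combination (-v * (starRingEnd ℂ) w / a) * hI
  have p21 : toMat P 2 1 = w * (starRingEnd ℂ) v / a := by
    rw [hm]; simp [heisMat, weylMat, Matrix.mul_apply, Fin.sum_univ_four]
    linear_combination (-w * (starRingEnd ℂ) v / a) * hI
  have p22 : toMat P 2 2 = 1 + w * (starRingEnd ℂ) w / a := by
    rw [hm]; simp [heisMat, weylMat, Matrix.mul_apply, Fin.sum_univ_four]
    linear_combination (-w * (starRingEnd ℂ) w / a) * hI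
  obtain ⟨v', w', b', h', hM⟩ := exists_heis_mul_eq_block p10 p20 p30
  refine ⟨_, H.mul_mem (hN h') hPH, ?_, toMat P 3 3, ?_⟩
  · have : (toMat (heisU h)).det = 1 := det_heisU h
    simp only [hP, det_toMat_mul, det_heisU, det_weylU, mul_one, this]
  rw [hM, p00, p11, p12, p21, p22]

/-- Determinant one and unitarity give ck = c̄k = 1, so c is real. The case v = w = 0, a = i/c of
`exists_block_reflection` is then inverse to g. -/
theorem mem_of_diagonal {g : U31} (hdet : (toMat g).det = 1) {c k : ℂ}
    (hg : toMat g = blockMat c 1 0 0 1 k) : g ∈ H := by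
  have u03 := toMat_mem_apply g 0 3
  rw [hg] at u03 hdet
  simp [blockMat, siegelJ] at u03
  simp [blockMat, Matrix.det_succ_row_zero, Fin.sum_univ_succ] at hdet
  have hk : k ≠ 0 := right_ne_zero_of_mul_eq_one hdet
  have hc : c ≠ 0 := left_ne_zero_of_mul_eq_one hdet
  have hcc : (starRingEnd ℂ) c = c := mul_right_cancel₀ hk (u03.trans hdet.symm)
  obtain ⟨M, hM, -, k', hMk⟩ := exists_block_reflection hN hW (v := 0) (w := 0)
    (a := Complex.I * c⁻¹) (by
      unfold IsHeis
      simp only [map_mul, map_inv₀, hcc, Complex.conj_I]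
      ring) (mul_ne_zero Complex.I_ne_zero (inv_ne_zero hc))
  have e : toMat (M * g) = blockMat 1 1 0 0 1 (k' * k) := by
    rw [toMat_mul, hMk, hg]
    have : -Complex.I * (Complex.I * c⁻¹) * c = 1 := by
      field_simp
      rw [Complex.I_sq]; ring
    ext i j
    fin_cases i <;> fin_cases j <;> simp [blockMat, Matrix.mul_apply, Fin.sum_univ_four]
    simpa using this
  have u := toMat_mem_apply (M * g) 0 3
  rw [e] at u
  simp [blockMat, siegelJ] at u
  have : M * g = 1 := by
    apply U31_ext
    rw [e, u, toMat_one]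
    ext i j
    fin_cases i <;> fin_cases j <;> simp [blockMat]
  exact (H.mul_mem_cancel_left hM).1 (this ▸ H.one_mem)

/-- The complex reflection along (v - 1, w), with a = v - 1, carries the unit vector (v, w) to (1,
0). -/
theorem exists_fix_unit {v w : ℂ} (h : v * (starRingEnd ℂ) v + w * (starRingEnd ℂ) w = 1) :
    ∃ M ∈ H, (toMat M).det = 1 ∧ ∃ c p q r s k, toMat M = blockMat c p q r s k ∧
      p * v + q * w = 1 ∧ r * v + s * w = 0 := by
  by_cases hv : v = 1
  · have hw : w = 0 := by
      rw [hv, map_one, mul_one, add_eq_left, Complex.mul_conj] at h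
      exact Complex.normSq_eq_zero.1 (by exact_mod_cast h)
    refine ⟨1, H.one_mem, by simp, 1, 1, 0, 0, 1, 1, ?_, by simp [hv, hw], by simp [hw]⟩
    ext i j
    fin_cases i <;> fin_cases j <;> simp [blockMat]
  · have ha : v - 1 ≠ 0 := sub_ne_zero.2 hv
    obtain ⟨M, hM, hdet, k, e⟩ := exists_block_reflection hN hW (v := v - 1) (w := w) (a := v - 1)
      (by unfold IsHeis; simp only [map_sub, map_one]; linear_combination h) ha
    refine ⟨M, hM, hdet, _, _, _, _, _, _, e, ?_, ?_⟩
    · simp only [map_sub, map_one]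
      field_simp
      linear_combination h
    · simp only [map_sub, map_one]
      field_simp
      linear_combination w * h

/-- The Heisenberg group is transitive on the boundary points other than ∞. It moves g∞ to the point
of e₄, which the Weyl element exchanges with ∞. -/
theorem exists_column_zero (g : U31) : ∃ h ∈ H, (toMat h).det = 1 ∧ toMat (h * g) 1 0 = 0 ∧
    toMat (h * g) 2 0 = 0 ∧ toMat (h * g) 3 0 = 0 := by
  have hnull := toMat_mem_apply g 0 0
  set x := toMat g 0 0 with hx
  set v := toMat g 1 0 with hv
  set w := toMat g 2 0 with hw
  set k := toMat g 3 0 with hk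
  simp only [siegelJ, Matrix.of_apply, Matrix.cons_val_zero, Matrix.cons_val'] at hnull
  by_cases hk0 : k = 0
  · have : Complex.normSq v + Complex.normSq w = 0 := by
      rw [hk0] at hnull
      have h2 : v * (starRingEnd ℂ) v + w * (starRingEnd ℂ) w = 0 := by
        simp only [map_zero, mul_zero, zero_mul, zero_add, add_zero] at hnull
        linear_combination hnull
      rw [Complex.mul_conj, Complex.mul_conj] at h2
      exact_mod_cast h2
    have n1 := Complex.normSq_nonneg v
    have n2 := Complex.normSq_nonneg w
    refine ⟨1, H.one_mem, by simp, ?_, ?_, ?_⟩ <;> rw [one_mul]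
    · exact Complex.normSq_eq_zero.1 (by linarith)
    · exact Complex.normSq_eq_zero.1 (by linarith)
    · exact hk0
  · have hk' : (starRingEnd ℂ) k ≠ 0 := (map_ne_zero _).2 hk0
    have hh : IsHeis (-(v / k)) (-(w / k)) ((starRingEnd ℂ) (x / k)) := by
      unfold IsHeis
      simp only [map_neg, map_div₀, Complex.conj_conj]
      field_simp
      linear_combination hnull
    refine ⟨weylU * heisU hh, H.mul_mem hW (hN hh), ?_, ?_, ?_, ?_⟩
    · rw [det_toMat_mul, det_heisU, det_weylU, one_mul]
    all_goals
      rw [mul_assoc, toMat_mul, toMat_mul, toMat_heisU, toMat_weylU]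
      simp [weylMat, heisMat, Matrix.mul_apply, Fin.sum_univ_four, Matrix.vecMul, dotProduct,
        ← hx, ← hv, ← hw, ← hk]
      field_simp
    · ring
    · ring
    · linear_combination hnull

/-- The Heisenberg group and a Weyl element generate `SU(3,1)`. -/
theorem mem_of_det_eq_one {g : U31} (hg : (toMat g).det = 1) : g ∈ H := by
  obtain ⟨h, hh, hd, h1, h2, h3⟩ := exists_column_zero hN hW g
  obtain ⟨v, w, b, hb, e⟩ := exists_heis_mul_eq_block h1 h2 h3
  set P := heisU hb * (h * g) with hP
  have hPdet : (toMat P).det = 1 := by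
    rw [hP, det_toMat_mul, det_toMat_mul, det_heisU, hd, hg]; simp
  suffices P ∈ H from (H.mul_mem_cancel_left hh).1 ((H.mul_mem_cancel_left (hN hb)).1 this)
  generalize toMat (h * g) 0 0 = c at e
  generalize toMat (h * g) 1 1 = p at e
  generalize toMat (h * g) 1 2 = q at e
  generalize toMat (h * g) 2 1 = r at e
  generalize toMat (h * g) 2 2 = s at e
  generalize toMat (h * g) 3 3 = k at e
  clear_value P
  have u11 := toMat_mem_apply P 1 1
  rw [e] at u11
  simp [blockMat, siegelJ] at u11
  obtain ⟨M, hM, hMd, c', p', q', r', s', k', hMe, e1, e2⟩ := exists_fix_unit hN hW (v := p) (w := r)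
    (by linear_combination u11)
  rw [← H.mul_mem_cancel_left hM]
  have eQ : toMat (M * P) = blockMat (c' * c) 1 (p' * q + q' * s) 0 (r' * q + s' * s) (k' * k) := by
    rw [toMat_mul, hMe, e, blockMat_mul, e1, e2]
  have hQd : (toMat (M * P)).det = 1 := by rw [det_toMat_mul, hMd, hPdet, one_mul]
  generalize M * P = Q at eQ hQd ⊢
  generalize p' * q + q' * s = q₁ at eQ
  generalize r' * q + s' * s = β at eQ
  have u12 := toMat_mem_apply Q 1 2
  have u22 := toMat_mem_apply Q 2 2
  rw [eQ] at u12 u22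
  simp [blockMat, siegelJ] at u12 u22
  subst u12
  -- The middle block is now diag(1, β) with |β| = 1; one more reflection removes β.
  by_cases hβ : β = 1
  · subst hβ
    exact mem_of_diagonal hN hW hQd eQ
  · have ha : β - 1 ≠ 0 := sub_ne_zero.2 hβ
    obtain ⟨M', hM', hMd', k'', hMe'⟩ := exists_block_reflection hN hW (v := 0) (w := β - 1)
      (a := β - 1) (by
        unfold IsHeis
        simp only [map_sub, map_one, map_zero]
        simp at u22
        linear_combination u22) ha
    rw [← H.mul_mem_cancel_left hM']
    refine mem_of_diagonal hN hW (c := -Complex.I * (β - 1) * (c' * c)) (k := k'' * (k' * k))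
      (by rw [det_toMat_mul, hMd', hQd, one_mul]) ?_
    have : (1 + (β - 1) * (starRingEnd ℂ) (β - 1) / (β - 1)) * β = 1 := by
      simp only [map_sub, map_one]
      simp at u22
      field_simp
      linear_combination u22
    rw [toMat_mul, hMe', eQ, blockMat_mul]
    simp only [zero_mul, mul_zero, add_zero, zero_add, mul_one, map_zero, zero_div, this]

end Generation

/-! ### Generation of `SU(3,1)` by `SO(3,1)` and a bending element -/

theorem heisMat_mul (v w b v' w' b' : ℂ) :
    heisMat v w b * heisMat v' w' b' = heisMat (v + v') (w + w')
      (b + b' - (starRingEnd ℂ) v * v' - (starRingEnd ℂ) w * w') := by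
  ext i j
  fin_cases i <;> fin_cases j <;> simp [heisMat, Matrix.mul_apply, Fin.sum_univ_four] <;> ring

/-- The diagonal element that relates the two Weyl elements. -/
def weylQuotU : U31 := mkU31 (Matrix.diagonal ![Complex.I, -1, 1, Complex.I]) (by
  ext i j
  fin_cases i <;> fin_cases j <;>
    simp [siegelJ, Matrix.diagonal_conjTranspose, Matrix.diagonal_mul, Matrix.mul_diagonal])

theorem weylU_mul_weylQuotU : weylU * weylQuotU = spinU weylC := by
  apply U31_ext
  rw [toMat_spinU_weylC, toMat_mul, toMat_weylU]
  change weylMat * Matrix.diagonal _ = _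
  ext i j
  fin_cases i <;> fin_cases j <;> simp [weylMat, matA, Matrix.mul_diagonal]

theorem isHeis_center (t : ℝ) : IsHeis 0 0 (Complex.I * t) := by
  unfold IsHeis; simp

theorem isHeis_real (a b : ℝ) : IsHeis a b (-((a : ℂ) ^ 2 + (b : ℂ) ^ 2) / 2) := by
  unfold IsHeis
  simp [show (starRingEnd ℂ) 2 = 2 from map_ofNat _ 2]
  ring

theorem heisU_center_mem_of {H : Subgroup U31} (hc : ∀ t : ℝ, heisU (isHeis_center t) ∈ H)
    {v w b b' : ℂ} (h : IsHeis v w b) (h' : IsHeis v w b') (hm : heisU h ∈ H) : heisU h' ∈ H := by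
  have e : b' = b + Complex.I * ((b' - b).im : ℝ) := by
    have hre : (b' - b).re = 0 := by
      unfold IsHeis at h h'
      have := congrArg Complex.re (h.trans h'.symm)
      simp at this
      simp; linarith
    have := Complex.re_add_im (b' - b)
    rw [hre, Complex.ofReal_zero, zero_add] at this
    linear_combination -this
  have : heisU h' = heisU (isHeis_center (b' - b).im) * heisU h := by
    apply U31_ext
    rw [toMat_mul, toMat_heisU, toMat_heisU, toMat_heisU, heisMat_mul]
    nth_rewrite 1 [e]
    simp [add_comm]
  rw [this]
  exact H.mul_mem (hc _) hm

/-- The rank one identity: upper, lower and upper unipotent multiply to a Weyl element of the plane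
of e₁ and e₄. -/
theorem weylU_eq : weylU = heisU (isHeis_center 1) *
    (spinU weylC * heisU (isHeis_center 1) * spinU weylC) * heisU (isHeis_center 1) := by
  apply U31_ext
  simp only [toMat_mul, toMat_heisU, toMat_weylU, toMat_spinU_weylC]
  have e : matA * heisMat 0 0 (Complex.I * (1 : ℝ)) * matA =
      !![1, 0, 0, 0; 0, 1, 0, 0; 0, 0, 1, 0; Complex.I, 0, 0, 1] := by
    ext i j
    fin_cases i <;> fin_cases j <;>
      simp [matA, heisMat, Matrix.mul_apply, Fin.sum_univ_four]
  rw [e]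
  ext i j
  fin_cases i <;> fin_cases j <;>
    simp [weylMat, heisMat, Matrix.mul_apply, Fin.sum_univ_four]

theorem weylU_mem {H : Subgroup U31} (hA : spinU weylC ∈ H)
    (hc : ∀ t : ℝ, heisU (isHeis_center t) ∈ H) : weylU ∈ H := by
  rw [weylU_eq]
  exact H.mul_mem (H.mul_mem (hc 1) (H.mul_mem (H.mul_mem hA (hc 1)) hA)) (hc 1)

theorem spinU_upperC_eq (a b : ℝ) :
    spinU (upperC (a / Real.sqrt 2 - Complex.I * (b / Real.sqrt 2))) = heisU (isHeis_real a b) := by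
  have h2 := sqrtTwo_sq
  have h0 := sqrtTwo_ne
  have hr : ((a : ℂ) / (Real.sqrt 2 : ℂ) - Complex.I * ((b : ℂ) / (Real.sqrt 2 : ℂ))) =
      ((a / Real.sqrt 2 : ℝ) : ℂ) + ((-(b / Real.sqrt 2) : ℝ) : ℂ) * Complex.I := by
    push_cast; ring
  apply U31_ext
  rw [toMat_spinU_upperC, toMat_heisU, hr]
  simp only [Complex.add_re, Complex.add_im, Complex.ofReal_re, Complex.ofReal_im, Complex.mul_re,
    Complex.mul_im, Complex.I_re, Complex.I_im, mul_zero, mul_one, sub_zero, add_zero,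
    zero_add]
  ext i j
  fin_cases i <;> fin_cases j <;> simp [transMat, heisMat] <;> field_simp
  rw [h2]
  ring

section Generation

variable {H : Subgroup U31} {u : Circle} (hu : (u : ℂ).im ≠ 0)
  (hT : ∀ z : ℂ, spinU (upperC z) ∈ H) (hA : spinU weylC ∈ H) (hZ : z3U u ∈ H)
include hu hT hA hZ

omit hu hA in
theorem heisU_twist_mem (b : ℝ) (h : IsHeis 0 (u * b) (-((b : ℂ) ^ 2) / 2)) : heisU h ∈ H := by
  have huu : (u : ℂ) * (starRingEnd ℂ) u = 1 := by rw [Complex.mul_conj, Circle.normSq_coe]; simp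
  have e : heisU h * z3U u = z3U u * heisU (isHeis_real 0 b) := by
    apply U31_ext
    simp only [toMat_mul, toMat_heisU, toMat_z3U, matZ3]
    ext i j
    fin_cases i <;> fin_cases j <;>
      simp [heisMat, Matrix.mul_diagonal, Matrix.diagonal_mul]
    linear_combination (b : ℂ) * huu
  rw [← H.mul_mem_cancel_right hZ, e, ← spinU_upperC_eq]
  exact H.mul_mem hZ (hT _)

omit hA in
-- The commutator of the translations w = 1 and w = ub is central, with height proportional to b Im
-- u. Here Im u ≠ 0 is essential.
theorem heisU_center_mem (t : ℝ) : heisU (isHeis_center t) ∈ H := by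
  have huu : (u : ℂ) * (starRingEnd ℂ) u = 1 := by rw [Complex.mul_conj, Circle.normSq_coe]; simp
  set b : ℝ := -t / (2 * (u : ℂ).im) with hb
  have h1 := isHeis_real 0 1
  have h2 : IsHeis 0 (u * b) (-((b : ℂ) ^ 2) / 2) := by
    unfold IsHeis
    simp [show (starRingEnd ℂ) 2 = 2 from map_ofNat _ 2]
    linear_combination -(b : ℂ) ^ 2 * huu
  have m1 : heisU h1 ∈ H := by rw [← spinU_upperC_eq]; exact hT _
  have m2 : heisU h2 ∈ H := heisU_twist_mem hT hZ b h2
  have e : heisU (isHeis_center t) * (heisU h2 * heisU h1) = heisU h1 * heisU h2 := by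
    apply U31_ext
    simp only [toMat_mul, toMat_heisU, heisMat_mul]
    congr 1
    · simp
    · simp [add_comm]
    · have e1 : (u : ℂ) - (starRingEnd ℂ) u = 2 * Complex.I * ((u : ℂ).im : ℂ) := by
        apply Complex.ext <;> simp; ring
      have e2 : (b : ℂ) * (2 * ((u : ℂ).im : ℂ)) = -t := by
        rw [hb]; push_cast
        have : ((u : ℂ).im : ℂ) ≠ 0 := by exact_mod_cast hu
        field_simp
      simp
      linear_combination (b : ℂ) * e1 + Complex.I * e2
  rw [← H.mul_mem_cancel_right (H.mul_mem m2 m1), e]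
  exact H.mul_mem m1 m2

/-- The directions 1 and u span the w-plane over ℝ. In the v-plane the imaginary direction comes
from conjugating a real translation by diag(i, -1, 1, i), the quotient of two Weyl elements. The
height is corrected by the centre. -/
theorem heisU_mem {v w b : ℂ} (h : IsHeis v w b) : heisU h ∈ H := by
  have huu : (u : ℂ) * (starRingEnd ℂ) u = 1 := by rw [Complex.mul_conj, Circle.normSq_coe]; simp
  have hc := heisU_center_mem hu hT hZ
  have hW := weylU_mem hA hc
  have hQ : weylQuotU ∈ H := by
    rw [← H.mul_mem_cancel_left hW, weylU_mul_weylQuotU]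
    exact hA
  have himag : ∀ (x : ℝ) (h : IsHeis (Complex.I * x) 0 (-((x : ℂ) ^ 2) / 2)), heisU h ∈ H := by
    intro x h
    have e : heisU h * weylQuotU = weylQuotU * heisU (isHeis_real x 0) := by
      apply U31_ext
      simp only [toMat_mul, toMat_heisU]
      change _ * Matrix.diagonal _ = Matrix.diagonal _ * _
      ext i j
      fin_cases i <;> fin_cases j <;>
        simp [heisMat, Matrix.mul_diagonal, Matrix.diagonal_mul]
      · ring
      · linear_combination (x : ℂ) * Complex.I_sq
    rw [← H.mul_mem_cancel_right hQ, e, ← spinU_upperC_eq]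
    exact H.mul_mem hQ (hT _)
  -- With p, the real coordinates of w in the basis 1, u.
  set q : ℝ := w.im / (u : ℂ).im with hq
  set p : ℝ := w.re - q * (u : ℂ).re with hp
  have h2 : IsHeis 0 (u * q) (-((q : ℂ) ^ 2) / 2) := by
    unfold IsHeis
    simp [show (starRingEnd ℂ) 2 = 2 from map_ofNat _ 2]
    linear_combination -(q : ℂ) ^ 2 * huu
  have h3 : IsHeis (Complex.I * v.im) 0 (-((v.im : ℂ) ^ 2) / 2) := by
    unfold IsHeis
    simp [show (starRingEnd ℂ) 2 = 2 from map_ofNat _ 2]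
    linear_combination -(v.im : ℂ) ^ 2 * Complex.I_sq
  have h1 := isHeis_real v.re p
  have m1 : heisU h1 ∈ H := by rw [← spinU_upperC_eq]; exact hT _
  have m := H.mul_mem (H.mul_mem m1 (heisU_twist_mem hT hZ q h2)) (himag _ h3)
  have e : toMat (heisU h1 * heisU h2 * heisU h3) = heisMat v w
      (toMat (heisU h1 * heisU h2 * heisU h3) 0 3) := by
    simp only [toMat_mul, toMat_heisU, heisMat_mul]
    congr 1
    · apply Complex.ext <;> simp
    · have : q * (u : ℂ).im = w.im := by rw [hq]; field_simp
      apply Complex.ext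
      · simp [hp]; ring
      · simp; linarith
  generalize heisU h1 * heisU h2 * heisU h3 = g at m e
  have h' : IsHeis v w (toMat g 0 3) := by
    have u33 := toMat_mem_apply g 3 3
    generalize toMat g 0 3 = β at e ⊢
    rw [e] at u33
    simp [heisMat, siegelJ] at u33
    unfold IsHeis
    linear_combination u33
  refine heisU_center_mem_of hc h' h ?_
  have : heisU h' = g := U31_ext (by rw [toMat_heisU, ← e])
  rwa [this]

/-- `SO(3,1)` and a nontrivial bending element generate a group that contains `SU(3,1)`. -/
theorem mem_of_det_eq_one_of_bending {g : U31} (hg : (toMat g).det = 1) : g ∈ H :=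
  mem_of_det_eq_one (fun h => heisU_mem hu hT hA hZ h)
    (weylU_mem hA (heisU_center_mem hu hT hZ)) hg

end Generation

/-! ### Polynomial functions and Zariski closures -/

section PolynomialMaps

variable {X : Type*} (𝒜 : Subalgebra ℝ (X → ℝ))

/-- A complex function with real and imaginary parts in a given algebra of functions. -/
def ComplexMem (h : X → ℂ) : Prop := (fun x => (h x).re) ∈ 𝒜 ∧ (fun x => (h x).im) ∈ 𝒜

/-- A matrix-valued function with coordinates in a given algebra of functions. -/
def MatrixMem (Φ : X → Matrix (Fin 4) (Fin 4) ℂ) : Prop := ∀ i j, ComplexMem 𝒜 fun x => Φ x i j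

variable {𝒜}

theorem ComplexMem.const (c : ℂ) : ComplexMem 𝒜 fun _ => c :=
  ⟨𝒜.algebraMap_mem c.re, 𝒜.algebraMap_mem c.im⟩

theorem ComplexMem.add {g h : X → ℂ} (hg : ComplexMem 𝒜 g) (hh : ComplexMem 𝒜 h) :
    ComplexMem 𝒜 fun x => g x + h x :=
  ⟨𝒜.add_mem hg.1 hh.1, 𝒜.add_mem hg.2 hh.2⟩

theorem ComplexMem.mul {g h : X → ℂ} (hg : ComplexMem 𝒜 g) (hh : ComplexMem 𝒜 h) :
    ComplexMem 𝒜 fun x => g x * h x :=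
  ⟨𝒜.sub_mem (𝒜.mul_mem hg.1 hh.1) (𝒜.mul_mem hg.2 hh.2),
    𝒜.add_mem (𝒜.mul_mem hg.1 hh.2) (𝒜.mul_mem hg.2 hh.1)⟩

theorem ComplexMem.star {g : X → ℂ} (hg : ComplexMem 𝒜 g) :
    ComplexMem 𝒜 fun x => (starRingEnd ℂ) (g x) :=
  ⟨hg.1, 𝒜.neg_mem hg.2⟩

theorem ComplexMem.ofReal {g : X → ℝ} (hg : g ∈ 𝒜) : ComplexMem 𝒜 fun x => (g x : ℂ) :=
  ⟨hg, 𝒜.zero_mem⟩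

theorem MatrixMem.const (M : Matrix (Fin 4) (Fin 4) ℂ) : MatrixMem 𝒜 fun _ => M :=
  fun _ _ => ComplexMem.const _

theorem MatrixMem.add {Φ Ψ : X → Matrix (Fin 4) (Fin 4) ℂ} (h : MatrixMem 𝒜 Φ)
    (h' : MatrixMem 𝒜 Ψ) : MatrixMem 𝒜 fun x => Φ x + Ψ x :=
  fun i j => (h i j).add (h' i j)

theorem MatrixMem.smul {g : X → ℂ} (hg : ComplexMem 𝒜 g) (M : Matrix (Fin 4) (Fin 4) ℂ) :
    MatrixMem 𝒜 fun x => g x • M :=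
  fun _ _ => hg.mul (ComplexMem.const _)

theorem MatrixMem.mul {Φ Ψ : X → Matrix (Fin 4) (Fin 4) ℂ} (h : MatrixMem 𝒜 Φ)
    (h' : MatrixMem 𝒜 Ψ) : MatrixMem 𝒜 fun x => Φ x * Ψ x := by
  intro i j
  simp only [Matrix.mul_apply, Fin.sum_univ_four]
  exact ((((h i 0).mul (h' 0 j)).add ((h i 1).mul (h' 1 j))).add ((h i 2).mul (h' 2 j))).add
    ((h i 3).mul (h' 3 j))

theorem MatrixMem.conjTranspose {Φ : X → Matrix (Fin 4) (Fin 4) ℂ} (h : MatrixMem 𝒜 Φ) :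
    MatrixMem 𝒜 fun x => (Φ x).conjTranspose :=
  fun i j => (h j i).star

end PolynomialMaps

/-- The algebra of real polynomial functions on complex `4 × 4` matrices. -/
def polyFun : Subalgebra ℝ (Matrix (Fin 4) (Fin 4) ℂ → ℝ) :=
  Algebra.adjoin ℝ (Set.range fun i M => realCoords M i)

theorem eval_mem_polyFun (f : MvPolynomial ((Fin 4 × Fin 4) ⊕ (Fin 4 × Fin 4)) ℝ) :
    (fun M => MvPolynomial.eval (realCoords M) f) ∈ polyFun := by
  induction f using MvPolynomial.induction_on with
  | C a =>
    simp only [MvPolynomial.eval_C]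
    exact polyFun.algebraMap_mem a
  | add p q hp hq =>
    simp only [map_add]
    exact polyFun.add_mem hp hq
  | mul_X p i hp =>
    simp only [map_mul, MvPolynomial.eval_X]
    exact polyFun.mul_mem hp (Algebra.subset_adjoin ⟨i, rfl⟩)

theorem exists_eval_of_mem_polyFun {F : Matrix (Fin 4) (Fin 4) ℂ → ℝ} (hF : F ∈ polyFun) :
    ∃ f : MvPolynomial ((Fin 4 × Fin 4) ⊕ (Fin 4 × Fin 4)) ℝ,
      ∀ M, MvPolynomial.eval (realCoords M) f = F M := by
  induction hF using Algebra.adjoin_induction with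
  | mem F h =>
    obtain ⟨i, rfl⟩ := h
    exact ⟨MvPolynomial.X i, fun M => MvPolynomial.eval_X i⟩
  | algebraMap r => exact ⟨MvPolynomial.C r, fun M => MvPolynomial.eval_C r⟩
  | add F G _ _ hF hG =>
    obtain ⟨f, hf⟩ := hF
    obtain ⟨g, hg⟩ := hG
    exact ⟨f + g, fun M => by rw [map_add, hf, hg]; rfl⟩
  | mul F G _ _ hF hG =>
    obtain ⟨f, hf⟩ := hF
    obtain ⟨g, hg⟩ := hG
    exact ⟨f * g, fun M => by rw [map_mul, hf, hg]; rfl⟩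

theorem mem_zariskiClosure_iff {S : Set U31} {g : U31} :
    g ∈ zariskiClosure S ↔ ∀ F ∈ polyFun, (∀ s ∈ S, F (toMat s) = 0) → F (toMat g) = 0 := by
  constructor
  · intro h F hF hS
    obtain ⟨f, hf⟩ := exists_eval_of_mem_polyFun hF
    rw [← hf]
    exact h f fun s hs => by rw [hf, hS s hs]
  · intro h f hS
    exact h _ (eval_mem_polyFun f) hS

/-- This single statement serves for translations and inversion on matrices, for polynomial curves,
and for Laurent polynomials on the circle. -/
theorem polyFun_comp_mem {X : Type*} {𝒜 : Subalgebra ℝ (X → ℝ)}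
    {Φ : X → Matrix (Fin 4) (Fin 4) ℂ} (hΦ : MatrixMem 𝒜 Φ)
    {F : Matrix (Fin 4) (Fin 4) ℂ → ℝ} (hF : F ∈ polyFun) : (fun x => F (Φ x)) ∈ 𝒜 := by
  induction hF using Algebra.adjoin_induction with
  | mem F h =>
    obtain ⟨i | i, rfl⟩ := h
    · exact (hΦ i.1 i.2).1
    · exact (hΦ i.1 i.2).2
  | algebraMap r => exact 𝒜.algebraMap_mem r
  | add F G _ _ hF hG => exact 𝒜.add_mem hF hG
  | mul F G _ _ hF hG => exact 𝒜.mul_mem hF hG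

theorem matrixMem_id : MatrixMem polyFun fun M => M := fun i j =>
  ⟨Algebra.subset_adjoin ⟨Sum.inl (i, j), rfl⟩, Algebra.subset_adjoin ⟨Sum.inr (i, j), rfl⟩⟩

/-- The Zariski closure of a subgroup is a subgroup. -/
def zariskiSubgroup (S : Subgroup U31) : Subgroup U31 where
  carrier := zariskiClosure S
  one_mem' := fun _ hf => hf 1 S.one_mem
  mul_mem' := by
    -- Left translation by S preserves the closure; then right translation by a point of the closure
    -- does too.
    have h1 : ∀ s ∈ S, ∀ g ∈ zariskiClosure (S : Set U31), s * g ∈ zariskiClosure (S : Set U31) := by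
      intro s hs g hg
      rw [mem_zariskiClosure_iff] at *
      intro F hF hS
      exact hg _ (polyFun_comp_mem ((MatrixMem.const (toMat s)).mul matrixMem_id) hF)
        fun t ht => hS _ (S.mul_mem hs ht)
    intro g h hg hh
    have hg' := mem_zariskiClosure_iff.1 hg
    rw [mem_zariskiClosure_iff]
    intro F hF hS
    exact hg' _ (polyFun_comp_mem (matrixMem_id.mul (MatrixMem.const (toMat h))) hF)
      fun t ht => mem_zariskiClosure_iff.1 (h1 t ht h hh) F hF hS
  inv_mem' := by
    intro g hg
    have hg' := mem_zariskiClosure_iff.1 hg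
    rw [mem_zariskiClosure_iff]
    intro F hF hS
    -- On U(3,1) inversion is polynomial: it is M ↦ J M* J for the Siegel matrix J.
    have := hg' _ (polyFun_comp_mem (((MatrixMem.const siegelJ).mul
      matrixMem_id.conjTranspose).mul (MatrixMem.const siegelJ)) hF) fun t ht => by
        rw [← toMat_inv]; exact hS _ (S.inv_mem ht)
    rwa [← toMat_inv] at this

theorem mem_zariskiSubgroup {S : Subgroup U31} {g : U31} :
    g ∈ zariskiSubgroup S ↔ g ∈ zariskiClosure (S : Set U31) := Iff.rfl

theorem le_zariskiSubgroup (S : Subgroup U31) : S ≤ zariskiSubgroup S := fun g hg _ hf => hf g hg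

/-- The algebra of polynomial functions of one real variable. -/
def polyLine : Subalgebra ℝ (ℝ → ℝ) where
  carrier := {h | ∃ p : Polynomial ℝ, ∀ s, h s = p.eval s}
  mul_mem' := by
    rintro _ _ ⟨p, hp⟩ ⟨q, hq⟩
    exact ⟨p * q, fun s => by simp [hp, hq]⟩
  add_mem' := by
    rintro _ _ ⟨p, hp⟩ ⟨q, hq⟩
    exact ⟨p + q, fun s => by simp [hp, hq]⟩
  algebraMap_mem' r := ⟨Polynomial.C r, fun s => by simp⟩

theorem id_mem_polyLine : (fun s : ℝ => s) ∈ polyLine := ⟨Polynomial.X, fun s => by simp⟩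

theorem eq_zero_of_mem_polyLine {h : ℝ → ℝ} (hh : h ∈ polyLine) (h0 : ∀ n : ℕ, h n = 0) (s : ℝ) :
    h s = 0 := by
  obtain ⟨p, hp⟩ := hh
  have : p = 0 := by
    apply Polynomial.eq_zero_of_infinite_isRoot
    refine Set.Infinite.mono (s := Set.range fun n : ℕ => (n : ℝ)) ?_
      (Set.infinite_range_of_injective Nat.cast_injective)
    rintro _ ⟨n, rfl⟩
    rw [Set.mem_ofPred_eq, Polynomial.IsRoot.def, ← hp, h0]
  rw [hp, this, Polynomial.eval_zero]

/-- The entries are polynomial in s, and a polynomial that vanishes at all natural numbers is zero.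
-/
theorem spinU_upperC_mem_of_nat {S : Subgroup U31} (h : ∀ n : ℕ, spinU (upperC n) ∈ S) (s : ℝ) :
    spinU (upperC s) ∈ zariskiSubgroup S := by
  rw [mem_zariskiSubgroup, mem_zariskiClosure_iff]
  intro F hF hS
  have e : ∀ s : ℝ, toMat (spinU (upperC s)) = 1 +
      ((s : ℂ) • !![0, -(Real.sqrt 2 : ℂ), 0, 0; 0, 0, 0, (Real.sqrt 2 : ℂ); 0, 0, 0, 0; 0, 0, 0, 0] +
        (s : ℂ) • ((s : ℂ) • !![0, 0, 0, -1; 0, 0, 0, 0; 0, 0, 0, 0; 0, 0, 0, 0])) := by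
    intro s
    rw [toMat_spinU_upperC, Complex.ofReal_re, Complex.ofReal_im]
    ext i j
    fin_cases i <;> fin_cases j <;> simp [transMat] <;> ring
  have hs := ComplexMem.ofReal id_mem_polyLine
  have hmem : MatrixMem polyLine fun s => toMat (spinU (upperC (s : ℝ))) := by
    simp only [e, smul_smul]
    exact (MatrixMem.const 1).add ((MatrixMem.smul hs _).add (MatrixMem.smul (hs.mul hs) _))
  refine eq_zero_of_mem_polyLine (polyFun_comp_mem hmem hF) (fun n => ?_) s
  exact hS _ (by simpa using h n)

/-- The algebra of Laurent polynomial functions on the circle. -/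
def laurentCircle : Subalgebra ℝ (Circle → ℝ) where
  carrier := {h | ∃ (N : ℕ) (p : Polynomial ℂ), ∀ v : Circle, (v : ℂ) ^ N * h v = p.eval (v : ℂ)}
  mul_mem' := by
    rintro f g ⟨N, p, hp⟩ ⟨M, q, hq⟩
    refine ⟨N + M, p * q, fun v => ?_⟩
    rw [Polynomial.eval_mul, ← hp, ← hq]
    simp; ring
  add_mem' := by
    rintro f g ⟨N, p, hp⟩ ⟨M, q, hq⟩
    refine ⟨N + M, Polynomial.X ^ M * p + Polynomial.X ^ N * q, fun v => ?_⟩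
    simp [← hp, ← hq]; ring
  algebraMap_mem' r := ⟨0, Polynomial.C (r : ℂ), fun v => by simp⟩

theorem eq_zero_of_mem_laurentCircle {h : Circle → ℝ} (hh : h ∈ laurentCircle) {u : Circle}
    (hu : ∀ k : ℕ, 0 < k → (u : ℂ) ^ k ≠ 1) (h0 : ∀ n : ℕ, h (u ^ n) = 0) (v : Circle) : h v = 0 := by
  obtain ⟨N, p, hp⟩ := hh
  have hinj : Function.Injective fun n : ℕ => (u : ℂ) ^ n := by
    have hlt : ∀ m n : ℕ, m < n → (u : ℂ) ^ m ≠ (u : ℂ) ^ n := by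
      intro m n hmn h
      refine hu (n - m) (by omega) ?_
      have : (u : ℂ) ^ m * (u : ℂ) ^ (n - m) = (u : ℂ) ^ m * 1 := by
        rw [← pow_add, mul_one, h]; congr 1; omega
      exact mul_left_cancel₀ (pow_ne_zero _ u.coe_ne_zero) this
    intro m n h
    rcases lt_trichotomy m n with hmn | hmn | hmn
    · exact absurd h (hlt _ _ hmn)
    · exact hmn
    · exact absurd h.symm (hlt _ _ hmn)
  have : p = 0 := by
    apply Polynomial.eq_zero_of_infinite_isRoot
    refine Set.Infinite.mono (s := Set.range fun n : ℕ => (u : ℂ) ^ n) ?_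
      (Set.infinite_range_of_injective hinj)
    rintro _ ⟨n, rfl⟩
    rw [Set.mem_ofPred_eq, Polynomial.IsRoot.def]
    have := hp (u ^ n)
    rw [h0] at this
    simpa using this.symm
  have h1 := hp v
  rw [this, Polynomial.eval_zero] at h1
  have := (mul_eq_zero.1 h1).resolve_left (pow_ne_zero _ v.coe_ne_zero)
  exact_mod_cast this

/-- On the circle v̄ = v⁻¹, so real and imaginary parts are Laurent polynomials in v. -/
theorem complexMem_coe_circle : ComplexMem laurentCircle fun v : Circle => (v : ℂ) := by
  have key : ∀ v : Circle, (v : ℂ) * (starRingEnd ℂ) (v : ℂ) = 1 := fun v => by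
    rw [Complex.mul_conj, Circle.normSq_coe]; simp
  constructor
  · refine ⟨1, Polynomial.C (1 / 2) * (Polynomial.X ^ 2 + 1), fun v => ?_⟩
    rw [Complex.re_eq_add_conj]
    simp
    linear_combination (1 / 2) * key v
  · refine ⟨1, Polynomial.C (1 / (2 * Complex.I)) * (Polynomial.X ^ 2 - 1), fun v => ?_⟩
    rw [Complex.im_eq_sub_conj]
    simp only [pow_one, Polynomial.eval_mul, Polynomial.eval_C, Polynomial.eval_sub,
      Polynomial.eval_pow, Polynomial.eval_X, Polynomial.eval_one]
    linear_combination (-1 / (2 * Complex.I)) * key v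

theorem z3U_mem_of_pow {S : Subgroup U31} {u : Circle} (hu : ∀ k : ℕ, 0 < k → (u : ℂ) ^ k ≠ 1)
    (h : z3U u ∈ zariskiSubgroup S) (v : Circle) : z3U v ∈ zariskiSubgroup S := by
  have hpow : ∀ n : ℕ, z3U (u ^ n) ∈ zariskiSubgroup S := by
    intro n
    have : z3U (u ^ n) = z3U u ^ n := by
      induction n with
      | zero =>
        apply U31_ext
        ext i j
        fin_cases i <;> fin_cases j <;> simp [matZ3]
      | succ n ih =>
        rw [pow_succ (z3U u), ← ih]
        apply U31_ext
        rw [toMat_mul, toMat_z3U, toMat_z3U, toMat_z3U, matZ3, matZ3, matZ3, Matrix.diagonal_mul_diagonal]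
        congr 1
        ext i
        fin_cases i <;> simp [pow_succ]
    rw [this]
    exact pow_mem h n
  rw [mem_zariskiSubgroup, mem_zariskiClosure_iff]
  intro F hF hS
  have e : ∀ v : Circle, toMat (z3U v) = Matrix.diagonal ![1, 1, 0, 1] +
      (v : ℂ) • Matrix.diagonal ![0, 0, 1, 0] := by
    intro v
    ext i j
    fin_cases i <;> fin_cases j <;> simp [matZ3]
  have hmem : MatrixMem laurentCircle fun v => toMat (z3U v) := by
    simp only [e]
    exact (MatrixMem.const _).add (MatrixMem.smul complexMem_coe_circle _)
  refine eq_zero_of_mem_laurentCircle (polyFun_comp_mem hmem hF) hu (fun n => ?_) v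
  exact mem_zariskiClosure_iff.1 (hpow n) F hF hS

/-! ### Zariski density -/

theorem diagC_eq_prod (l : ℂˣ) : diagC l = upperC l * weylC * upperC ((l⁻¹ : ℂˣ) : ℂ) * weylC⁻¹ *
    upperC l * weylC := by
  have hw : (weylC⁻¹).val = !![0, 1; -1, 0] := by
    rw [Matrix.SpecialLinearGroup.coe_inv, weylC_val, Matrix.adjugate_fin_two_of]; simp
  apply SL2_ext
  simp only [SL2_mul_val, diagC_val, upperC_val, weylC_val, hw]
  ext i j
  fin_cases i <;> fin_cases j <;> simp [Matrix.mul_apply, Fin.sum_univ_two]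

theorem diagC_mul_upperC (l : ℂˣ) (z : ℂ) :
    diagC l * upperC z * (diagC l)⁻¹ = upperC ((l : ℂ) ^ 2 * z) := by
  rw [mul_inv_eq_iff_eq_mul]
  apply SL2_ext
  simp only [SL2_mul_val, diagC_val, upperC_val]
  have := l.ne_zero
  ext i j
  fin_cases i <;> fin_cases j <;> simp [Matrix.mul_apply, Fin.sum_univ_two]
  field_simp

/-- Two conjugates of `SL(2, ℝ)` sharing their real translations generate all translations. -/
theorem upperC_mem_of_real {S : Subgroup SL(2, ℂ)} (hr : ∀ s : ℝ, upperC s ∈ S) (hw : weylC ∈ S)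
    {τ : ℂ} (hτ : τ.im ≠ 0) (hc : upperC (-τ) * weylC * upperC τ ∈ S) (z : ℂ) : upperC z ∈ S := by
  have hcw : upperC (-τ) * weylC * (upperC (-τ))⁻¹ ∈ S := by
    rw [← upperC_neg, neg_neg]; exact hc
  have hcr : ∀ s : ℝ, upperC (-τ) * upperC s * (upperC (-τ))⁻¹ ∈ S := by
    intro s
    rw [← upperC_neg, ← upperC_add, ← upperC_add]
    convert hr s using 2
    ring
  -- The commutator of the translation by -τ with diag(l, l⁻¹) is the translation by (l² - 1)τ. It
  -- is in S because both diagonal elements, original and conjugated, are words in translations and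
  -- Weyl elements of S.
  have hsq : ∀ l : ℝ, l ≠ 0 → upperC (((l ^ 2 - 1 : ℝ) : ℂ) * τ) ∈ S := by
    intro l hl
    set L : ℂˣ := Units.mk0 (l : ℂ) (by exact_mod_cast hl) with hL
    have hLi : ((L⁻¹ : ℂˣ) : ℂ) = ((l⁻¹ : ℝ) : ℂ) := by simp [hL]
    have hLv : (L : ℂ) = (l : ℂ) := rfl
    have hD : diagC L ∈ S := by
      rw [diagC_eq_prod, hLi, hLv]
      exact S.mul_mem (S.mul_mem (S.mul_mem (S.mul_mem (S.mul_mem (hr _) hw) (hr _))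
        (S.inv_mem hw)) (hr _)) hw
    have hcD : upperC (-τ) * diagC L * (upperC (-τ))⁻¹ ∈ S := by
      set c := upperC (-τ)
      have : c * diagC L * c⁻¹ = (c * upperC l * c⁻¹) * (c * weylC * c⁻¹) *
          (c * upperC (l⁻¹ : ℝ) * c⁻¹) * (c * weylC * c⁻¹)⁻¹ * (c * upperC l * c⁻¹) *
          (c * weylC * c⁻¹) := by
        rw [diagC_eq_prod, hLi, hLv]; group
      rw [this]
      exact S.mul_mem (S.mul_mem (S.mul_mem (S.mul_mem (S.mul_mem (hcr _) hcw) (hcr _))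
        (S.inv_mem hcw)) (hcr _)) hcw
    have := S.mul_mem hcD (S.inv_mem hD)
    have e : upperC (-τ) * diagC L * (upperC (-τ))⁻¹ * (diagC L)⁻¹ =
        upperC (-τ) * (diagC L * upperC τ * (diagC L)⁻¹) := by
      rw [← upperC_neg, neg_neg]; group
    rw [e, diagC_mul_upperC, ← upperC_add, hLv] at this
    convert this using 2
    push_cast; ring
  have hpos : ∀ s : ℝ, 0 ≤ s → upperC ((s : ℂ) * τ) ∈ S := by
    intro s hs
    have := hsq (Real.sqrt (1 + s)) (Real.sqrt_ne_zero'.2 (by linarith))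
    rwa [Real.sq_sqrt (by linarith), add_sub_cancel_left] at this
  have hall : ∀ s : ℝ, upperC ((s : ℂ) * τ) ∈ S := by
    intro s
    rcases le_total 0 s with hs | hs
    · exact hpos s hs
    · have := S.inv_mem (hpos (-s) (by linarith))
      rw [← upperC_neg] at this
      convert this using 2
      push_cast; ring
  have e : z = ((z.re - z.im / τ.im * τ.re : ℝ) : ℂ) + ((z.im / τ.im : ℝ) : ℂ) * τ := by
    apply Complex.ext
    · simp
    · simp
      field_simp
  rw [e, upperC_add]
  exact S.mul_mem (hr _) (hall _)

/-! ### The Zariski closure of the image of a bending deformation. -/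

section

variable {d : ℕ} (hd : Admissible d) {u : Circle} {ρ : Bi d →* U31} (h : IsBending d u ρ)
include hd h

theorem spinU_weylC_mem_zariski : spinU weylC ∈ zariskiSubgroup ρ.range := by
  apply le_zariskiSubgroup
  refine ⟨toBi d (weylO d), ?_⟩
  rw [bending_toBi_of_mem hd h (weylO_mem hd)]
  change spinU (toSLC d (weylO d)) = _
  rw [toSLC_weylO']

/-- On the base chamber's two vertical walls ρ agrees with ρ₁, so the image contains the integral
translations, the Weyl element, and its conjugate by the translation τ. `upperC_mem_of_real` does
the rest. -/
theorem spinU_upperC_mem_zariski (z : ℂ) : spinU (upperC z) ∈ zariskiSubgroup ρ.range := by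
  have hr : ∀ s : ℝ, spinU (upperC s) ∈ zariskiSubgroup ρ.range := by
    apply spinU_upperC_mem_of_nat
    intro n
    have := bending_toBi_of_mem hd h (upperO_int_mem hd n)
    refine ⟨toBi d (upperO ((n : ℤ) : ringO d)), ?_⟩
    rw [this]
    change spinU (toSLC d (upperO _)) = _
    rw [toSLC_upperO']
    simp
  refine upperC_mem_of_real (S := (zariskiSubgroup ρ.range).comap spinU) hr
    (spinU_weylC_mem_zariski hd h) (τ := tau d) hd.delta_pos.ne' ?_ z
  apply le_zariskiSubgroup
  have hJ : actM (weylO d) matJ = matJ := by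
    rw [actM, toSLC_weylO]
    ext i j
    fin_cases i <;> fin_cases j <;> simp [matJ, Matrix.mul_apply, Fin.sum_univ_two]
  have := bending_toBi_of_mem hd h (conj_mem_chamberStab hd hJ)
  refine ⟨_, this.trans ?_⟩
  change spinU (toSLC d _) = _
  have e : toSLC d ((upperO (tauO d))⁻¹ * weylO d * upperO (tauO d)) =
      upperC (-tau d) * weylC * upperC (tau d) := by
    rw [map_mul, map_mul, map_inv, toSLC_weylO', toSLC_upperO', upperC_neg]
    rfl
  rw [e]

theorem z3U_mem_zariski : z3U u ∈ zariskiSubgroup ρ.range := by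
  have e : ρ (uElt d) = z3U u * spinU (upperC (tau d)) := by
    apply U31_ext
    rw [h.2, toMat_mul, toMat_z3U, uElt_eq, rho1_toBi]
    change _ * toMat (spinU (toSLC d (upperO (tauO d)))) = _
    rw [toSLC_upperO']
    rfl
  rw [← (zariskiSubgroup ρ.range).mul_mem_cancel_right (spinU_upperC_mem_zariski hd h (tau d)), ← e]
  exact le_zariskiSubgroup _ ⟨_, rfl⟩

omit hd h in
theorem im_ne_zero_of_ne {u : Circle} (h1 : (u : ℂ) ≠ 1) (h2 : (u : ℂ) ≠ -1) : (u : ℂ).im ≠ 0 := by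
  intro h0
  have hn := Circle.normSq_coe u
  rw [Complex.normSq_apply, h0, mul_zero, add_zero] at hn
  rcases mul_self_eq_one_iff.1 hn with hr | hr
  · exact h1 (Complex.ext (by simpa using hr) (by simpa using h0))
  · exact h2 (Complex.ext (by simpa using hr) (by simpa using h0))

theorem mem_zariskiClosure_of_det_eq_one (h1 : (u : ℂ) ≠ 1) (h2 : (u : ℂ) ≠ -1) {g : U31}
    (hg : (toMat g).det = 1) : g ∈ zariskiClosure (Set.range ρ) := by
  rw [← MonoidHom.coe_range]
  exact mem_of_det_eq_one_of_bending (H := zariskiSubgroup ρ.range) (im_ne_zero_of_ne h1 h2)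
    (spinU_upperC_mem_zariski hd h) (spinU_weylC_mem_zariski hd h) (z3U_mem_zariski hd h) hg

omit hd h in
theorem normSq_det (g : U31) : Complex.normSq (toMat g).det = 1 := by
  have hJ : siegelJ.det ≠ 0 := by
    have := congrArg Matrix.det siegelJ_mul_self
    rw [Matrix.det_mul, Matrix.det_one] at this
    exact left_ne_zero_of_mul_eq_one this
  have := congrArg Matrix.det (toMat_mem g)
  rw [Matrix.det_mul, Matrix.det_mul, Matrix.det_conjTranspose] at this
  have h2 : star (toMat g).det * (toMat g).det = 1 := by
    apply mul_right_cancel₀ hJ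
    linear_combination this
  have h3 : (toMat g).det * (starRingEnd ℂ) (toMat g).det = 1 := by rw [mul_comm]; exact h2
  rw [Complex.mul_conj] at h3
  exact_mod_cast h3

/-- Dividing g by Z₃(det g), which is in the closure, leaves an element of SU(3,1). -/
theorem zariskiClosure_eq_univ (h1 : (u : ℂ) ≠ 1) (h2 : (u : ℂ) ≠ -1)
    (hu : ∀ k : ℕ, 0 < k → (u : ℂ) ^ k ≠ 1) : zariskiClosure (Set.range ρ) = Set.univ := by
  rw [Set.eq_univ_iff_forall]
  intro g
  rw [← MonoidHom.coe_range]
  set v : Circle := ⟨(toMat g).det, by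
    have := normSq_det g
    rw [Complex.normSq_eq_norm_sq] at this
    refine mem_sphere_zero_iff_norm.2 ?_
    exact (pow_eq_one_iff_of_nonneg (norm_nonneg _) two_ne_zero).1 this⟩ with hv
  have hz := z3U_mem_of_pow hu (z3U_mem_zariski hd h) v
  change g ∈ zariskiSubgroup ρ.range
  rw [← (zariskiSubgroup ρ.range).mul_mem_cancel_left ((zariskiSubgroup ρ.range).inv_mem hz)]
  have hdz : (toMat (z3U v)).det = (toMat g).det := by
    rw [toMat_z3U, matZ3, Matrix.det_diagonal, Fin.prod_univ_four]
    simp [hv]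
  have hdet : (toMat ((z3U v)⁻¹ * g)).det = 1 := by
    have h3 := det_toMat_mul (z3U v) ((z3U v)⁻¹ * g)
    rw [mul_inv_cancel_left, hdz] at h3
    have h0 : (toMat g).det ≠ 0 := by
      intro h0; have := normSq_det g; rw [h0] at this; simp at this
    exact (mul_left_cancel₀ h0 (by rw [mul_one]; exact h3)).symm
  have := mem_zariskiClosure_of_det_eq_one hd h h1 h2 hdet
  rw [← MonoidHom.coe_range] at this
  exact this

end

/-! ### Exponentials and connected Lie subgroups -/

open NormedSpace in
-- Conjugation by exp Y is exp(ad Y). Here ad Y = L + R with commuting left and right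
-- multiplications, and its exponential series at X has all terms in the closed subspace.
theorem exp_conj_mem {𝔸 : Type*} [NormedRing 𝔸] [NormedAlgebra ℝ 𝔸] [CompleteSpace 𝔸]
    {𝔨 : Submodule ℝ 𝔸} (hcl : IsClosed (𝔨 : Set 𝔸)) {Y : 𝔸}
    (hY : ∀ X ∈ 𝔨, Y * X - X * Y ∈ 𝔨) {X : 𝔸} (hX : X ∈ 𝔨) : exp Y * X * exp (-Y) ∈ 𝔨 := by
  let _ : NormedAlgebra ℚ (𝔸 →L[ℝ] 𝔸) := NormedAlgebra.restrictScalars ℚ ℝ _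
  set L : 𝔸 →L[ℝ] 𝔸 := ContinuousLinearMap.mul ℝ 𝔸 Y with hL
  set R : 𝔸 →L[ℝ] 𝔸 := (ContinuousLinearMap.mul ℝ 𝔸).flip (-Y) with hR
  have hsum : ∀ (T : 𝔸 →L[ℝ] 𝔸) (Z : 𝔸),
      HasSum (fun n : ℕ => ((n.factorial : ℝ)⁻¹) • (T ^ n) Z) (exp T Z) := by
    intro T Z
    have := (exp_series_hasSum_exp' (𝕂 := ℝ) T).mapL (ContinuousLinearMap.apply ℝ 𝔸 Z)
    simpa [Function.comp_def] using this
  have hLZ : ∀ Z, exp L Z = exp Y * Z := by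
    intro Z
    refine (hsum L Z).unique ?_
    have h1 := (exp_series_hasSum_exp' (𝕂 := ℝ) Y).mul_right Z
    have h2 : ∀ n : ℕ, (L ^ n) Z = Y ^ n * Z := by
      intro n
      induction n with
      | zero => simp
      | succ n ih => rw [pow_succ', mul_apply_eq_comp, ih, pow_succ', hL]; simp [mul_assoc]
    simpa [h2] using h1
  have hRZ : ∀ Z, exp R Z = Z * exp (-Y) := by
    intro Z
    refine (hsum R Z).unique ?_
    have h1 := (exp_series_hasSum_exp' (𝕂 := ℝ) (-Y)).mul_left Z
    have h2 : ∀ n : ℕ, (R ^ n) Z = Z * (-Y) ^ n := by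
      intro n
      induction n with
      | zero => simp
      | succ n ih => rw [pow_succ', mul_apply_eq_comp, ih, pow_succ, hR]; simp [mul_assoc]
    simpa only [h2, mul_smul_comm] using h1
  have hcomm : Commute L R := by
    ext Z
    simp [hL, hR, mul_assoc]
  have h1 : exp (L + R) X = exp Y * X * exp (-Y) := by
    rw [exp_add_of_commute hcomm, mul_apply_eq_comp, hRZ, hLZ, mul_assoc]
  rw [← h1, ← (hsum (L + R) X).tsum_eq]
  have h2 : ∀ n : ℕ, ((L + R) ^ n) X ∈ 𝔨 := by
    intro n
    induction n with
    | zero => simpa using hX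
    | succ n ih =>
      rw [pow_succ', mul_apply_eq_comp]
      convert hY _ ih using 1
      simp [hL, hR, sub_eq_add_neg]
  exact tsum_mem hcl fun n => 𝔨.smul_mem _ (h2 n)

open scoped Matrix.Norms.Operator in
theorem matrix_exp_conj_mem {𝔨 : Submodule ℝ (Matrix (Fin 4) (Fin 4) ℂ)}
    {Y : Matrix (Fin 4) (Fin 4) ℂ} (hY : ∀ X ∈ 𝔨, Y * X - X * Y ∈ 𝔨)
    {X : Matrix (Fin 4) (Fin 4) ℂ} (hX : X ∈ 𝔨) :
    NormedSpace.exp Y * X * NormedSpace.exp (-Y) ∈ 𝔨 :=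
  exp_conj_mem 𝔨.closed_of_finiteDimensional hY hX

open scoped Matrix.Norms.Operator in
theorem continuous_exp_smul (X : Matrix (Fin 4) (Fin 4) ℂ) :
    Continuous fun s : ℝ => NormedSpace.exp (s • X) := by
  let _ : NormedAlgebra ℚ (Matrix (Fin 4) (Fin 4) ℂ) := NormedAlgebra.restrictScalars ℚ ℝ _
  exact NormedSpace.exp_continuous.comp (continuous_id.smul continuous_const)

theorem exp_eq_one_add {N : Matrix (Fin 4) (Fin 4) ℂ} (hN : N * N = 0) :
    NormedSpace.exp N = 1 + N := by
  have h : ∀ n ∉ Finset.range 2, ((n.factorial : ℝ)⁻¹) • N ^ n = 0 := by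
    intro n hn
    obtain ⟨k, rfl⟩ : ∃ k, n = k + 2 := ⟨n - 2, by simp at hn; omega⟩
    rw [pow_add, pow_two, hN, mul_zero, smul_zero]
  rw [NormedSpace.exp_eq_tsum ℝ]
  change ∑' n : ℕ, ((n.factorial : ℝ)⁻¹) • N ^ n = _
  rw [tsum_eq_sum h]
  simp [Finset.sum_range_succ]

/-- A nontrivial one-parameter subgroup of the circle is everything. -/
theorem exists_eq_of_oneParameter {f : ℝ → ℂ} (hf : Continuous f) (hn : ∀ s, Complex.normSq (f s) = 1)
    (hadd : ∀ s t, f (s + t) = f s * f t) {s₀ : ℝ} (h0 : f s₀ ≠ 1) {ζ : ℂ}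
    (hζ : Complex.normSq ζ = 1) : ∃ s, f s = ζ := by
  have hz : f 0 = 1 := by
    have h1 := hadd 0 0
    rw [add_zero] at h1
    have h2 : f 0 ≠ 0 := fun h => by have := hn 0; rw [h] at this; simp at this
    exact (mul_left_cancel₀ h2 (by rw [mul_one]; exact h1)).symm
  have hmul : ∀ (n : ℕ) s, f (n * s) = f s ^ n := by
    intro n s
    induction n with
    | zero => simp [hz]
    | succ n ih => rw [pow_succ, ← ih, ← hadd]; congr 1; push_cast; ring
  have hneg : ∀ s, f (-s) = (starRingEnd ℂ) (f s) := by
    intro s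
    have h1 : f s * f (-s) = 1 := by rw [← hadd, add_neg_cancel, hz]
    have h2 : f s * (starRingEnd ℂ) (f s) = 1 := by rw [Complex.mul_conj, hn]; simp
    have h3 : f s ≠ 0 := left_ne_zero_of_mul_eq_one h1
    exact mul_left_cancel₀ h3 (h1.trans h2.symm)
  have hre : (f s₀).re < 1 := by
    have := hn s₀
    rw [Complex.normSq_apply] at this
    rcases lt_trichotomy (f s₀).re 1 with h | h | h
    · exact h
    · exfalso
      apply h0
      have him : (f s₀).im = 0 := by rw [h] at this; nlinarith
      exact Complex.ext (by simpa using h) (by simpa using him)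
    · nlinarith [mul_self_nonneg (f s₀).im]
  set θ := Complex.arg ζ with hθ
  have hζθ : ζ = Complex.exp (θ * Complex.I) := by
    have h1 := Complex.norm_mul_exp_arg_mul_I ζ
    have h2 : ‖ζ‖ = 1 := by
      rw [Complex.normSq_eq_norm_sq] at hζ
      exact (pow_eq_one_iff_of_nonneg (norm_nonneg _) two_ne_zero).1 hζ
    rw [h2] at h1
    simpa using h1.symm
  -- For large n the angle θ/n is so small that its cosine is a value of Re f, by the intermediate
  -- value theorem. Then f(s) or f(-s) is exp(iθ/n), and its n-th power is ζ.
  obtain ⟨n, hn0, hn1⟩ : ∃ n : ℕ, 0 < n ∧ (f s₀).re < Real.cos (θ / n) := by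
    have h1 : Filter.Tendsto (fun n : ℕ => Real.cos (θ / n)) Filter.atTop (nhds 1) := by
      have := (Real.continuous_cos.tendsto 0).comp (tendsto_const_div_atTop_nhds_zero_nat θ)
      simpa [Function.comp_def] using this
    obtain ⟨n, h2, h3⟩ := ((h1.eventually_const_lt hre).and (Filter.eventually_gt_atTop 0)).exists
    exact ⟨n, h3, h2⟩
  have hn0' : (n : ℂ) ≠ 0 := by exact_mod_cast hn0.ne'
  obtain ⟨s, -, hs⟩ : Real.cos (θ / n) ∈ (fun s => (f s).re) '' Set.uIcc s₀ 0 := by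
    apply intermediate_value_uIcc (Complex.continuous_re.comp hf).continuousOn
    change _ ∈ Set.uIcc (f s₀).re (f 0).re
    rw [hz, Complex.one_re, Set.uIcc_of_le hre.le]
    exact ⟨hn1.le, Real.cos_le_one _⟩
  have hs' : (f s).re = Real.cos (θ / n) := hs
  have hval : f s = Complex.exp ((θ / n : ℝ) * Complex.I) ∨
      f (-s) = Complex.exp ((θ / n : ℝ) * Complex.I) := by
    have h1 := hn s
    rw [Complex.normSq_apply, hs'] at h1
    have h2 := Real.sin_sq_add_cos_sq (θ / n)
    have h3 : (f s).im ^ 2 = Real.sin (θ / n) ^ 2 := by linarith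
    rcases sq_eq_sq_iff_eq_or_eq_neg.1 h3 with h | h
    · left
      apply Complex.ext
      · rw [Complex.exp_ofReal_mul_I_re, hs']
      · rw [Complex.exp_ofReal_mul_I_im, h]
    · right
      rw [hneg]
      apply Complex.ext
      · rw [Complex.exp_ofReal_mul_I_re, Complex.conj_re, hs']
      · rw [Complex.exp_ofReal_mul_I_im, Complex.conj_im, h, neg_neg]
  have hfin : ∀ t, f t = Complex.exp ((θ / n : ℝ) * Complex.I) → f (n * t) = ζ := by
    intro t ht
    rw [hmul, ht, ← Complex.exp_nat_mul, hζθ]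
    congr 1
    push_cast
    field_simp
  rcases hval with h | h
  exacts [⟨_, hfin _ h⟩, ⟨_, hfin _ h⟩]

theorem linear_mem {X : Type*} {𝒜 : Subalgebra ℝ (X → ℝ)} {Φ : X → Matrix (Fin 4) (Fin 4) ℂ}
    (hΦ : MatrixMem 𝒜 Φ) (φ : Matrix (Fin 4) (Fin 4) ℂ →ₗ[ℝ] ℝ) : (fun x => φ (Φ x)) ∈ 𝒜 := by
  have e : (fun x => φ (Φ x)) = ∑ i, ∑ j, (φ (Matrix.single i j 1) • (fun x => (Φ x i j).re) +
      φ (Matrix.single i j Complex.I) • fun x => (Φ x i j).im) := by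
    ext x
    conv_lhs => rw [Matrix.matrix_eq_sum_single (Φ x)]
    simp only [map_sum, Finset.sum_apply, Pi.add_apply, Pi.smul_apply]
    refine Finset.sum_congr rfl fun i _ => Finset.sum_congr rfl fun j _ => ?_
    have : Matrix.single i j (Φ x i j) = (Φ x i j).re • Matrix.single i j (1 : ℂ) +
        (Φ x i j).im • Matrix.single i j Complex.I := by
      rw [Matrix.smul_single, Matrix.smul_single, ← Matrix.single_add]
      congr 1
      apply Complex.ext <;> simp
    rw [this, map_add, map_smul, map_smul, smul_eq_mul, smul_eq_mul, smul_eq_mul, smul_eq_mul]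
    ring
  rw [e]
  exact sum_mem fun i _ => sum_mem fun j _ =>
    add_mem (𝒜.smul_mem (hΦ i j).1 _) (𝒜.smul_mem (hΦ i j).2 _)

/-- The condition of preserving a real subspace of matrices under conjugation is Zariski closed. -/
theorem conj_mem_of_zariski {S : Set U31} {𝔨 : Submodule ℝ (Matrix (Fin 4) (Fin 4) ℂ)}
    (hS : ∀ s ∈ S, ∀ X ∈ 𝔨, toMat s * X * toMat s⁻¹ ∈ 𝔨) {g : U31} (hg : g ∈ zariskiClosure S)
    {X : Matrix (Fin 4) (Fin 4) ℂ} (hX : X ∈ 𝔨) : toMat g * X * toMat g⁻¹ ∈ 𝔨 := by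
  by_contra hcon
  obtain ⟨φ, hφ, hle⟩ := Submodule.exists_le_ker_of_notMem hcon
  apply hφ
  have hmem : (fun M => φ (M * X * (siegelJ * M.conjTranspose * siegelJ))) ∈ polyFun :=
    linear_mem ((matrixMem_id.mul (MatrixMem.const X)).mul (((MatrixMem.const siegelJ).mul
      matrixMem_id.conjTranspose).mul (MatrixMem.const siegelJ))) φ
  have := mem_zariskiClosure_iff.1 hg _ hmem fun s hs => by
    rw [← toMat_inv]
    exact hle (hS s hs X hX)
  rwa [← toMat_inv] at this

/-! ### Connected Lie subgroups that contain the image of a bending deformation -/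

/-- The entry (3,0) of g⁻¹Xg is the Hermitian product of ge₁ with X ge₁. So this product vanishes on
all null vectors (b, v, w, 1); finitely many of them give enough linear equations on X. -/
theorem eq_scalar_of_conj {X : Matrix (Fin 4) (Fin 4) ℂ}
    (hX : ∀ g : U31, (toMat g).det = 1 → (toMat g⁻¹ * X * toMat g) 3 0 = 0) :
    X = X 0 0 • (1 : Matrix (Fin 4) (Fin 4) ℂ) := by
  have hI := Complex.I_sq
  have h30 : X 3 0 = 0 := by simpa using hX 1 (by simp)
  have key : ∀ {v w b : ℂ} (_ : IsHeis v w b),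
      (starRingEnd ℂ) b * (X 3 1 * v + X 3 2 * w + X 3 3) +
        (starRingEnd ℂ) v * (X 1 0 * b + X 1 1 * v + X 1 2 * w + X 1 3) +
        (starRingEnd ℂ) w * (X 2 0 * b + X 2 1 * v + X 2 2 * w + X 2 3) +
        (X 0 0 * b + X 0 1 * v + X 0 2 * w + X 0 3) = 0 := by
    intro v w b h
    have := hX (heisU h * weylU) (by rw [det_toMat_mul, det_heisU, det_weylU, one_mul])
    have e1 : ∀ i, toMat (heisU h * weylU) i 0 = Complex.I * ![b, v, w, 1] i := by
      intro i
      rw [toMat_mul, toMat_heisU, toMat_weylU]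
      fin_cases i <;> simp [heisMat, weylMat, Matrix.mul_apply, Fin.sum_univ_four, mul_comm]
    have e2 : ∀ j, toMat (heisU h * weylU)⁻¹ 3 j = -Complex.I * ![1, (starRingEnd ℂ) v,
        (starRingEnd ℂ) w, (starRingEnd ℂ) b] j := by
      intro j
      generalize heisU h * weylU = g at e1 ⊢
      rw [toMat_inv]
      simp only [Matrix.mul_apply, Fin.sum_univ_four, Matrix.conjTranspose_apply]
      fin_cases j <;> simp [siegelJ, e1]
    rw [Matrix.mul_apply] at this
    simp only [Matrix.mul_apply, Fin.sum_univ_four, e1, e2] at this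
    simp [h30] at this
    linear_combination this - ((starRingEnd ℂ) b * (X 3 1 * v + X 3 2 * w + X 3 3) +
        (starRingEnd ℂ) v * (X 1 0 * b + X 1 1 * v + X 1 2 * w + X 1 3) +
        (starRingEnd ℂ) w * (X 2 0 * b + X 2 1 * v + X 2 2 * w + X 2 3) +
        (X 0 0 * b + X 0 1 * v + X 0 2 * w + X 0 3)) * (-hI)
  have hh : ∀ (v w : ℂ) (n : ℝ) (t : ℝ), v * (starRingEnd ℂ) v + w * (starRingEnd ℂ) w = n →
      IsHeis v w (-(n / 2) + Complex.I * t) := by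
    intro v w n t h
    unfold IsHeis
    simp [show (starRingEnd ℂ) 2 = 2 from map_ofNat _ 2]
    linear_combination h
  have k0 := key (hh 0 0 0 0 (by simp))
  have k1 := key (hh 0 0 0 1 (by simp))
  have a1 := key (hh 1 0 1 0 (by simp))
  have a2 := key (hh 1 0 1 1 (by simp))
  have a3 := key (hh (-1) 0 1 0 (by simp))
  have a4 := key (hh Complex.I 0 1 0 (by simp))
  have a5 := key (hh Complex.I 0 1 1 (by simp))
  have b1 := key (hh 0 1 1 0 (by simp))
  have b2 := key (hh 0 1 1 1 (by simp))
  have b3 := key (hh 0 (-1) 1 0 (by simp))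
  have b4 := key (hh 0 Complex.I 1 0 (by simp))
  have b5 := key (hh 0 Complex.I 1 1 (by simp))
  have c1 := key (hh 1 1 2 0 (by simp; norm_num))
  have c2 := key (hh 1 Complex.I 2 0 (by simp; norm_num))
  simp [show (starRingEnd ℂ) 2 = 2 from map_ofNat _ 2] at k0 k1 a1 a2 a3 a4 a5 b1 b2 b3 b4 b5 c1 c2
  have h33 : X 3 3 = X 0 0 := by grind
  have h31 : X 3 1 = 0 := by grind
  have h10 : X 1 0 = 0 := by grind
  have h32 : X 3 2 = 0 := by grind
  have h20 : X 2 0 = 0 := by grind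
  have h11 : X 1 1 = X 0 0 := by grind
  have h22 : X 2 2 = X 0 0 := by grind
  have h13 : X 1 3 = 0 := by grind
  have h01 : X 0 1 = 0 := by grind
  have h23 : X 2 3 = 0 := by grind
  have h02 : X 0 2 = 0 := by grind
  have h12 : X 1 2 = 0 := by grind
  have h21 : X 2 1 = 0 := by grind
  ext i j
  fin_cases i <;> fin_cases j <;> simp [*]

/-- The group generated by the exponentials of the elements of a real subspace. -/
def expGroup (𝔨 : Submodule ℝ (Matrix (Fin 4) (Fin 4) ℂ)) : Subgroup (GL (Fin 4) ℂ) :=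
  Subgroup.closure {g | ∃ X ∈ 𝔨, g.val = NormedSpace.exp X}

/-- The exponential of a matrix, as a unit. -/
def expGL (X : Matrix (Fin 4) (Fin 4) ℂ) : GL (Fin 4) ℂ := (Matrix.isUnit_exp X).unit

/-! ### The group generated by the exponentials of a real subspace. -/

section

variable {𝔨 : Submodule ℝ (Matrix (Fin 4) (Fin 4) ℂ)}

theorem expGL_mem {X : Matrix (Fin 4) (Fin 4) ℂ} (hX : X ∈ 𝔨) : expGL X ∈ expGroup 𝔨 :=
  Subgroup.subset_closure ⟨X, hX, rfl⟩

theorem expGroup_conj_mem (hbr : ∀ X ∈ 𝔨, ∀ Y ∈ 𝔨, X * Y - Y * X ∈ 𝔨) {g : GL (Fin 4) ℂ}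
    (hg : g ∈ expGroup 𝔨) : (∀ X ∈ 𝔨, g.val * X * g⁻¹.val ∈ 𝔨) ∧
      ∀ X ∈ 𝔨, g⁻¹.val * X * g.val ∈ 𝔨 := by
  induction hg using Subgroup.closure_induction with
  | mem g hg =>
    obtain ⟨Y, hY, e⟩ := hg
    have e' : g⁻¹.val = NormedSpace.exp (-Y) := by
      rw [Matrix.coe_units_inv, e, Matrix.exp_neg]
    rw [e, e']
    refine ⟨fun X hX => matrix_exp_conj_mem (hbr Y hY) hX, fun X hX => ?_⟩
    have := matrix_exp_conj_mem (hbr (-Y) (𝔨.neg_mem hY)) hX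
    rwa [neg_neg] at this
  | one => simp
  | mul a b _ _ ha hb =>
    refine ⟨fun X hX => ?_, fun X hX => ?_⟩
    · have := ha.1 _ (hb.1 X hX)
      simpa only [mul_inv_rev, Units.val_mul, mul_assoc] using this
    · have := hb.2 _ (ha.2 X hX)
      simpa only [mul_inv_rev, Units.val_mul, mul_assoc] using this
  | inv a _ ha => exact ⟨by simpa using ha.2, by simpa using ha.1⟩

theorem expGroup_normal {g : GL (Fin 4) ℂ} (hg : ∀ X ∈ 𝔨, g.val * X * g⁻¹.val ∈ 𝔨)
    {k : GL (Fin 4) ℂ} (hk : k ∈ expGroup 𝔨) : g * k * g⁻¹ ∈ expGroup 𝔨 := by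
  induction hk using Subgroup.closure_induction with
  | mem k hk =>
    obtain ⟨Y, hY, e⟩ := hk
    refine Subgroup.subset_closure ⟨_, hg Y hY, ?_⟩
    rw [Matrix.exp_units_conj, Units.val_mul, Units.val_mul, e]
  | one => simp
  | mul a b _ _ ha hb =>
    have := mul_mem ha hb
    rwa [show g * a * g⁻¹ * (g * b * g⁻¹) = g * (a * b) * g⁻¹ by group] at this
  | inv a _ ha =>
    have := inv_mem ha
    rwa [show (g * a * g⁻¹)⁻¹ = g * a⁻¹ * g⁻¹ by group] at this

theorem expGroup_comm {M : Matrix (Fin 4) (Fin 4) ℂ} (h𝔨 : ∀ X ∈ 𝔨, Commute X M)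
    {k : GL (Fin 4) ℂ} (hk : k ∈ expGroup 𝔨) : Commute k.val M := by
  induction hk using Subgroup.closure_induction with
  | mem k hk =>
    obtain ⟨Y, hY, e⟩ := hk
    rw [e]
    exact Commute.exp_left (h𝔨 Y hY)
  | one => exact Commute.one_left M
  | mul a b _ _ ha hb => exact ha.mul_left hb
  | inv a _ ha => exact ha.units_inv_left

theorem expGroup_det (h𝔨 : ∀ X ∈ 𝔨, (NormedSpace.exp X).det = 1)
    {k : GL (Fin 4) ℂ} (hk : k ∈ expGroup 𝔨) : k.val.det = 1 := by
  induction hk using Subgroup.closure_induction with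
  | mem k hk =>
    obtain ⟨Y, hY, e⟩ := hk
    rw [e, h𝔨 Y hY]
  | one => simp
  | mul a b _ _ ha hb => rw [Units.val_mul, Matrix.det_mul, ha, hb, one_mul]
  | inv a _ ha =>
    have := congrArg Matrix.det a.mul_inv
    rwa [Matrix.det_mul, ha, one_mul, Matrix.det_one] at this

theorem heisU_center_inv (s : ℝ) : (heisU (isHeis_center s))⁻¹ = heisU (isHeis_center (-s)) := by
  rw [inv_eq_iff_mul_eq_one]
  apply U31_ext
  rw [toMat_mul, toMat_heisU, toMat_heisU, heisMat_mul, toMat_one]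
  ext i j
  fin_cases i <;> fin_cases j <;> simp [heisMat]

/-- For N = iE₀₃, half of (1+N)X(1-N) + (1-N)X(1+N) - 2X is -NXN = X₃₀E₀₃. -/
theorem single_mem_of_conj (hconj : ∀ g : U31, (toMat g).det = 1 → ∀ X ∈ 𝔨,
    toMat g * X * toMat g⁻¹ ∈ 𝔨) {X : Matrix (Fin 4) (Fin 4) ℂ} (hX : X ∈ 𝔨) :
    Matrix.single 0 3 (X 3 0) ∈ 𝔨 := by
  have h1 := hconj _ (det_heisU (isHeis_center 1)) X hX
  have h2 := hconj _ (det_heisU (isHeis_center (-1))) X hX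
  rw [heisU_center_inv, toMat_heisU, toMat_heisU] at h1 h2
  have h3 := 𝔨.smul_mem (1 / 2 : ℝ) (𝔨.sub_mem (𝔨.add_mem h1 h2) (𝔨.smul_mem (2 : ℝ) hX))
  convert h3 using 1
  ext i j
  have hI := Complex.I_sq
  simp only [Matrix.smul_apply, Matrix.sub_apply, Matrix.add_apply, Matrix.mul_apply,
    Fin.sum_univ_four, Matrix.single_apply]
  clear h1 h2 h3
  fin_cases i <;> fin_cases j <;> simp [heisMat] <;> ring_nf
  simp

theorem toMat_weylU_center : toMat (weylU * heisU (isHeis_center (1 / 2)) * (weylU *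
    heisU (isHeis_center 2)) * (weylU * heisU (isHeis_center (1 / 2)))) =
      Matrix.diagonal ![2, 1, 1, 1 / 2] := by
  have hI := Complex.I_mul_I
  have e : ∀ t : ℝ, toMat (weylU * heisU (isHeis_center t)) =
      !![0, 0, 0, Complex.I; 0, 1, 0, 0; 0, 0, 1, 0; Complex.I, 0, 0, -t] := by
    intro t
    rw [toMat_mul, toMat_weylU, toMat_heisU]
    ext i j
    fin_cases i <;> fin_cases j <;>
      simp [weylMat, heisMat, Matrix.mul_apply, Fin.sum_univ_four]
    linear_combination (t : ℂ) * hI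
  rw [toMat_mul, toMat_mul, e, e]
  ext i j
  simp only [Matrix.mul_apply, Fin.sum_univ_four]
  fin_cases i <;> fin_cases j <;> simp
  · linear_combination -2 * hI
  · linear_combination -(2⁻¹ : ℂ) * hI

section

variable (hle : expGroup 𝔨 ≤ U31) (hconj : ∀ g : U31, (toMat g).det = 1 → ∀ X ∈ 𝔨,
  toMat g * X * toMat g⁻¹ ∈ 𝔨) {X : Matrix (Fin 4) (Fin 4) ℂ} (hX : X ∈ 𝔨) (hX0 : X 3 0 ≠ 0)
include hle hconj hX hX0

/-- Since exp(xE₀₃) = 1 + xE₀₃ preserves the form, x = X₃₀ is purely imaginary, and its real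
multiples exhaust the central translations. -/
theorem heisU_center_mem_expGroup (t : ℝ) : (heisU (isHeis_center t)).val ∈ expGroup 𝔨 := by
  have hS := single_mem_of_conj hconj hX
  set x := X 3 0 with hx
  have hsq : ∀ y : ℂ, Matrix.single (0 : Fin 4) (3 : Fin 4) y * Matrix.single 0 3 y = 0 := by
    intro y
    rw [Matrix.single_mul_single_of_ne]
    decide
  have hx1 := toMat_mem_apply ⟨expGL (Matrix.single 0 3 x), hle (expGL_mem hS)⟩ 3 3
  have e : toMat ⟨expGL (Matrix.single 0 3 x), hle (expGL_mem hS)⟩ =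
      1 + Matrix.single (0 : Fin 4) (3 : Fin 4) x := exp_eq_one_add (hsq x)
  rw [e] at hx1
  simp [siegelJ] at hx1
  have hre : x.re = 0 := by
    have := congrArg Complex.re hx1
    simp at this
    linarith
  have him : x.im ≠ 0 := fun h0 => hX0 (Complex.ext (by simpa using hre) (by simpa using h0))
  refine Subgroup.subset_closure ⟨_, 𝔨.smul_mem (t / x.im) hS, ?_⟩
  rw [Matrix.smul_single, exp_eq_one_add (hsq _)]
  have ex : (t / x.im) • x = Complex.I * t := by
    apply Complex.ext
    · simp [hre]
    · simp
      field_simp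
  rw [ex]
  change heisMat 0 0 (Complex.I * t) = _
  ext i j
  fin_cases i <;> fin_cases j <;> simp [heisMat]

/-- The group is normalized by SU(3,1) and contains the centre of the Heisenberg group, hence a Weyl
element and the dilation diag(2, 1, 1, 1/2). Commutators with the dilation give the rest of the
Heisenberg group. -/
theorem mem_expGroup_of_det_eq_one {g : U31} (hg : (toMat g).det = 1) : g.val ∈ expGroup 𝔨 := by
  set H := (expGroup 𝔨).subgroupOf U31 with hH
  have hc : ∀ t : ℝ, heisU (isHeis_center t) ∈ H := heisU_center_mem_expGroup hle hconj hX hX0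
  have hnorm : ∀ g : U31, (toMat g).det = 1 → ∀ k ∈ H, g * k * g⁻¹ ∈ H := by
    intro g hg k hk
    exact expGroup_normal (g := g.val) (hconj g hg) hk
  have hA2 : (spinU weylC)⁻¹ = spinU weylC := by
    rw [inv_eq_iff_mul_eq_one]
    apply U31_ext
    rw [toMat_mul, toMat_spinU_weylC, toMat_one]
    ext i j
    fin_cases i <;> fin_cases j <;> simp [matA, Matrix.mul_apply, Fin.sum_univ_four]
  have hAd : (toMat (spinU weylC)).det = 1 := by
    rw [toMat_spinU_weylC]
    simp [matA, Matrix.det_succ_row_zero, Fin.sum_univ_succ, Fin.succAbove]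
    norm_num
  have hW : weylU ∈ H := by
    have := hnorm _ hAd _ (hc 1)
    rw [hA2] at this
    rw [weylU_eq]
    exact H.mul_mem (H.mul_mem (hc 1) this) (hc 1)
  obtain ⟨δ, hδm, hδe⟩ : ∃ δ ∈ H, toMat δ = Matrix.diagonal ![2, 1, 1, 1 / 2] :=
    ⟨_, H.mul_mem (H.mul_mem (H.mul_mem hW (hc _)) (H.mul_mem hW (hc _))) (H.mul_mem hW (hc _)),
      toMat_weylU_center⟩
  refine mem_of_det_eq_one (H := H) (fun {v w b} h => ?_) hW hg
  have h2 : (starRingEnd ℂ) (2 : ℂ) = 2 := map_ofNat _ 2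
  have h' : IsHeis v w (-(v * (starRingEnd ℂ) v + w * (starRingEnd ℂ) w) / 2) := by
    unfold IsHeis
    simp [h2]
    ring
  have h'' : IsHeis (-v) (-w) (-(v * (starRingEnd ℂ) v + w * (starRingEnd ℂ) w) / 2) := by
    unfold IsHeis
    simp [h2]
    ring
  have hinv : (heisU h'')⁻¹ = heisU h' := by
    rw [inv_eq_iff_mul_eq_one]
    apply U31_ext
    rw [toMat_mul, toMat_heisU, toMat_heisU, heisMat_mul, toMat_one]
    ext i j
    fin_cases i <;> fin_cases j <;> simp [heisMat]
    ring
  -- The dilation doubles (v, w), so the commutator of the translation by -(v, w) with it is the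
  -- translation by (v, w).
  have e : heisU h'' * δ * (heisU h'')⁻¹ = heisU h' * δ := by
    rw [hinv]
    apply U31_ext
    rw [toMat_mul, toMat_mul, toMat_mul, hδe, toMat_heisU, toMat_heisU]
    ext i j
    simp only [Matrix.mul_apply, Fin.sum_univ_four, Matrix.diagonal_apply]
    fin_cases i <;> fin_cases j <;> simp [heisMat] <;> ring
  have := hnorm _ (det_heisU h'') _ hδm
  rw [e, H.mul_mem_cancel_right hδm] at this
  exact heisU_center_mem_of hc h' h this

end

/-- The determinant of the one-parameter subgroup of X is a nontrivial one-parameter subgroup of the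
circle, hence takes the value det g. -/
theorem expGroup_eq_of_det_ne_one (hle : expGroup 𝔨 ≤ U31)
    (hS : ∀ g : U31, (toMat g).det = 1 → g.val ∈ expGroup 𝔨)
    {X : Matrix (Fin 4) (Fin 4) ℂ} (hX : X ∈ 𝔨) (hdet : (NormedSpace.exp X).det ≠ 1) :
    expGroup 𝔨 = U31 := by
  refine le_antisymm hle fun g hg => ?_
  have hm : ∀ s : ℝ, expGL (s • X) ∈ expGroup 𝔨 := fun s => expGL_mem (𝔨.smul_mem s hX)
  obtain ⟨s, hs⟩ := exists_eq_of_oneParameter (f := fun s : ℝ => (NormedSpace.exp (s • X)).det)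
    (continuous_exp_smul X).matrix_det (fun s => normSq_det ⟨expGL (s • X), hle (hm s)⟩)
    (fun s t => by
      rw [add_smul, Matrix.exp_add_of_commute _ _
        (((Commute.refl X).smul_left s).smul_right t), Matrix.det_mul])
    (s₀ := 1) (by simpa using hdet) (normSq_det ⟨g, hg⟩)
  set k : U31 := ⟨expGL (s • X), hle (hm s)⟩ with hk
  have h0 : (toMat k).det ≠ 0 := by
    intro h0; have := normSq_det k; rw [h0] at this; simp at this
  have hd : (toMat (k⁻¹ * ⟨g, hg⟩)).det = 1 := by
    have h3 := det_toMat_mul k (k⁻¹ * ⟨g, hg⟩)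
    rw [mul_inv_cancel_left] at h3
    exact (mul_left_cancel₀ h0 (by rw [mul_one, ← h3]; exact hs)).symm
  have := mul_mem (hm s) (hS _ hd)
  simpa [hk] using this

end

theorem connectedLieSubgroup_eq {d : ℕ} (hd : Admissible d) {u : Circle} {ρ : Bi d →* U31}
    (h : IsBending d u ρ) (h1 : (u : ℂ) ≠ 1) (h2 : (u : ℂ) ≠ -1) {K : Subgroup (GL (Fin 4) ℂ)}
    (hK : IsConnectedLieSubgroup K) (hle : K ≤ U31) (hρ : ∀ γ, (ρ γ).val ∈ K) : K = U31 := by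
  obtain ⟨𝔨, hbr, rfl⟩ := hK
  change expGroup 𝔨 ≤ U31 at hle
  change ∀ γ, (ρ γ).val ∈ expGroup 𝔨 at hρ
  change expGroup 𝔨 = U31
  have hconj : ∀ g : U31, (toMat g).det = 1 → ∀ X ∈ 𝔨, toMat g * X * toMat g⁻¹ ∈ 𝔨 := by
    intro g hg X hX
    refine conj_mem_of_zariski (S := Set.range ρ) ?_
      (mem_zariskiClosure_of_det_eq_one hd h h1 h2 hg) hX
    rintro _ ⟨γ, rfl⟩ Y hY
    exact (expGroup_conj_mem hbr (hρ γ)).1 Y hY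
  -- Otherwise stability under SU(3,1) makes every element of the Lie algebra scalar, and T₁ would
  -- commute with the Siegel matrix.
  obtain ⟨X, hX, hX0⟩ : ∃ X ∈ 𝔨, X 3 0 ≠ 0 := by
    by_contra! hall
    have hs : ∀ X ∈ 𝔨, Commute X siegelJ := by
      intro X hX
      rw [eq_scalar_of_conj (X := X) fun g hg => ?_]
      · exact (Commute.one_left _).smul_left _
      · have hg' : (toMat g⁻¹).det = 1 := by
          have := det_toMat_mul g g⁻¹
          rw [mul_inv_cancel, hg, toMat_one, Matrix.det_one, one_mul] at this
          exact this.symm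
        have := hconj g⁻¹ hg' X hX
        rw [inv_inv] at this
        exact hall _ this
    have hc : toMat (ρ (tElt d)) * siegelJ = siegelJ * toMat (ρ (tElt d)) :=
      expGroup_comm hs (hρ (tElt d))
    rw [bending_t hd h] at hc
    have := congrFun (congrFun hc 0) 0
    simp [matT, siegelJ, Matrix.mul_apply, Fin.sum_univ_four] at this
  -- Otherwise all of K has determinant one, against det U_u = u ≠ 1.
  obtain ⟨Y, hY, hY1⟩ : ∃ Y ∈ 𝔨, (NormedSpace.exp Y).det ≠ 1 := by
    by_contra! hall
    have hdet : (toMat (ρ (uElt d))).det = 1 := expGroup_det hall (hρ (uElt d))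
    rw [bending_u h, matU] at hdet
    apply h1
    split_ifs at hdet <;> simpa [Matrix.det_succ_row_zero, Fin.sum_univ_succ, Fin.succAbove] using hdet
  exact expGroup_eq_of_det_ne_one hle (fun g hg => mem_expGroup_of_det_eq_one hle hconj hX hX0 hg)
    hY hY1

end BianchiBending

end

theorem proposition4p6 (d : ℕ) (hd : Squarefree d) (hd1 : d ≠ 1) (hd3 : d ≠ 3) :
    -- for `d = 2, 7, 11` the matrices `A₁, T₁, U_u` define a (unique) representation
    ((d = 2 ∨ d = 7 ∨ d = 11) → ∀ u : Circle,
      ∃! ρ : Bi d →* U31,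
        toMat (ρ (aElt d)) = matA ∧ toMat (ρ (tElt d)) = matT ∧ toMat (ρ (uElt d)) = matU d u) ∧
    -- for all `d ≠ 1, 3` they extend to a representation, the bending deformation `ρ_u`
    (∀ u : Circle, ∃! ρ : Bi d →* U31, IsBending d u ρ) ∧
    (∀ (u : Circle) (ρ : Bi d →* U31), IsBending d u ρ →
      toMat (ρ (aElt d)) = matA ∧ toMat (ρ (tElt d)) = matT ∧ toMat (ρ (uElt d)) = matU d u ∧
        (toMat (ρ (uElt d))).trace = 3 + u) ∧
    -- pairwise non-conjugate, even in `GL(4,ℂ)`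
    (∀ (u u' : Circle) (ρ ρ' : Bi d →* U31), IsBending d u ρ → IsBending d u' ρ' → u ≠ u' →
      ¬ ∃ g : GL (Fin 4) ℂ, ∀ γ, g * (ρ γ).val * g⁻¹ = (ρ' γ).val) ∧
    -- parabolic-preserving
    (∀ (u : Circle) (ρ : Bi d →* U31), IsBending d u ρ → (u : ℂ) ≠ -1 →
      IsParabolicPreserving (rho1 d) ρ) ∧
    -- strongly parabolic-preserving
    ((d % 4 = 1 ∨ d % 4 = 2) → ∀ (u : Circle) (ρ : Bi d →* U31), IsBending d u ρ →
      (u : ℂ) ≠ -1 → IsStronglyParabolicPreserving (rho1 d) ρ) ∧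
    (∀ (u : Circle) (ρ : Bi d →* U31), IsBending d u ρ → (u : ℂ) ≠ 1 → (u : ℂ) ≠ -1 →
      -- the image lies in no proper connected Lie subgroup of `U(3,1)`
      (∀ K : Subgroup (GL (Fin 4) ℂ), IsConnectedLieSubgroup K → K ≤ U31 →
        (∀ γ, (ρ γ).val ∈ K) → K = U31) ∧
      -- the Zariski closure of the image contains `SU(3,1)`
      (∀ g : U31, (toMat g).det = 1 → g ∈ zariskiClosure (Set.range ρ)) ∧
      -- the image is Zariski-dense in `U(3,1)` if `u` is not a root of unity
      ((∀ k : ℕ, 0 < k → (u : ℂ) ^ k ≠ 1) → zariskiClosure (Set.range ρ) = Set.univ)) := by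
  have hA : Admissible d := ⟨hd, hd1, hd3⟩
  refine ⟨fun hd' u => existsUnique_of_generators hA hd' u,
    fun u => ⟨bendBi hA u, isBending_bendBi hA u, fun ρ h => eq_bendBi hA h⟩,
    fun u ρ h => ⟨bending_a hA h, bending_t hA h, bending_u h, bending_trace h⟩,
    fun u u' ρ ρ' h h' hne => not_conjugate_of_ne h h' hne,
    fun u ρ h hu => isParabolicPreserving_bending hA h hu,
    fun hmod u ρ h hu => isStronglyParabolicPreserving_bending hA hmod h hu, ?_⟩
  exact fun u ρ h h1 h2 => ⟨fun K hK hle hmem => connectedLieSubgroup_eq hA h h1 h2 hK hle hmem,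
    fun g hg => mem_zariskiClosure_of_det_eq_one hA h h1 h2 hg,
    fun hu => zariskiClosure_eq_univ hA h h1 h2 hu⟩
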